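/- **Model.** In the external-memory (I/O) model of Aggarwal and Vitter with parameters $B \ge 1$ and $M \ge 2B$, main memory consists of $M$ cells and external memory of an unbounded sequence of cells divided into blocks of $B$ consecutive cells; each cell holds one element. On an input graph with $n$ vertices and $m$ edges an element (and likewise a block address) is a natural number below $(n+m+2)^{d}$ for a fixed constant $d$, i.e. it has $O(\log(n+m+2))$ bits. An algorithm may depend on $M$ and $B$ but not on the input; it has a finite control whose number of states is independent of $M$, $B$ and the input, and otherwise it knows only the contents of main memory. Computation in main memory is free: between I/Os the control state and the main memory may be changed by any function of themselves. One I/O reads one block into main memory, writes one block from main memory to external memory, or appends at most $B$ elements from main memory to a write-only output file. Write $\mathrm{scan}(N) = \max\{1, \lceil N/B\rceil\}$ and $\mathrm{sort}(N) = \mathrm{scan}(N)\cdot\max\{1, \log_{M/B}(N/B)\}$. **Input.** A finite simple undirected graph $G$ with vertex set $\{0,\dots,n-1\}$ and $m$ edges is stored contiguously at the beginning of external memory in adjacency row representation: the numbers $n$ and $m$, then an array $P$ with $n$ entries and an array $E$ with $2m$ entries, where $E$ is the concatenation, over the vertices $v = 0,\dots,n-1$, of the lists of neighbours of $v$ (each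 neighbour once, in arbitrary order), and $P[v]$ is the position in $E$ at which the list of $v$ begins. Main memory is initially zero. A *split partition* of $G$ is a partition of its vertex set into two (possibly empty) sets $K$ and $I$ such that $K$ is a clique and $I$ is an independent set; $G$ is a *split graph* if it has a split partition. $2K_2$ is the graph on $\{a,b,c,d\}$ with the two edges $ab$ and $cd$. **Lemma.** There are an algorithm in this model and constants $d$ and $C$ such that, for all $M, B$ with $B \ge 1$ and $M \ge 2B$ and for every graph $G$ with $n$ vertices and $m$ edges stored in external memory in adjacency row representation: * if $G$ is a split graph, then the algorithm announces this after at most $C\cdot\mathrm{sort}(n+m)$ I/Os, having output nothing so far, and then, within at most $C\cdot\mathrm{scan}(|K|+|I|)$ further I/Os, it outputs a split partition $(K,I)$ of $G$ (in the form: $|K|$, the vertices of $K$, the vertices of $I$, each once) and halts; * if $G$ is not a split graph, then the algorithm announces this, outputs four or five vertices that induce a $C_4$, a $C_5$ or a $2K_2$ in $G$ (listed in cyclic order in the case of a cycle, and as $a,b,c,d$ in the case of a $2K_2$ with edges $ab$ and $cd$), and halts, using at most $C\cdot\mathrm{sort}(n+m)$ I/Os in total. -/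

import Mathlib

/-! ### Split graphs and their forbidden induced subgraphs -/

/-- `(K, I)` is a split partition of `G`: the vertex set is the disjoint union of the clique `K`
and the independent set `I` (either of which may be empty). -/
structure IsSplitPartition {V : Type*} (G : SimpleGraph V) (K I : Set V) : Prop where
  disjoint : Disjoint K I
  union : K ∪ I = Set.univ
  clique : G.IsClique K
  indep : G.IsIndepSet I

/-- A split graph is a graph that has a split partition. -/
def IsSplitGraph {V : Type*} (G : SimpleGraph V) : Prop :=
  ∃ K I : Set V, IsSplitPartition G K I

/-- The graph `2K₂` on `{0, 1, 2, 3}`, with edges `01` and `23`. -/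
def twoK2 : SimpleGraph (Fin 4) := SimpleGraph.fromEdgeSet {s(0, 1), s(2, 3)}

/-- The list `l` enumerates, in the order of the vertices `0, …, k - 1` of `H`, the vertices of an
induced subgraph of `G` that is isomorphic to `H`. -/
def InducedCopy {V : Type*} (G : SimpleGraph V) {k : ℕ} (H : SimpleGraph (Fin k))
    (l : List V) : Prop :=
  ∃ f : H ↪g G, l = List.ofFn f

/-! ### Adjacency row representation -/

/-- An adjacency row representation of a graph on the vertices `0, …, n - 1`: for every vertex the
list of its neighbours, without repetition and in an arbitrary order. -/
structure AdjacencyRows {n : ℕ} (G : SimpleGraph (Fin n)) where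
  row : Fin n → List (Fin n)
  nodup : ∀ v, (row v).Nodup
  mem_row : ∀ v w, w ∈ row v ↔ G.Adj v w

namespace AdjacencyRows

variable {n : ℕ} {G : SimpleGraph (Fin n)}

/-- The edge array `E`: the concatenation of all rows. Every edge occurs in two rows. -/
def edgeArray (R : AdjacencyRows G) : List ℕ :=
  (List.ofFn R.row).flatten.map Fin.val

/-- The array `P`: its `i`-th entry is the position in `E` at which the row of vertex `i` begins. -/
def posArray (R : AdjacencyRows G) : List ℕ :=
  List.ofFn fun i : Fin n => ∑ j ∈ Finset.univ.filter (· < i), (R.row j).length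

/-- The contents of the input file: the numbers `n` and `m` of vertices and edges, then the arrays
`P` and `E`. -/
noncomputable def input (R : AdjacencyRows G) : List ℕ :=
  n :: G.edgeSet.ncard :: (R.posArray ++ R.edgeArray)

end AdjacencyRows

/-! ### The I/O model (external memory model)

Main memory consists of `M` cells and external memory of infinitely many cells, each cell holding
one element (a natural number; its size is restricted in `Step` below). External memory is divided
into blocks of `B` consecutive cells: block `a` consists of the cells `a * B, …, a * B + B - 1`.
Computation in main memory is free, an I/O moves one block between external and main memory. -/

/-- What an algorithm does next. Each instruction other than `halt` first replaces the control state
by `s` and the contents of main memory by `mem`, the results of a free computation in main memory.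
As the contents of main memory can be rearranged for free, a transferred block is always read into,
or written from, the first `B` cells of main memory. -/
inductive Instr (S : Type) (M : ℕ) where
  /-- one I/O: read block `a` -/
  | read (s : S) (mem : Fin M → ℕ) (a : ℕ)
  /-- one I/O: write block `a` -/
  | write (s : S) (mem : Fin M → ℕ) (a : ℕ)
  /-- one I/O: append the first `k` cells (at most `B`) of main memory to the output file -/
  | emit (s : S) (mem : Fin M → ℕ) (k : ℕ)
  /-- announce the answer "yes" (`true`) or "no" (`false`), for free -/
  | announce (s : S) (mem : Fin M → ℕ) (b : Bool)
  | halt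

/-- An algorithm in the I/O model: it may depend on `M` and `B`, it has finitely many control states
(their number depends on nothing), and besides the control state it knows only the contents of main
memory. It does not depend on the input. -/
structure IOAlgorithm where
  numStates : ℕ
  start : Fin numStates
  prog : (M B : ℕ) → Fin numStates → (Fin M → ℕ) → Instr (Fin numStates) M

namespace IOAlgorithm

/-- A configuration of a run. The fields `answer`, `out` and `ios` (the announced answer, the
contents of the output file, and the number of I/Os so far) cannot be read by the algorithm. -/
structure Config (A : IOAlgorithm) (M : ℕ) where
  state : Fin A.numStates
  mem : Fin M → ℕ
  disk : ℕ → ℕ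
  answer : Option Bool
  out : List ℕ
  ios : ℕ

/-- The contents of cell `i` of main memory (and `0` if there is no such cell). -/
def cell {M : ℕ} (mem : Fin M → ℕ) (i : ℕ) : ℕ := if h : i < M then mem ⟨i, h⟩ else 0

variable (A : IOAlgorithm) (M B : ℕ)

/-- Initially the external memory holds the input, followed by zeros, main memory is all zero, and
nothing has been announced or output. -/
def init (input : List ℕ) : A.Config M where
  state := A.start
  mem := fun _ => 0
  disk := fun i => input.getD i 0
  answer := none
  out := []
  ios := 0

variable {A M}

/-- The instruction that the algorithm executes in a configuration. -/
def current (c : A.Config M) : Instr (Fin A.numStates) M := A.prog M B c.state c.mem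

/-- The configuration after the next instruction, `none` if that is `halt`. Only the first
announcement counts. -/
def next (c : A.Config M) : Option (A.Config M) :=
  match current B c with
  | .read s mem a => some { c with
      state := s
      mem := fun i => if (i : ℕ) < B then c.disk (a * B + i) else mem i
      ios := c.ios + 1 }
  | .write s mem a => some { c with
      state := s
      mem := mem
      disk := fun i => if i / B = a then cell mem (i % B) else c.disk i
      ios := c.ios + 1 }
  | .emit s mem k => some { c with
      state := s
      mem := mem
      out := c.out ++ (List.range (min k B)).map (cell mem)
      ios := c.ios + 1 }
  | .announce s mem b => some { c with
      state := s
      mem := mem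
      answer := c.answer.or (some b) }
  | .halt => none

/-- The block address of a reading or writing instruction is smaller than `W`. -/
def AddressLT (W : ℕ) {S : Type} : Instr S M → Prop
  | .read _ _ a => a < W
  | .write _ _ a => a < W
  | _ => True

/-- One step of a run on a machine whose elements and block addresses are smaller than `W`. -/
def Step (W : ℕ) (c c' : A.Config M) : Prop :=
  next B c = some c' ∧ AddressLT W (current B c) ∧ ∀ i, c'.mem i < W

/-- Finitely many steps lead from `c` to `c'`. -/
def Reaches (W : ℕ) : A.Config M → A.Config M → Prop := Relation.ReflTransGen (Step B W)

/-- The algorithm has halted. -/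
def Halted (c : A.Config M) : Prop := next B c = none

end IOAlgorithm

/-- `scan(N) = ⌈N / B⌉`, and at least one I/O. -/
noncomputable def scanIO (B N : ℕ) : ℝ := max 1 (⌈(N : ℝ) / B⌉₊ : ℝ)

/-- `sort(N) = ⌈N / B⌉ · log_{M/B} (N / B)`, where both factors are at least one. -/
noncomputable def sortIO (M B N : ℕ) : ℝ :=
  scanIO B N * max 1 (Real.logb ((M : ℝ) / B) ((N : ℝ) / B))

/-! ### Read-only programs with two cached blocks and a buffered output -/

/-! Order the vertices by degree, ties broken by index, and cut this order where the number of
vertices above the cut fits the degrees: every vertex of the upper part `K` has degree at least `|K|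
- 1`, every vertex of the lower part `I` has degree at most `|K| - 1` (`exists_threshold`). This one
candidate decides the problem: either it is a split partition, or any violation of it leads to an
obstruction, and an obstruction excludes every split partition (`Obstruction.not_isSplitGraph`).

Let the violation be an edge `ab` inside `I`. A non-edge inside `K` is the same situation in the
complement, since the degree conditions needed are inherited and the class `C₄`, `C₅`, `2K₂` is
closed under complements (`exists_obstruction_of_compl`). The vertex `a` has too few neighbours to
see `b` and all of `K`, so some `x` in `K` is not adjacent to `a`; likewise some `y` in `K` is not
adjacent to `b`, and `x = y` is chosen if possible (`exists_not_adj`). Since `x` has at least the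
degree of `b` and misses the neighbour `a` of `b`, it has a neighbour `e` not adjacent to `b`;
likewise `y` has a neighbour `f` not adjacent to `a` (`exists_adj_not_adj`). The vertices `a, b, x,
y, e, f` contain an obstruction (`exists_obstruction`).

No sorting takes place. The cut is the least number satisfying a monotone predicate. So is the
length of the shortest prefix `0, …, i - 1` of the vertices containing a violation, because prefixes
without violation are recognised by counting adjacencies (`count_eq_iff`). With `k = M - B` counters
one pass over the graph tests `k` candidates and shrinks the range of a search by the factor `k + 1`
(`search_next`). As `M - B + 1` is at least the square root of `M`, the number of passes is
`O(max(1, log_{M/B}(N/B)))` (`clog_le`), and a pass costs `O(scan(N))` I/Os (`passCost_le`). The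
last vertex of the shortest violating prefix serves as `a`; it and the other vertices are recorded
in seven further passes (`exists_obstruction_recsAt`).

The program is written for a machine with one cached block for each of the arrays `P` and `E` and
with an output buffer. State, caches and buffer are packed into the `M - B ≥ B` cells above the
transfer area, with polynomially bounded entries, and I/Os are then exactly cache misses and flushed
output blocks (`Simulates.step`, `Simulates.halts`). -/

/-- What a cached program does next: a free internal step, reading the cell `x` of external memory
through the cache `b`, appending an element to the output, announcing an answer, or halting. -/
inductive Act (σ : Type) where
  | tau (s : σ)
  | get (b : Bool) (x : ℕ) (f : ℕ → σ)
  | put (x : ℕ) (s : σ)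
  | ann (b : Bool) (s : σ)
  | halt

/-- A configuration of a cached program: `tag b` is one more than the block held by the cache `b`
(zero if the cache is empty), and `cost` counts the cache misses. -/
structure AConf (σ : Type) where
  s : σ
  tag : Bool → ℕ
  out : List ℕ
  ans : Option Bool
  cost : ℕ

namespace AConf

variable {σ : Type}

/-- The next configuration of a cached program that works on the external memory `D`. -/
def next (δ : σ → Act σ) (D : ℕ → ℕ) (B : ℕ) (α : AConf σ) : Option (AConf σ) :=
  match δ α.s with
  | .tau s => some { α with s := s }
  | .get b x f => some { α with
      s := f (D x)
      tag := Function.update α.tag b (x / B + 1)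
      cost := α.cost + if α.tag b = x / B + 1 then 0 else 1 }
  | .put x s => some { α with s := s, out := α.out ++ [x] }
  | .ann b s => some { α with s := s, ans := α.ans.or (some b) }
  | .halt => none

/-- All numbers occurring in the configuration are smaller than `X`. -/
structure Tame (enc : σ → ℕ → ℕ) (X : ℕ) (α : AConf σ) : Prop where
  enc_lt : ∀ j, enc α.s j < X
  tag_lt : ∀ b, α.tag b < X
  out_lt : ∀ x ∈ α.out, x < X
  length_lt : α.out.length < X

/-- One step between configurations with small numbers. -/
def Step (δ : σ → Act σ) (enc : σ → ℕ → ℕ) (D : ℕ → ℕ) (B X : ℕ) (α α' : AConf σ) : Prop :=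
  next δ D B α = some α' ∧ Tame enc X α'

end AConf

/-! ### Layout of main memory -/

/-- The information kept in main memory while a cached program runs. -/
structure Layer (σ : Type) (B : ℕ) where
  s : σ
  tag : Bool → ℕ
  cache : Bool → Fin B → ℕ
  buf : List ℕ

theorem getD_lt {X : ℕ} (hX : 0 < X) {l : List ℕ} (h : ∀ x ∈ l, x < X) (j : ℕ) :
    l.getD j 0 < X := by
  by_cases hj : j < l.length
  · rw [List.getD_eq_getElem _ _ hj]
    exact h _ (List.getElem_mem hj)
  · rw [List.getD_eq_default _ _ (by omega)]
    exact hX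

namespace Layer

open IOAlgorithm (cell)

variable {σ : Type} {B : ℕ}

/-- The next step, if it is possible without any I/O. -/
def free (δ : σ → Act σ) (L : Layer σ B) : Option (Layer σ B) :=
  match δ L.s with
  | .tau s => some { L with s := s }
  | .get b x f =>
    if L.tag b = x / B + 1 then some { L with s := f (cell (L.cache b) (x % B)) } else none
  | .put x s => if L.buf.length < B then some { L with s := s, buf := L.buf ++ [x] } else none
  | .ann _ _ => none
  | .halt => none

open Classical in
/-- The state in which the next I/O takes place. -/
noncomputable def normal (δ : σ → Act σ) (L : Layer σ B) : Layer σ B :=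
  if h : (StateTransition.eval (free δ) L).Dom then (StateTransition.eval (free δ) L).get h else L

/-- Free steps are deterministic, so at most one stuck layer is reachable, and it suffices to
exhibit one. The fallback value of `normal` for non-terminating free computations then plays no
role. -/
theorem normal_eq {δ : σ → Act σ} {L L' : Layer σ B}
    (h : StateTransition.Reaches (free δ) L L') (h' : free δ L' = none) : normal δ L = L' := by
  have hm : L' ∈ StateTransition.eval (free δ) L := StateTransition.mem_eval.2 ⟨h, h'⟩
  obtain ⟨hd, he⟩ := hm
  rw [normal, dif_pos hd, he]

/-- The contents of the `j`-th cell above the transfer area. -/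
def code (enc : σ → ℕ → ℕ) (L : Layer σ B) (j : ℕ) : ℕ :=
  Nat.pair (enc L.s j) (Nat.pair (cell (L.cache false) j) (Nat.pair (cell (L.cache true) j)
    (Nat.pair (L.buf.getD j 0) (Nat.pair L.buf.length (Nat.pair (L.tag false) (L.tag true))))))

/-- Cell `j` carries the `j`-th entries of both caches and of the buffer, so `k` cells suffice for
all of them. The length of the buffer is stored separately because padding by zeros would hide it.
-/
theorem code_injOn {enc : σ → ℕ → ℕ} {k : ℕ} (hk : 0 < k) (hB : B ≤ k)
    (henc : ∀ s s', (∀ j < k, enc s j = enc s' j) → s = s') :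
    Set.InjOn (fun (L : Layer σ B) (j : Fin k) => code enc L j) {L | L.buf.length ≤ k} := by
  rintro ⟨s, t, c, b⟩ h ⟨s', t', c', b'⟩ h' he
  have H : ∀ j < k, code enc ⟨s, t, c, b⟩ j = code enc ⟨s', t', c', b'⟩ j :=
    fun j hj => congrFun he ⟨j, hj⟩
  simp only [code, Nat.pair_eq_pair] at H
  have h0 := H 0 hk
  obtain rfl : s = s' := henc _ _ fun j hj => (H j hj).1
  obtain rfl : t = t' := by
    funext x
    cases x
    · exact h0.2.2.2.2.2.1
    · exact h0.2.2.2.2.2.2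
  obtain rfl : c = c' := by
    funext x i
    have := H i (i.2.trans_le hB)
    simp only [cell, i.2, dif_pos] at this
    cases x
    · exact this.2.1
    · exact this.2.2.1
  obtain rfl : b = b' := by
    refine List.ext_getElem h0.2.2.2.2.1 fun i hi hi' => ?_
    have := (H i (hi.trans_le h)).2.2.2.1
    rwa [List.getD_eq_getElem _ _ hi, List.getD_eq_getElem _ _ hi'] at this
  rfl

theorem pair_lt_sq {a b X : ℕ} (ha : a < X) (hb : b < X) : Nat.pair a b < X ^ 2 :=
  (Nat.pair_lt_max_add_one_sq a b).trans_le (Nat.pow_le_pow_left (by omega) 2)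

/-- Six nested pairings, each squaring the bound, give the exponent `2 ^ 6 = 64`. -/
theorem code_lt {enc : σ → ℕ → ℕ} {X : ℕ} {L : Layer σ B} (hX : 0 < X)
    (hs : ∀ j, enc L.s j < X) (ht : ∀ b, L.tag b < X) (hc : ∀ b i, L.cache b i < X)
    (hb : ∀ x ∈ L.buf, x < X) (hl : L.buf.length < X) (j : ℕ) : code enc L j < X ^ 64 := by
  have up : ∀ {a r s : ℕ}, r ≤ s → a < X ^ r → a < X ^ s := fun hrs h =>
    h.trans_le (Nat.pow_le_pow_right hX hrs)
  have pr : ∀ {a b r : ℕ}, a < X → b < X ^ (r + 1) → Nat.pair a b < X ^ ((r + 1) * 2) := by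
    intro a b r ha hb
    rw [pow_mul]
    exact pair_lt_sq (up (Nat.le_add_left 1 r) (by simpa using ha)) hb
  have cl : ∀ b, cell (L.cache b) j < X := by
    intro b
    unfold cell
    split
    · exact hc _ _
    · exact hX
  have bl : L.buf.getD j 0 < X := by
    by_cases h : j < L.buf.length
    · rw [List.getD_eq_getElem _ _ h]
      exact hb _ (List.getElem_mem h)
    · rw [List.getD_eq_default _ _ (by omega)]
      exact hX
  have h1 := pr (r := 0) (ht false) (by simpa using ht true)
  exact pr (r := 31) (hs j) (pr (r := 15) (cl _) (pr (r := 7) (cl _) (pr (r := 3) bl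
    (pr (r := 1) hl h1))))

/-- The contents of main memory: the transfer area followed by the encoded layer. -/
def pack (enc : σ → ℕ → ℕ) (M : ℕ) (low : ℕ → ℕ) (L : Layer σ B) : Fin M → ℕ :=
  fun i => if (i : ℕ) < B then low i else code enc L (i - B)

open Classical in
/-- The layer encoded in main memory. -/
noncomputable def unpack [Inhabited σ] (enc : σ → ℕ → ℕ) (B : ℕ) {M : ℕ} (mem : Fin M → ℕ) :
    Layer σ B :=
  haveI : Nonempty (Layer σ B) := ⟨⟨default, fun _ => 0, fun _ _ => 0, []⟩⟩
  Function.invFunOn (fun (L : Layer σ B) (j : Fin (M - B)) => code enc L j)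
    {L | L.buf.length ≤ M - B} (fun j => cell mem (B + j))

theorem unpack_eq [Inhabited σ] {enc : σ → ℕ → ℕ} {M : ℕ} (hB : 1 ≤ B) (hM : 2 * B ≤ M)
    (henc : ∀ s s', (∀ j < M - B, enc s j = enc s' j) → s = s') {mem : Fin M → ℕ}
    {L : Layer σ B} (hL : L.buf.length ≤ B)
    (hm : ∀ j < M - B, cell mem (B + j) = code enc L j) : unpack enc B mem = L := by
  have : Nonempty (Layer σ B) := ⟨L⟩
  have : (fun j : Fin (M - B) => cell mem (B + j)) = fun j : Fin (M - B) => code enc L j :=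
    funext fun j => hm j j.2
  rw [unpack, this]
  exact (code_injOn (by omega) (by omega) henc).leftInvOn_invFunOn
    (show L.buf.length ≤ M - B by omega)

theorem cell_pack {enc : σ → ℕ → ℕ} {M : ℕ} {low : ℕ → ℕ} {L : Layer σ B} {j : ℕ}
    (hj : j < M - B) : cell (pack enc M low L) (B + j) = code enc L j := by
  rw [cell, dif_pos (by omega), pack, if_neg (by simp)]
  simp

theorem pack_lt {X W : ℕ} {M : ℕ} {enc : σ → ℕ → ℕ} {low : ℕ → ℕ} {L : Layer σ B} (hX : 1 < X)
    (hW : X ^ 64 ≤ W) (hlow : ∀ i, low i < X)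
    (hs : ∀ j, enc L.s j < X) (ht : ∀ b, L.tag b < X) (hc : ∀ b i, L.cache b i < X)
    (hb : ∀ x ∈ L.buf, x < X) (hl : L.buf.length < X) (i : Fin M) :
    pack (enc) M low L i < W := by
  refine lt_of_lt_of_le ?_ hW
  unfold pack
  split
  · exact (hlow _).trans_le (Nat.le_self_pow (by norm_num) X)
  · exact code_lt (by omega) hs ht hc hb hl _

theorem map_cell_pack {M : ℕ} {enc : σ → ℕ → ℕ} {low : List ℕ} {L : Layer σ B} (hM : 2 * B ≤ M)
    (hl : low.length ≤ B) :
    (List.range (min low.length B)).map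
      (cell (pack enc M (fun i => low.getD i 0) L)) = low := by
  rw [min_eq_left hl]
  refine List.ext_getElem (by simp) fun i h h' => ?_
  simp only [List.getElem_map, List.getElem_range]
  rw [cell, dif_pos (by omega), pack, if_pos (show i < B by omega),
    List.getD_eq_getElem _ _ h']

/-- The control state after reading a block for the cache `b`. -/
def ctl (b : Bool) : Fin 3 := if b then 2 else 1

/-- A block that has just been read is moved to its cache. -/
def resume {M : ℕ} (q : Fin 3) (mem : Fin M → ℕ) (L : Layer σ B) : Layer σ B :=
  if q = 1 then { L with cache := Function.update L.cache false fun i => cell mem i }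
  else if q = 2 then { L with cache := Function.update L.cache true fun i => cell mem i }
  else L

theorem resume_ctl {M : ℕ} (b : Bool) (mem : Fin M → ℕ) (L : Layer σ B) :
    resume (ctl b) mem L = { L with cache := Function.update L.cache b fun i => cell mem i } := by
  cases b <;> rfl

/-- The I/O performed in a state in which no free step is possible. -/
noncomputable def instr (δ : σ → Act σ) (enc : σ → ℕ → ℕ) (M : ℕ) (L : Layer σ B) :
    Instr (Fin 3) M :=
  match δ L.s with
  | .tau _ => .halt
  | .get b x _ => .read (ctl b)
      (pack enc M (fun _ => 0) { L with tag := Function.update L.tag b (x / B + 1) }) (x / B)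
  | .put _ _ => .emit 0 (pack enc M (fun i => L.buf.getD i 0) { L with buf := [] }) L.buf.length
  | .ann b s => .announce 0 (pack enc M (fun _ => 0) { L with s := s }) b
  | .halt => if L.buf = [] then .halt else
      .emit 0 (pack enc M (fun i => L.buf.getD i 0) { L with buf := [] }) L.buf.length

/-- The layer in which the free computation starts. -/
noncomputable def entry [Inhabited σ] (enc : σ → ℕ → ℕ) (B : ℕ) {M : ℕ} (q : Fin 3)
    (mem : Fin M → ℕ) : Layer σ B :=
  resume q mem (unpack enc B mem)

end Layer

/-- The algorithm in the I/O model that executes a cached program. -/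
noncomputable def compile (σ : ℕ → Type) [∀ k, Inhabited (σ k)] (δ : ∀ k, σ k → Act (σ k))
    (enc : ∀ k, σ k → ℕ → ℕ) : IOAlgorithm where
  numStates := 3
  start := 0
  prog M B q mem := Layer.instr (δ (M - B)) (enc (M - B)) M
    (Layer.normal (δ (M - B)) (Layer.entry (enc (M - B)) B q mem))

/-! ### Simulation of a cached program by the I/O machine -/

section Simulation

open IOAlgorithm (cell Config)

variable {σ : ℕ → Type} [∀ k, Inhabited (σ k)] {δ : ∀ k, σ k → Act (σ k)}
  {enc : ∀ k, σ k → ℕ → ℕ} {M B : ℕ} {D : ℕ → ℕ}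

/-- The configuration `c` of the compiled algorithm is in accordance with `α`. -/
def Simulates (D : ℕ → ℕ) (B : ℕ) (c : (compile σ δ enc).Config M)
    (α : AConf (σ (M - B))) : Prop :=
  ∃ (cache : Bool → Fin B → ℕ) (buf : List ℕ) (e : ℕ),
    StateTransition.Reaches (Layer.free (δ (M - B)))
      (Layer.entry (enc (M - B)) B c.state c.mem) ⟨α.s, α.tag, cache, buf⟩ ∧
    c.out ++ buf = α.out ∧ buf.length ≤ B ∧ c.out.length = e * B ∧ c.ios = α.cost + e ∧
    c.disk = D ∧ c.answer = α.ans ∧ (∀ b i, cache b i = 0 ∨ ∃ x, cache b i = D x) ∧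
    ∀ b x, α.tag b = x + 1 → ∀ i : Fin B, cache b i = D (x * B + i)

/-- Main memory starts as zero, and zero memory has to decode to the initial layer; this is why the
default state is encoded by `0`, using that `Nat.pair 0 0 = 0`. -/
theorem simulates_init {input : List ℕ} (hB : 1 ≤ B) (hM : 2 * B ≤ M)
    (henc : ∀ s s', (∀ j < M - B, enc (M - B) s j = enc (M - B) s' j) → s = s')
    (h0 : ∀ j, enc (M - B) default j = 0) :
    Simulates (fun i => input.getD i 0) B ((compile σ δ enc).init M input)
      ⟨default, fun _ => 0, [], none, 0⟩ := by
  refine ⟨fun _ _ => 0, [], 0, ?_, rfl, by simp, by simp [IOAlgorithm.init], rfl, rfl, rfl,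
    fun _ _ => .inl rfl, fun b x h => by simp at h⟩
  have : Layer.entry (enc (M - B)) B (0 : Fin 3) (fun _ : Fin M => 0) =
      ⟨default, fun _ => 0, fun _ _ => 0, []⟩ := by
    rw [Layer.entry, Layer.unpack_eq hB hM henc (L := ⟨default, fun _ => 0, fun _ _ => 0, []⟩)]
    · rfl
    · simp
    · intro j hj
      simp [Layer.code, cell, h0, show Nat.pair 0 0 = 0 from rfl]
  change StateTransition.Reaches _ (Layer.entry (enc (M - B)) B (0 : Fin 3) (fun _ : Fin M => 0)) _
  rw [this]
  exact Relation.ReflTransGen.refl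

theorem entry_pack (hB : 1 ≤ B) (hM : 2 * B ≤ M)
    (henc : ∀ s s', (∀ j < M - B, enc (M - B) s j = enc (M - B) s' j) → s = s')
    {low : ℕ → ℕ} {L : Layer (σ (M - B)) B} (hL : L.buf.length ≤ B) :
    Layer.entry (enc (M - B)) B (0 : Fin 3) (Layer.pack (enc (M - B)) M low L) = L := by
  rw [Layer.entry, Layer.unpack_eq hB hM henc hL fun j hj => Layer.cell_pack hj]
  rfl

/-- Internal steps, cache hits and writes to a buffer with room are absorbed in the free computation
and need no machine step. A miss or a full buffer needs one I/O, an announcement one step without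
I/O. Only full blocks are flushed here, so `e` flushes account for exactly `e * B` output elements.
-/
theorem Simulates.step {X W : ℕ} (hB : 1 ≤ B) (hM : 2 * B ≤ M) (hX : 1 < X)
    (henc : ∀ s s', (∀ j < M - B, enc (M - B) s j = enc (M - B) s' j) → s = s')
    (hW : X ^ 64 ≤ W) (hD : ∀ x, D x < X) {c : (compile σ δ enc).Config M}
    {α α' : AConf (σ (M - B))} (h : Simulates D B c α) (hα : α.Tame (enc (M - B)) X)
    (hs : AConf.Step (δ (M - B)) (enc (M - B)) D B X α α') :
    ∃ c', IOAlgorithm.Reaches B W c c' ∧ Simulates D B c' α' := by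
  obtain ⟨hn, hα'⟩ := hs
  obtain ⟨cache, buf, e, hr, ho, hbl, hol, hi, hd, ha, hcD, hc⟩ := h
  have hcX : ∀ b i, cache b i < X := fun b i => by
    obtain h | ⟨x, h⟩ := hcD b i <;> rw [h]
    · omega
    · exact hD x
  have hbX : ∀ x ∈ buf, x < X := fun x hx => hα.out_lt x (by rw [← ho]; simp [hx])
  have hbL : buf.length < X := lt_of_le_of_lt (by rw [← ho]; simp) hα.length_lt
  have hXW : X ≤ W := (Nat.le_self_pow (by norm_num) X).trans hW
  unfold AConf.next at hn
  have hcur : Layer.free (δ (M - B)) ⟨α.s, α.tag, cache, buf⟩ = none →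
      IOAlgorithm.current B c =
        Layer.instr (δ (M - B)) (enc (M - B)) M ⟨α.s, α.tag, cache, buf⟩ := by
    intro hf
    rw [← Layer.normal_eq hr hf]
    rfl
  cases hact : δ (M - B) α.s with
  | tau s =>
    simp only [hact, Option.some.injEq] at hn
    subst hn
    refine ⟨c, .refl, cache, buf, e, hr.tail ?_, ho, hbl, hol, hi, hd, ha, hcD, hc⟩
    simp [Layer.free, hact]
  | get b x f =>
    simp only [hact, Option.some.injEq] at hn
    subst hn
    by_cases hit : α.tag b = x / B + 1
    · have ht : Function.update α.tag b (x / B + 1) = α.tag := by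
        rw [← hit, Function.update_eq_self]
      refine ⟨c, .refl, cache, buf, e, ?_, ho, hbl, hol, by simpa [hit] using hi, hd, ha, hcD, ?_⟩
      · refine hr.tail ?_
        have hx : x % B < B := Nat.mod_lt _ hB
        have := hc b _ hit ⟨x % B, hx⟩
        simp only [Nat.mul_comm] at this
        simp [Layer.free, hact, hit, cell, hx, this, Nat.div_add_mod]
      · simpa [ht] using hc
    · have hf : Layer.free (δ (M - B)) ⟨α.s, α.tag, cache, buf⟩ = none := by
        simp [Layer.free, hact, hit]
      have hcur := hcur hf
      simp only [Layer.instr, hact] at hcur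
      set L1 : Layer (σ (M - B)) B := ⟨α.s, Function.update α.tag b (x / B + 1), cache, buf⟩
        with hL1
      set mem1 : Fin M → ℕ := fun i => if (i : ℕ) < B then c.disk (x / B * B + i) else
        Layer.pack (enc (M - B)) M (fun _ => 0) L1 i with hmem1
      have htag : ∀ b', Function.update α.tag b (x / B + 1) b' < X := hα'.tag_lt
      set c1 : (compile σ δ enc).Config M :=
        { c with state := Layer.ctl b, mem := mem1, ios := c.ios + 1 } with hc1
      -- The incoming block overwrites only the transfer area; the layer above it survives, and the
      -- control state tells which cache the block belongs to.
      have hent : Layer.entry (enc (M - B)) B (Layer.ctl b) mem1 =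
          ⟨α.s, Function.update α.tag b (x / B + 1),
            Function.update cache b fun i => D (x / B * B + i), buf⟩ := by
        rw [Layer.entry, Layer.unpack_eq hB hM henc (L := L1) hbl, Layer.resume_ctl]
        · simp only [hL1, Layer.mk.injEq, true_and, and_true]
          congr 1
          funext i
          have := i.2
          rw [cell, dif_pos (by omega), hmem1]
          simp [hd]
        · intro j hj
          rw [← Layer.cell_pack (low := fun _ => 0) hj, cell, cell, dif_pos (by omega),
            dif_pos (by omega), hmem1]
          simp
      refine ⟨c1, .single ⟨?_, ?_, ?_⟩, Function.update cache b fun i => D (x / B * B + i), buf, e,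
        ?_, ho, hbl, hol, ?_, hd, ha, ?_, ?_⟩
      · rw [IOAlgorithm.next, hcur]
      · rw [hcur]
        have := htag b
        simp only [Function.update_self] at this
        simp only [IOAlgorithm.AddressLT]
        omega
      · intro i
        simp only [hc1, hmem1]
        split
        · rw [hd]
          exact (hD _).trans_le hXW
        · exact Layer.pack_lt (low := fun _ => 0) hX hW (fun _ => by omega) hα.enc_lt htag hcX hbX hbL i
      -- The I/O has only filled the cache. The access itself is now a hit and is executed as a free
      -- step.
      · simp only [hc1, hent]
        refine .single ?_
        have hx : x % B < B := Nat.mod_lt _ hB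
        simp [Layer.free, hact, cell, hx, Nat.div_add_mod']
      · simp [hc1, hi, hit]
        omega
      · intro b' i
        by_cases hb : b' = b
        · subst hb
          simp only [Function.update_self]
          exact .inr ⟨_, rfl⟩
        · simpa [hb] using hcD b' i
      · intro b' y hy i
        by_cases hb : b' = b
        · subst hb
          simp only [Function.update_self, Nat.add_right_cancel_iff] at hy ⊢
          rw [hy]
        · simp only [Function.update_of_ne hb] at hy ⊢
          exact hc b' y hy i
  | put x s =>
    simp only [hact, Option.some.injEq] at hn
    subst hn
    by_cases hlt : buf.length < B
    · refine ⟨c, .refl, cache, buf ++ [x], e, hr.tail ?_, by simp [← ho], by simpa using hlt, hol,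
        hi, hd, ha, hcD, hc⟩
      simp [Layer.free, hact, hlt]
    · have hf : Layer.free (δ (M - B)) ⟨α.s, α.tag, cache, buf⟩ = none := by
        simp [Layer.free, hact, hlt]
      have hcur := hcur hf
      simp only [Layer.instr, hact] at hcur
      set mem1 : Fin M → ℕ := Layer.pack (enc (M - B)) M (fun i => buf.getD i 0)
        ⟨α.s, α.tag, cache, []⟩ with hmem1
      set c1 : (compile σ δ enc).Config M :=
        { c with state := (0 : Fin 3), mem := mem1, out := c.out ++ buf, ios := c.ios + 1 }
        with hc1
      have hent : Layer.entry (enc (M - B)) B (0 : Fin 3) mem1 = ⟨α.s, α.tag, cache, []⟩ :=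
        entry_pack hB hM henc (by simp)
      refine ⟨c1, .single ⟨?_, ?_, ?_⟩, cache, [x], e + 1, ?_, ?_, ?_, ?_, ?_, hd, ha, hcD, hc⟩
      · rw [IOAlgorithm.next, hcur]
        simp only [hc1, Layer.map_cell_pack hM hbl, hmem1]
      · rw [hcur]
        trivial
      · exact fun i => Layer.pack_lt hX hW (getD_lt (by omega) hbX) hα.enc_lt hα.tag_lt hcX
          (by simp) (by simp; omega) i
      · simp only [hc1, hent]
        refine .single ?_
        simp [Layer.free, hact, show 0 < B by omega]
      · simp [hc1, ho]
      · simpa using hB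
      · simp only [hc1, List.length_append, hol]
        rw [Nat.add_mul]
        omega
      · simp [hc1, hi]
        omega
  | ann b s =>
    simp only [hact, Option.some.injEq] at hn
    subst hn
    have hf : Layer.free (δ (M - B)) ⟨α.s, α.tag, cache, buf⟩ = none := by
      simp [Layer.free, hact]
    have hcur := hcur hf
    simp only [Layer.instr, hact] at hcur
    set mem1 : Fin M → ℕ := Layer.pack (enc (M - B)) M (fun _ => 0) ⟨s, α.tag, cache, buf⟩
      with hmem1
    set c1 : (compile σ δ enc).Config M :=
      { c with state := (0 : Fin 3), mem := mem1, answer := c.answer.or (some b) } with hc1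
    have hent : Layer.entry (enc (M - B)) B (0 : Fin 3) mem1 = ⟨s, α.tag, cache, buf⟩ :=
      entry_pack hB hM henc hbl
    refine ⟨c1, .single ⟨?_, ?_, ?_⟩, cache, buf, e, ?_, ho, hbl, hol, hi, hd, ?_, hcD, hc⟩
    · rw [IOAlgorithm.next, hcur]
    · rw [hcur]
      trivial
    · exact fun i => Layer.pack_lt (low := fun _ => 0) hX hW (fun _ => by omega) hα'.enc_lt hα.tag_lt hcX hbX hbL i
    · simp only [hc1, hent]
      exact .refl
    · simp [hc1, ha]
  | halt =>
    simp [hact] at hn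

theorem Simulates.reaches {X W : ℕ} (hB : 1 ≤ B) (hM : 2 * B ≤ M) (hX : 1 < X)
    (henc : ∀ s s', (∀ j < M - B, enc (M - B) s j = enc (M - B) s' j) → s = s')
    (hW : X ^ 64 ≤ W) (hD : ∀ x, D x < X) {c : (compile σ δ enc).Config M}
    {α α' : AConf (σ (M - B))} (h : Simulates D B c α) (hα : α.Tame (enc (M - B)) X)
    (hs : Relation.ReflTransGen (AConf.Step (δ (M - B)) (enc (M - B)) D B X) α α') :
    α'.Tame (enc (M - B)) X ∧ ∃ c', IOAlgorithm.Reaches B W c c' ∧ Simulates D B c' α' := by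
  induction hs with
  | refl => exact ⟨hα, c, .refl, h⟩
  | tail _ hst ih =>
    obtain ⟨ht, c', hr, hc'⟩ := ih
    obtain ⟨c'', hr', hc''⟩ := hc'.step hB hM hX henc hW hD ht hst
    exact ⟨hst.2, c'', hr.trans hr', hc''⟩

/-- Full blocks have been flushed on the way, at most `α.out.length / B` of them; the additional I/O
is for a last, non-empty buffer. -/
theorem Simulates.halts {X W : ℕ} (hB : 1 ≤ B) (hM : 2 * B ≤ M) (hX : 1 < X)
    (henc : ∀ s s', (∀ j < M - B, enc (M - B) s j = enc (M - B) s' j) → s = s')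
    (hW : X ^ 64 ≤ W) (hD : ∀ x, D x < X) {c : (compile σ δ enc).Config M}
    {α : AConf (σ (M - B))} (h : Simulates D B c α) (hα : α.Tame (enc (M - B)) X)
    (hh : δ (M - B) α.s = .halt) :
    ∃ c', IOAlgorithm.Reaches B W c c' ∧ IOAlgorithm.Halted B c' ∧ c'.out = α.out ∧
      c'.answer = α.ans ∧ c'.ios ≤ α.cost + α.out.length / B + 1 := by
  obtain ⟨cache, buf, e, hr, ho, hbl, hol, hi, hd, ha, hcD, hc⟩ := h
  have hcX : ∀ b i, cache b i < X := fun b i => by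
    obtain h | ⟨x, h⟩ := hcD b i <;> rw [h]
    · omega
    · exact hD x
  have hbX : ∀ x ∈ buf, x < X := fun x hx => hα.out_lt x (by rw [← ho]; simp [hx])
  have he : e ≤ α.out.length / B := by
    rw [Nat.le_div_iff_mul_le hB, ← hol, ← ho]
    simp
  have hf : ∀ buf, Layer.free (δ (M - B)) ⟨α.s, α.tag, cache, buf⟩ = none := by
    intro buf
    simp [Layer.free, hh]
  have hcur : ∀ (c' : (compile σ δ enc).Config M) buf,
      StateTransition.Reaches (Layer.free (δ (M - B)))
        (Layer.entry (enc (M - B)) B c'.state c'.mem) ⟨α.s, α.tag, cache, buf⟩ →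
      IOAlgorithm.current B c' =
        Layer.instr (δ (M - B)) (enc (M - B)) M ⟨α.s, α.tag, cache, buf⟩ := by
    intro c' buf hr
    rw [← Layer.normal_eq hr (hf buf)]
    rfl
  have hcur1 := hcur c buf hr
  simp only [Layer.instr, hh] at hcur1
  by_cases hb : buf = []
  · rw [if_pos hb] at hcur1
    refine ⟨c, .refl, ?_, by simpa [hb] using ho, ha, by omega⟩
    rw [IOAlgorithm.Halted, IOAlgorithm.next, hcur1]
  · rw [if_neg hb] at hcur1
    set mem1 : Fin M → ℕ := Layer.pack (enc (M - B)) M (fun i => buf.getD i 0)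
      ⟨α.s, α.tag, cache, []⟩ with hmem1
    set c1 : (compile σ δ enc).Config M :=
      { c with state := (0 : Fin 3), mem := mem1, out := c.out ++ buf, ios := c.ios + 1 }
      with hc1
    have hent : Layer.entry (enc (M - B)) B (0 : Fin 3) mem1 = ⟨α.s, α.tag, cache, []⟩ :=
      entry_pack hB hM henc (by simp)
    have hcur2 := hcur c1 [] (by simp only [hc1, hent]; exact .refl)
    simp only [Layer.instr, hh, if_true] at hcur2
    refine ⟨c1, .single ⟨?_, ?_, ?_⟩, ?_, ho, ha, by simp [hc1]; omega⟩
    · rw [IOAlgorithm.next, hcur1]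
      simp only [hc1, Layer.map_cell_pack hM hbl, hmem1]
    · rw [hcur1]
      trivial
    · exact fun i => Layer.pack_lt hX hW (getD_lt (by omega) hbX) hα.enc_lt hα.tag_lt hcX
        (by simp) (by simp; omega) i
    · rw [IOAlgorithm.Halted, IOAlgorithm.next, hcur2]

end Simulation

/-! ### The program -/

/-- A vertex together with its side of the tentative partition and with those of the vertices
recorded before that are adjacent to it. -/
abbrev Rec := ℕ × Bool × List ℕ

/-- The working data of a pass over the graph, with `k` triples of counters. -/
structure Work (k : ℕ) where
  ph : ℕ
  lo : ℕ
  sz : ℕ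
  θ : ℕ
  kc : ℕ
  inK : Bool
  recs : List Rec
  nbs : List ℕ
  hit : Option Rec
  c1 : Fin k → ℕ
  c2 : Fin k → ℕ
  c3 : Fin k → ℕ

/-- The state of the program. -/
structure St (k : ℕ) where
  mode : ℕ
  n : ℕ
  m : ℕ
  v : ℕ
  e : ℕ
  pend : ℕ
  outl : List ℕ
  w : Work k

instance (k : ℕ) : Inhabited (Work k) :=
  ⟨⟨0, 0, 0, 0, 0, false, [], [], none, fun _ => 0, fun _ => 0, fun _ => 0⟩⟩

instance (k : ℕ) : Inhabited (St k) := ⟨⟨0, 0, 0, 0, 0, 0, [], default⟩⟩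

/-- The encoding of a state in `k` numbers. -/
def St.enc {k : ℕ} (s : St k) (j : ℕ) : ℕ :=
  Encodable.encode ((s.mode, s.n, s.m, s.v, s.e, s.pend, s.outl),
    (s.w.ph, s.w.lo, s.w.sz, s.w.θ, s.w.kc, s.w.inK, s.w.recs, s.w.nbs, s.w.hit),
    (IOAlgorithm.cell s.w.c1 j, IOAlgorithm.cell s.w.c2 j, IOAlgorithm.cell s.w.c3 j))

/-- Only the counters are distributed over the cells; all other fields are repeated in each cell, so
a single cell determines them. -/
theorem St.enc_inj {k : ℕ} (hk : 0 < k) (s s' : St k) (h : ∀ j < k, s.enc j = s'.enc j) :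
    s = s' := by
  obtain ⟨_, _, _, _, _, _, _, _, _, _, _, _, _, _, _, _, c1, c2, c3⟩ := s
  obtain ⟨_, _, _, _, _, _, _, _, _, _, _, _, _, _, _, _, d1, d2, d3⟩ := s'
  simp only [St.enc, Encodable.encode_inj, Prod.mk.injEq] at h
  have h1 : c1 = d1 := funext fun j => by
    simpa [IOAlgorithm.cell] using (h j j.2).2.2.1
  have h2 : c2 = d2 := funext fun j => by
    simpa [IOAlgorithm.cell] using (h j j.2).2.2.2.1
  have h3 : c3 = d3 := funext fun j => by
    simpa [IOAlgorithm.cell] using (h j j.2).2.2.2.2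
  have h0 := h 0 hk
  simp only [h1, h2, h3, h0]

theorem St.enc_default (k j : ℕ) : (default : St k).enc j = 0 := by
  simp [St.enc, default, IOAlgorithm.cell, show Nat.pair 0 0 = 0 from rfl]

/-! ### Size of encoded data -/

section EncodingBounds

variable {α β : Type*} [Encodable α] [Encodable β] {Y p q r : ℕ}

theorem pow_two_pow_mono (hY : 0 < Y) (h : p ≤ q) : Y ^ 2 ^ p ≤ Y ^ 2 ^ q :=
  Nat.pow_le_pow_right hY (Nat.pow_le_pow_right (by norm_num) h)

theorem encode_pair_lt (hY : 0 < Y) {a : α} {b : β} (ha : Encodable.encode a < Y ^ 2 ^ p)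
    (hb : Encodable.encode b < Y ^ 2 ^ q) (hp : p + 1 ≤ r) (hq : q + 1 ≤ r) :
    Encodable.encode (a, b) < Y ^ 2 ^ r := by
  obtain ⟨r, rfl⟩ : ∃ r', r = r' + 1 := ⟨r - 1, by omega⟩
  rw [Encodable.encode_prod_val, pow_succ 2, pow_mul]
  exact Layer.pair_lt_sq (ha.trans_le (pow_two_pow_mono hY (by omega)))
    (hb.trans_le (pow_two_pow_mono hY (by omega)))

/-- Each list element costs two squarings: one for the pairing of head and tail, one to absorb the
successor in the encoding of a non-empty list. -/
theorem encode_list_lt (hY : 1 < Y) {l : List α} (hl : ∀ a ∈ l, Encodable.encode a < Y ^ 2 ^ p)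
    {c : ℕ} (hc : l.length ≤ c) : Encodable.encode l < Y ^ 2 ^ (p + 2 * c) := by
  induction l generalizing c with
  | nil => simpa using Nat.pow_pos (by omega)
  | cons a l ih =>
    obtain ⟨c, rfl⟩ : ∃ c', c = c' + 1 := ⟨c - 1, by simp at hc; omega⟩
    have h1 := ih (fun b hb => hl b (by simp [hb])) (by simpa using hc)
    have h2 := (hl a (by simp)).trans_le (pow_two_pow_mono (q := p + 2 * c) (by omega : 0 < Y)
      (by omega))
    rw [Encodable.encode_list_cons]
    calc _ < (Y ^ 2 ^ (p + 2 * c)) ^ 2 + 1 := by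
          simpa using Layer.pair_lt_sq h2 h1
      _ = Y ^ 2 ^ (p + 2 * c + 1) + 1 := by rw [← pow_mul, ← pow_succ]
      _ ≤ _ := Nat.pow_lt_pow_right hY (Nat.pow_lt_pow_right (by norm_num) (by omega))

theorem encode_option_lt (hY : 1 < Y) {o : Option α}
    (ho : ∀ a ∈ o, Encodable.encode a < Y ^ 2 ^ p) : Encodable.encode o < Y ^ 2 ^ (p + 1) := by
  cases o with
  | none => simpa using Nat.pow_pos (by omega)
  | some a =>
    rw [Encodable.encode_some]
    exact lt_of_le_of_lt (ho a rfl)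
      (Nat.pow_lt_pow_right hY (Nat.pow_lt_pow_right (by norm_num) (by omega)))

end EncodingBounds

/-- The record consists of numbers up to `n` and is short. -/
def RecOk (n : ℕ) (r : Rec) : Prop := r.1 ≤ n ∧ r.2.2.length ≤ 7 ∧ ∀ u ∈ r.2.2, u ≤ n

/-- The working data are in the range expected after `v` vertices and `e` entries of the edge
array of a graph with `n` vertices. -/
structure Work.Ok {k : ℕ} (n v e : ℕ) (w : Work k) : Prop where
  ph : w.ph ≤ 2
  lo : w.lo ≤ n * n + 1
  sz : w.sz ≤ n * n + 2
  θ : w.θ ≤ n * n + 1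
  kc : w.kc ≤ v
  recs_length : w.recs.length ≤ 7
  recs : ∀ r ∈ w.recs, RecOk n r
  nbs_length : w.nbs.length ≤ 7
  nbs : ∀ u ∈ w.nbs, u ≤ n
  hit : ∀ r ∈ w.hit, RecOk n r
  c1 : ∀ j, w.c1 j ≤ v
  c2 : ∀ j, w.c2 j ≤ e
  c3 : ∀ j, w.c3 j ≤ e

/-- The numbers in the state are in the range expected for a graph with `n` vertices and `m`
edges. -/
structure St.Ok {k : ℕ} (n m : ℕ) (s : St k) : Prop where
  mode_le : s.mode ≤ 12
  n_le : s.n ≤ n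
  m_le : s.m ≤ m
  v_le : s.v ≤ n
  e_le : s.e ≤ 2 * m
  pend_le : s.pend ≤ 2 * m
  outl_length : s.outl.length ≤ 7
  outl_le : ∀ x ∈ s.outl, x ≤ n
  work : s.w.Ok n n (2 * m)

theorem St.exists_enc_lt : ∃ d, ∀ k n m (s : St k), s.Ok n m →
    ∀ j, s.enc j < (n + m + 2) ^ d := by
  -- All entries are below `Y = (n + m + 2) ^ 4`, which leaves room for `n * n` and the constants.
  -- The nested encodings fit into sixty squarings of `Y`, because all lists have length at most
  -- `7`.
  refine ⟨4 * 2 ^ 60, fun k n m s h j => ?_⟩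
  have hw := h.work
  rw [pow_mul]
  have hY : n * n + 2 * m + 12 < (n + m + 2) ^ 4 := by
    have : (n + m + 2) ^ 4 = ((n + m + 2) * (n + m + 2)) * ((n + m + 2) * (n + m + 2)) := by ring
    nlinarith [Nat.zero_le n, Nat.zero_le m, Nat.mul_le_mul (show 4 ≤ (n + m + 2) * (n + m + 2) by
      nlinarith) (le_refl ((n + m + 2) * (n + m + 2)))]
  generalize (n + m + 2) ^ 4 = Y at hY ⊢
  have hnn : n ≤ n * n := Nat.le_mul_self n
  have hY0 : 0 < Y := by omega
  have hY1 : 1 < Y := by omega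
  have num : ∀ {x p : ℕ}, x ≤ n * n + 2 * m + 12 → Encodable.encode x < Y ^ 2 ^ p := by
    intro x p hx
    have : Y ^ 2 ^ 0 ≤ Y ^ 2 ^ p := pow_two_pow_mono hY0 (Nat.zero_le p)
    simp at this ⊢
    omega
  have boo : ∀ {x : Bool} {p : ℕ}, Encodable.encode x < Y ^ 2 ^ p := by
    intro x p
    have : Y ^ 2 ^ 0 ≤ Y ^ 2 ^ p := pow_two_pow_mono hY0 (Nat.zero_le p)
    have hx : Encodable.encode x ≤ 1 := by cases x <;> simp
    simp only [pow_zero, pow_one] at this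
    omega
  have lst : ∀ {l : List ℕ}, l.length ≤ 7 → (∀ x ∈ l, x ≤ n) →
      Encodable.encode l < Y ^ 2 ^ 14 := fun hl hx =>
    encode_list_lt (p := 0) (c := 7) hY1 (fun x h => num (by have := hx x h; omega)) hl
  have hrec : ∀ {r : Rec}, RecOk n r → Encodable.encode r < Y ^ 2 ^ 16 := by
    rintro ⟨v, b, l⟩ ⟨hv, hl, hx⟩
    simp only at hv hl hx
    exact encode_pair_lt (p := 15) (q := 15) hY0 (num (by omega))
      (encode_pair_lt (p := 14) hY0 boo (lst hl hx) le_rfl le_rfl) le_rfl le_rfl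
  have hrecs : Encodable.encode s.w.recs < Y ^ 2 ^ 30 :=
    encode_list_lt (c := 7) hY1 (fun r hr => hrec (hw.recs r hr)) hw.recs_length
  have hit : Encodable.encode s.w.hit < Y ^ 2 ^ 17 :=
    encode_option_lt hY1 fun r hr => hrec (hw.hit r hr)
  have cel : ∀ {c : Fin k → ℕ} {p : ℕ}, (∀ j, c j ≤ n + 2 * m) →
      Encodable.encode (IOAlgorithm.cell c j) < Y ^ 2 ^ p := by
    intro c p hc
    apply num
    unfold IOAlgorithm.cell
    split
    · have := hc ⟨j, ‹_›⟩
      omega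
    · omega
  have h' := h.mode_le
  have h1 := h.n_le
  have h2 := h.m_le
  have h3 := h.v_le
  have h4 := h.e_le
  have h5 := h.pend_le
  have w1 := hw.ph
  have w2 := hw.lo
  have w3 := hw.sz
  have w4 := hw.θ
  have w5 := hw.kc
  have step : ∀ {α β : Type} [Encodable α] [Encodable β] {a : α} {b : β} {q r : ℕ},
      Encodable.encode a < Y ^ 2 ^ q → Encodable.encode b < Y ^ 2 ^ q → q + 1 = r →
      Encodable.encode (a, b) < Y ^ 2 ^ r :=
    fun ha hb h => encode_pair_lt hY0 ha hb h.le h.le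
  have up : ∀ {x p : ℕ} (q : ℕ), p ≤ q → x < Y ^ 2 ^ p → x < Y ^ 2 ^ q :=
    fun q hpq hx => hx.trans_le (pow_two_pow_mono hY0 hpq)
  refine step (q := 59) ?_ (step (q := 58) ?_ ?_ rfl) rfl
  · refine up (p := 20) 59 (by norm_num) ?_
    exact step (num (by omega)) (step (num (by omega)) (step (num (by omega))
      (step (num (by omega)) (step (num (by omega)) (step (num (by omega))
      (lst h.outl_length h.outl_le) rfl) rfl) rfl) rfl) rfl) rfl
  · refine up (p := 40) 58 (by norm_num) ?_
    exact step (q := 39) (num (by omega)) (step (q := 38) (num (by omega)) (step (q := 37) (num (by omega))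
      (step (q := 36) (num (by omega)) (step (q := 35) (num (by omega)) (step (q := 34) boo
      (step (q := 33) (up 33 (by norm_num) hrecs) (step (q := 32)
      (up 32 (by norm_num) (lst hw.nbs_length hw.nbs)) (up 32 (by norm_num) hit)
      rfl) rfl) rfl) rfl) rfl) rfl) rfl) rfl
  · exact step (q := 57) (cel fun j => (hw.c1 j).trans (by omega)) (step (q := 56)
      (cel fun j => (hw.c2 j).trans (by omega)) (cel fun j => (hw.c3 j).trans (by omega)) rfl) rfl

namespace Work

variable {k : ℕ}

/-- The step width of the search. -/
def width (w : Work k) : ℕ := (w.sz + k) / (k + 1)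

/-- The `j`-th candidate tested in the current pass of a search. -/
def query (w : Work k) (j : Fin k) : ℕ := w.lo + (j + 1) * w.width - 1

/-- The vertex `v` with `d` neighbours is entered. -/
def startRow (n v d : ℕ) (w : Work k) : Work k := { w with
  inK := decide (w.θ ≤ d * n + v)
  kc := w.kc + if w.θ ≤ d * n + v then 1 else 0
  nbs := []
  -- In phase `0` the candidates are thresholds; in phase `1` they are prefix lengths for the fixed
  -- threshold `w.θ`.
  c1 := fun j => w.c1 j + if (if w.ph = 0 then w.query j ≤ d * n + v
    else w.θ ≤ d * n + v ∧ v < w.query j) then 1 else 0 }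

/-- The entry `u` in the row of `v` is processed. -/
def addEdge (v : ℕ) (w : Work k) (u : ℕ) : Work k := { w with
  nbs := (w.recs.map Prod.fst).filter fun a => a ∈ w.nbs ∨ a = u
  c2 := fun j => w.c2 j + if w.inK = true ∧ v < w.query j ∧ u < w.query j then 1 else 0
  c3 := fun j => w.c3 j + if w.inK = false ∧ v < w.query j ∧ u < w.query j then 1 else 0 }

end Work

/-- The condition on the next vertex to be recorded. Adjacency is taken in the graph if the first
recorded vertex is on the independent side, and in its complement otherwise. -/
def FindPred (n lo : ℕ) (recs : List Rec) (w : ℕ) (κ : Bool) (nbs : List ℕ) : Prop :=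
  let vt := fun i => (recs.getD i (n, false, [])).1
  let fl := (recs.getD 0 (n, false, [])).2.1
  let adj := fun i => w ≠ vt i ∧ (vt i ∈ nbs ↔ fl = false)
  -- The records are, in this order, `a`, `b`, a common non-neighbour `z` of both on the other side
  -- (if any), `x`, `y`, `e` and `f`. The value `n` in place of `z` says that there is none;
  -- otherwise `x` and `y` are forced to equal `z`.
  match recs.length with
  | 0 => w = lo - 1
  | 1 => κ = fl ∧ adj 0
  | 2 => κ ≠ fl ∧ ¬ adj 0 ∧ ¬ adj 1
  | 3 => κ ≠ fl ∧ ¬ adj 0 ∧ (vt 2 < n → w = vt 2)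
  | 4 => κ ≠ fl ∧ ¬ adj 1 ∧ (vt 2 < n → w = vt 2)
  | 5 => adj 3 ∧ w ≠ vt 1 ∧ ¬ adj 1
  | 6 => adj 4 ∧ w ≠ vt 0 ∧ ¬ adj 0
  | _ => False

/-- The graph on the recorded vertices. -/
def recGraph (recs : List Rec) : SimpleGraph ℕ :=
  SimpleGraph.fromRel fun u v => ∃ r ∈ recs, r.1 = u ∧ v ∈ r.2.2

/-- The list enumerates an induced `C₄`, `C₅` or `2K₂`. -/
def Obstruction {V : Type*} (G : SimpleGraph V) (l : List V) : Prop :=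
  InducedCopy G (SimpleGraph.cycleGraph 4) l ∨ InducedCopy G (SimpleGraph.cycleGraph 5) l ∨
    InducedCopy G twoK2 l

open Classical in
/-- An obstruction among the recorded vertices, if there is one. -/
noncomputable def pick (n : ℕ) (recs : List Rec) : List ℕ :=
  if h : ∃ l, (∀ v ∈ l, v < n ∧ v ∈ recs.map Prod.fst) ∧ Obstruction (recGraph recs) l
  then h.choose else []

namespace Work

variable {k : ℕ}

open Classical in
/-- The row of `v` has been processed. -/
noncomputable def endRow (n v : ℕ) (w : Work k) : Work k := { w with
  hit := w.hit.or
    (if FindPred n w.lo w.recs v w.inK w.nbs then some (v, w.inK, w.nbs) else none) }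

/-- The working data at the beginning of a pass. -/
def fresh (ph lo sz θ : ℕ) (recs : List Rec) : Work k :=
  ⟨ph, lo, sz, θ, 0, false, recs, [], none, fun _ => 0, fun _ => 0, fun _ => 0⟩

/-- The next lower bound in the search for the threshold. -/
def lo₁ (n : ℕ) (w : Work k) : ℕ :=
  w.lo + w.width * (Finset.univ.filter fun j => ¬ w.c1 j ≤ w.query j / n + 1).card

/-- The next lower bound in the search for the shortest prefix with a violation. -/
def lo₂ (n : ℕ) (w : Work k) : ℕ :=
  w.lo + w.width * (Finset.univ.filter fun j => w.query j ≤ n ∧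
    w.c1 j * (w.c1 j - 1) + w.c3 j = w.c2 j).card

end Work

/-- The end of a pass. -/
noncomputable def St.passEnd {k : ℕ} (s : St k) : St k :=
  let w := s.w
  let s₀ : St k := { s with v := 0, e := 0, pend := 0 }
  -- Phases `0`, `1`, `2` are the two searches and the recording. At width `1` each block of
  -- candidates is a single number, so this pass completes the search.
  if w.ph = 0 then
    if w.width = 1 then { s₀ with w := .fresh 1 0 (s.n + 2) (w.lo₁ s.n) [] }
    else { s₀ with w := .fresh 0 (w.lo₁ s.n) w.width 0 [] }
  else if w.ph = 1 then
    if w.width = 1 then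
      if w.lo₂ s.n = s.n + 1 then { s₀ with mode := 4 }
      else { s₀ with w := .fresh 2 (w.lo₂ s.n) 0 w.θ [] }
    else { s₀ with w := .fresh 1 (w.lo₂ s.n) w.width w.θ [] }
  else
    -- If no vertex qualifies, the non-vertex `n` is recorded, so that later records keep their
    -- positions.
    let recs := w.recs ++ [w.hit.getD (s.n, false, [])]
    let s₁ : St k := { s₀ with w := .fresh 2 w.lo 0 w.θ recs }
    if w.recs.length = 6 then { s₁ with mode := 10, outl := pick s.n recs } else s₁

/-- The program. In the modes `0` and `1` it reads the numbers of vertices and edges. In the modes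
`2` and `3` it makes passes over the graph, reading a row start and a row entry respectively: it
searches for the threshold, then for the shortest prefix with a violation, and then records
vertices. In the modes `4` to `9` it announces and outputs the partition, in the modes `10` and `11`
an obstruction. -/
noncomputable def St.step {k : ℕ} (s : St k) : Act (St k) :=
  match s.mode with
  | 0 => .get false 0 fun x => { s with n := x, mode := 1 }
  | 1 => .get false 1 fun x => { s with m := x, mode := 2, w := { s.w with sz := s.n * s.n + 1 } }
  -- Cell `v + 3` holds `P[v + 1]`, the end of the row of `v`. For the last vertex this cell lies
  -- beyond `P`; its contents are ignored in favour of `2 * m`.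
  | 2 => if s.v < s.n then .get false (s.v + 3) fun x =>
      let p := if s.v + 1 = s.n then 2 * s.m else x
      { s with mode := 3, v := s.v + 1, pend := p, w := s.w.startRow s.n s.v (p - s.e) }
    else .tau s.passEnd
  | 3 => if s.e < s.pend then .get true (s.n + 2 + s.e) fun x =>
      { s with e := s.e + 1, w := s.w.addEdge (s.v - 1) x }
    else .tau { s with mode := 2, w := s.w.endRow s.n (s.v - 1) }
  | 4 => .ann true { s with mode := 5 }
  | 5 => .put s.w.kc { s with mode := 6 }
  | 6 => if s.v < s.n then .get false (s.v + 3) fun x =>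
      let p := if s.v + 1 = s.n then 2 * s.m else x
      { s with v := s.v + 1, e := p,
               mode := if s.w.θ ≤ (p - s.e) * s.n + s.v then 7 else 6 }
    else .tau { s with v := 0, e := 0, mode := 8 }
  | 7 => .put (s.v - 1) { s with mode := 6 }
  | 8 => if s.v < s.n then .get false (s.v + 3) fun x =>
      let p := if s.v + 1 = s.n then 2 * s.m else x
      { s with v := s.v + 1, e := p,
               mode := if s.w.θ ≤ (p - s.e) * s.n + s.v then 8 else 9 }
    else .halt
  | 9 => .put (s.v - 1) { s with mode := 8 }
  | 10 => .ann false { s with mode := 11 }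
  | 11 => match s.outl with
    | [] => .halt
    | x :: l => .put x { s with outl := l }
  | _ => .halt

/-! ### Running one pass -/

/-- The position at which the row of `v` begins. -/
def rowStart (row : ℕ → List ℕ) (v : ℕ) : ℕ := ∑ i ∈ Finset.range v, (row i).length

theorem rowStart_succ (row : ℕ → List ℕ) (v : ℕ) :
    rowStart row (v + 1) = rowStart row v + (row v).length := Finset.sum_range_succ _ _

theorem rowStart_mono (row : ℕ → List ℕ) : Monotone (rowStart row) :=
  monotone_nat_of_le_succ fun v => by rw [rowStart_succ]; omega

/-- The external memory `D` contains the adjacency rows `row` of a graph with `n` vertices and `m`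
edges. -/
structure Layout (D : ℕ → ℕ) (n m : ℕ) (row : ℕ → List ℕ) : Prop where
  zero : D 0 = n
  one : D 1 = m
  pos : ∀ v, v + 1 < n → D (v + 3) = rowStart row (v + 1)
  edge : ∀ v < n, ∀ i (h : i < (row v).length), D (n + 2 + (rowStart row v + i)) = (row v)[i]
  total : rowStart row n = 2 * m

theorem Layout.rowEnd_eq {D : ℕ → ℕ} {n m : ℕ} {row : ℕ → List ℕ} (h : Layout D n m row) {v : ℕ}
    (hv : v < n) : (if v + 1 = n then 2 * m else D (v + 3)) = rowStart row (v + 1) := by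
  split
  · rw [← h.total]
    congr 1
    exact Eq.symm ‹_›
  · exact h.pos v (by omega)

theorem Layout.rowStart_le {D : ℕ → ℕ} {n m : ℕ} {row : ℕ → List ℕ} (h : Layout D n m row) {v : ℕ}
    (hv : v ≤ n) : rowStart row v ≤ 2 * m := by
  rw [← h.total]
  exact rowStart_mono row hv

theorem ite_one_le (P : Prop) [Decidable P] : (if P then 1 else 0) ≤ 1 := by split <;> simp

namespace Work

variable {k n v e : ℕ} {w : Work k}

theorem Ok.mono {v' e' : ℕ} (h : w.Ok n v e) (hv : v ≤ v') (he : e ≤ e') : w.Ok n v' e' :=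
  { h with
    kc := h.kc.trans hv
    c1 := fun j => (h.c1 j).trans hv
    c2 := fun j => (h.c2 j).trans he
    c3 := fun j => (h.c3 j).trans he }

theorem Ok.startRow (h : w.Ok n v e) (v' d : ℕ) : (w.startRow n v' d).Ok n (v + 1) e :=
  { h with
    kc := by
      have := h.kc
      simp only [Work.startRow]
      split <;> omega
    nbs_length := by simp [Work.startRow]
    nbs := by simp [Work.startRow]
    c1 := fun j => Nat.add_le_add (h.c1 j) (ite_one_le _) }

theorem nbs_mem_le (h : w.Ok n v e) {p : ℕ → Bool} :
    ((w.recs.map Prod.fst).filter p).length ≤ 7 ∧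
      ∀ a ∈ (w.recs.map Prod.fst).filter p, a ≤ n := by
  refine ⟨(List.length_filter_le _ _).trans (by simpa using h.recs_length), fun a ha => ?_⟩
  obtain ⟨r, hr, rfl⟩ := List.mem_map.1 (List.mem_of_mem_filter ha)
  exact (h.recs r hr).1

theorem Ok.addEdge (h : w.Ok n v e) (v' u : ℕ) : (w.addEdge v' u).Ok n v (e + 1) :=
  { h with
    nbs_length := (nbs_mem_le h).1
    nbs := (nbs_mem_le h).2
    c2 := fun j => by
      have := h.c2 j
      simp only [Work.addEdge]
      split <;> omega
    c3 := fun j => by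
      have := h.c3 j
      simp only [Work.addEdge]
      split <;> omega }

theorem Ok.endRow (h : w.Ok n v e) {v' : ℕ} (hv : v' ≤ n) : (w.endRow n v').Ok n v e :=
  { h with
    hit := fun r hr => by
      simp only [Work.endRow, Option.mem_def, Option.or_eq_some_iff] at hr
      obtain hr | ⟨-, hr⟩ := hr
      · exact h.hit r hr
      · split at hr
        · cases hr
          exact ⟨hv, h.nbs_length, h.nbs⟩
        · cases hr }

theorem ok_fresh {ph lo sz θ : ℕ} {recs : List Rec} (hph : ph ≤ 2) (hlo : lo ≤ n * n + 1)
    (hsz : sz ≤ n * n + 2) (hθ : θ ≤ n * n + 1) (hrecs : recs.length ≤ 7)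
    (hrecs' : ∀ r ∈ recs, RecOk n r) : (fresh ph lo sz θ recs : Work k).Ok n 0 0 where
  ph := hph
  lo := hlo
  sz := hsz
  θ := hθ
  kc := le_rfl
  recs_length := hrecs
  recs := hrecs'
  nbs_length := by simp [fresh]
  nbs := by simp [fresh]
  hit := fun r hr => by cases hr
  c1 := fun _ => le_rfl
  c2 := fun _ => le_rfl
  c3 := fun _ => le_rfl

/-- The effect of one row. -/
noncomputable def doRow (n : ℕ) (row : ℕ → List ℕ) (v : ℕ) (w : Work k) : Work k :=
  ((row v).foldl (addEdge v) (w.startRow n v (row v).length)).endRow n v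

/-- The effect of the first rows. -/
noncomputable def doRows (n : ℕ) (row : ℕ → List ℕ) (w : Work k) : ℕ → Work k
  | 0 => w
  | v + 1 => doRow n row v (doRows n row w v)

theorem Ok.foldl_addEdge (l : List ℕ) (v' : ℕ) : ∀ {w : Work k} {e : ℕ}, w.Ok n v e →
    (l.foldl (Work.addEdge v') w).Ok n v (e + l.length) := by
  induction l with
  | nil => exact fun h => h
  | cons u l ih =>
    intro w e h
    have := ih (h.addEdge v' u)
    rwa [List.length_cons, ← Nat.add_assoc, Nat.add_right_comm]

theorem Ok.doRows (row : ℕ → List ℕ) (h : w.Ok n 0 0) {v : ℕ} (hv : v ≤ n) :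
    (w.doRows n row v).Ok n v (rowStart row v) := by
  induction v with
  | zero => exact h
  | succ v ih =>
    rw [rowStart_succ]
    exact (((ih (by omega)).startRow v _).foldl_addEdge _ v).endRow (by omega)

end Work

/-! ### Cost of sequential reading -/

/-- The cost `c` of reading `v` consecutive cells from position `off + 1` on, when the tag of the
cache is now `t`. -/
def Streamed (off B t c v : ℕ) : Prop :=
  v = 0 ∧ c = 0 ∨ 0 < v ∧ t = (v + off) / B + 1 ∧ c ≤ (v + off) / B + 1

theorem Streamed.le {off B t c v : ℕ} (h : Streamed off B t c v) : c ≤ (v + off) / B + 1 := by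
  obtain ⟨-, rfl⟩ | ⟨-, -, h⟩ := h
  · exact Nat.zero_le _
  · exact h

/-- After the first access, a miss at the next position means that the block index has grown, and
the bound grows with it. The first access pays for the `+ 1`. -/
theorem Streamed.succ {off B t c v : ℕ} (h : Streamed off B t c v) :
    Streamed off B ((v + 1 + off) / B + 1) (c + if t = (v + 1 + off) / B + 1 then 0 else 1)
      (v + 1) := by
  refine .inr ⟨by omega, rfl, ?_⟩
  have hm : (v + off) / B ≤ (v + 1 + off) / B := Nat.div_le_div_right (by omega)
  obtain ⟨-, rfl⟩ | ⟨-, rfl, h⟩ := h <;> generalize (v + off) / B = a at * <;>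
    generalize (v + 1 + off) / B = b at * <;> split <;> omega

/-- The cost of a configuration in the middle of a pass. -/
def Charged (n B base : ℕ) {σ : Type} (α : AConf σ) (v e : ℕ) : Prop :=
  ∃ c₀ c₁, α.cost ≤ base + c₀ + c₁ ∧ Streamed 2 B (α.tag false) c₀ v ∧
    Streamed (n + 1) B (α.tag true) c₁ e

/-- All numbers outside the state are small. -/
structure AConf.Fine {σ : Type} (X : ℕ) (α : AConf σ) : Prop where
  tag_lt : ∀ b, α.tag b < X
  out_lt : ∀ x ∈ α.out, x < X
  length_lt : α.out.length < X

/-- The setting of a run of the program. -/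
structure Setting (k : ℕ) (D : ℕ → ℕ) (n m : ℕ) (row : ℕ → List ℕ) (B X : ℕ) : Prop
    extends Layout D n m row where
  pos_k : 0 < k
  enc_lt : ∀ s : St k, s.Ok n m → ∀ j, s.enc j < X
  lt_X : n + 2 * m + 6 ≤ X

/-- The configurations of the program that are reachable with small numbers. -/
abbrev Run (k : ℕ) (D : ℕ → ℕ) (B X : ℕ) : AConf (St k) → AConf (St k) → Prop :=
  Relation.ReflTransGen (AConf.Step St.step St.enc D B X)

namespace Setting

variable {k : ℕ} {D : ℕ → ℕ} {n m : ℕ} {row : ℕ → List ℕ} {B X : ℕ}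

theorem run_tau (S : Setting k D n m row B X) {α : AConf (St k)} (hα : α.Fine X) {s : St k}
    (hs : α.s.step = .tau s) (hok : s.Ok n m) :
    Run k D B X α { α with s := s } := by
  refine .single ⟨?_, S.enc_lt s hok, hα.tag_lt, hα.out_lt, hα.length_lt⟩
  rw [AConf.next, hs]

theorem run_get (S : Setting k D n m row B X) {α : AConf (St k)} (hα : α.Fine X) {b : Bool}
    {x : ℕ} {f : ℕ → St k} (hs : α.s.step = .get b x f) (hok : (f (D x)).Ok n m)
    (hx : x ≤ n + 2 * m + 4) :
    ∃ α' : AConf (St k), Run k D B X α α' ∧ α'.Fine X ∧ α'.s = f (D x) ∧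
      α'.tag = Function.update α.tag b (x / B + 1) ∧ α'.out = α.out ∧ α'.ans = α.ans ∧
      α'.cost = α.cost + if α.tag b = x / B + 1 then 0 else 1 := by
  have htag : ∀ b', Function.update α.tag b (x / B + 1) b' < X := by
    intro b'
    by_cases hb : b' = b
    · subst hb
      have := Nat.div_le_self x B
      have := S.lt_X
      simp only [Function.update_self]
      omega
    · simpa [hb] using hα.tag_lt b'
  refine ⟨{ α with
      s := f (D x)
      tag := Function.update α.tag b (x / B + 1)
      cost := α.cost + if α.tag b = x / B + 1 then 0 else 1 },
    .single ⟨?_, S.enc_lt _ hok, htag, hα.out_lt, hα.length_lt⟩,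
    ⟨htag, hα.out_lt, hα.length_lt⟩, rfl, rfl, rfl, rfl, rfl⟩
  rw [AConf.next, hs]

/-- The data outside the state and the caches agree. -/
structure _root_.AConf.Silent {σ : Type} (α α' : AConf σ) : Prop where
  out : α'.out = α.out
  ans : α'.ans = α.ans

theorem _root_.AConf.Silent.trans {σ : Type} {α β γ : AConf σ} (h : α.Silent β) (h' : β.Silent γ) :
    α.Silent γ := ⟨h'.out.trans h.out, h'.ans.trans h.ans⟩

/-- The row entries are processed. -/
theorem run_edges (S : Setting k D n m row B X) {base v : ℕ} (hv : v < n) {w : Work k}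
    (hw : w.Ok n (v + 1) (rowStart row v)) {α : AConf (St k)} (hα : α.Fine X)
    (hs : α.s = ⟨3, n, m, v + 1, rowStart row v, rowStart row (v + 1), [], w⟩)
    (hc : Charged n B base α (v + 1) (rowStart row v)) {i : ℕ} (hi : i ≤ (row v).length) :
    ∃ α' : AConf (St k), Run k D B X α α' ∧ α'.Fine X ∧ α.Silent α' ∧
      α'.s = ⟨3, n, m, v + 1, rowStart row v + i, rowStart row (v + 1), [],
        ((row v).take i).foldl (Work.addEdge v) w⟩ ∧
      Charged n B base α' (v + 1) (rowStart row v + i) := by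
  induction i with
  | zero => exact ⟨α, .refl, hα, ⟨rfl, rfl⟩, by simpa using hs, hc⟩
  | succ i ih =>
    obtain ⟨β, hr, hβ, hsil, hβs, c₀, c₁, hcost, h0, h1⟩ := ih (by omega)
    have hle := S.rowStart_le (v := v + 1) (by omega)
    have hsucc := rowStart_succ row v
    have hst : β.s.step = .get true (n + 2 + (rowStart row v + i)) fun x =>
        ⟨3, n, m, v + 1, rowStart row v + i + 1, rowStart row (v + 1), [],
          (((row v).take i).foldl (Work.addEdge v) w).addEdge v x⟩ := by
      rw [hβs]
      simp only [St.step, Nat.add_sub_cancel]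
      rw [if_pos (by omega)]
    have hwo : (((row v).take i).foldl (Work.addEdge v) w).Ok n (v + 1) (rowStart row v + i) := by
      have := hw.foldl_addEdge ((row v).take i) v
      rwa [List.length_take, min_eq_left (by omega)] at this
    obtain ⟨γ, hr', hγ, hγs, htag, hout, hans, hcst⟩ := S.run_get hβ hst
      { mode_le := by simp
        n_le := le_rfl
        m_le := le_rfl
        v_le := hv
        e_le := by simp only; omega
        pend_le := hle
        outl_length := by simp
        outl_le := by simp
        work := (hwo.addEdge v _).mono (by omega) (by omega) } (by omega)
    refine ⟨γ, hr.trans hr', hγ, hsil.trans ⟨hout, hans⟩, ?_, c₀,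
      c₁ + (if β.tag true = (rowStart row v + i + 1 + (n + 1)) / B + 1 then 0 else 1), ?_, ?_, ?_⟩
    · rw [hγs, S.edge v hv i (by omega), List.take_succ_eq_append_getElem (by omega),
        List.foldl_append]
      rfl
    · rw [hcst, show n + 2 + (rowStart row v + i) = rowStart row v + i + 1 + (n + 1) by omega]
      omega
    · rw [htag]
      simpa using h0
    · rw [htag, show n + 2 + (rowStart row v + i) = rowStart row v + i + 1 + (n + 1) by omega,
        Function.update_self]
      exact h1.succ

/-- The first rows are processed. -/
theorem run_rows (S : Setting k D n m row B X) {w : Work k} (hw : w.Ok n 0 0)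
    {α : AConf (St k)} (hα : α.Fine X) (hs : α.s = ⟨2, n, m, 0, 0, 0, [], w⟩) {v : ℕ}
    (hv : v ≤ n) :
    ∃ α' : AConf (St k), Run k D B X α α' ∧ α'.Fine X ∧ α.Silent α' ∧
      α'.s = ⟨2, n, m, v, rowStart row v, rowStart row v, [], w.doRows n row v⟩ ∧
      Charged n B α.cost α' v (rowStart row v) := by
  induction v with
  | zero =>
    exact ⟨α, .refl, hα, ⟨rfl, rfl⟩, by simpa [rowStart, Work.doRows] using hs, 0, 0, le_rfl, .inl ⟨rfl, rfl⟩,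
      .inl ⟨rfl, rfl⟩⟩
  | succ v ih =>
    obtain ⟨β, hr, hβ, hsil, hβs, c₀, c₁, hcost, h0, h1⟩ := ih (by omega)
    have hle := S.rowStart_le (v := v + 1) (by omega)
    have hsucc := rowStart_succ row v
    have hst : β.s.step = .get false (v + 3) fun x =>
        let p := if v + 1 = n then 2 * m else x
        ⟨3, n, m, v + 1, rowStart row v, p, [],
          (w.doRows n row v).startRow n v (p - rowStart row v)⟩ := by
      rw [hβs]
      simp only [St.step]
      rw [if_pos (by omega)]
    have hwo := hw.doRows row (v := v) (by omega)
    have hwo' := hwo.startRow v (rowStart row (v + 1) - rowStart row v)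
    obtain ⟨γ, hr', hγ, hγs, htag, hout, hans, hcst⟩ := S.run_get hβ hst (by
      simp only [S.rowEnd_eq (show v < n by omega)]
      exact {
        mode_le := by simp
        n_le := le_rfl
        m_le := le_rfl
        v_le := hv
        e_le := by simp only; omega
        pend_le := hle
        outl_length := by simp
        outl_le := by simp
        work := hwo'.mono (by omega) (by omega) }) (by omega)
    simp only [S.rowEnd_eq (show v < n by omega)] at hγs
    have hd : rowStart row (v + 1) - rowStart row v = (row v).length := by omega
    rw [hd] at hγs hwo'
    have hch : Charged n B α.cost γ (v + 1) (rowStart row v) := by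
      refine ⟨_, c₁, ?_, by rw [htag]; exact h0.succ, by rw [htag]; simpa using h1⟩
      rw [hcst]
      have : v + 3 = v + 1 + 2 := rfl
      rw [this]
      omega
    obtain ⟨ε, hr2, hε, hsil2, hεs, hch2⟩ := S.run_edges (by omega) hwo' hγ hγs hch le_rfl
    rw [List.take_length, ← hsucc] at hεs
    rw [← hsucc] at hch2
    have hst2 : ε.s.step = .tau ⟨2, n, m, v + 1, rowStart row (v + 1), rowStart row (v + 1), [],
        w.doRows n row (v + 1)⟩ := by
      rw [hεs]
      simp only [St.step, Nat.add_sub_cancel, lt_irrefl, if_false]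
      rfl
    refine ⟨_, ((hr.trans hr').trans hr2).trans (S.run_tau hε hst2 ?_), ⟨hε.1, hε.2, hε.3⟩,
      (hsil.trans ⟨hout, hans⟩).trans ⟨hsil2.out, hsil2.ans⟩, rfl, hch2⟩
    exact {
      mode_le := by simp
      n_le := le_rfl
      m_le := le_rfl
      v_le := hv
      e_le := hle
      pend_le := hle
      outl_length := by simp
      outl_le := by simp
      work := (hw.doRows row hv).mono hv hle }

/-- The cost of a pass. -/
def passCost (n m B : ℕ) : ℕ := (n + 2) / B + 1 + ((2 * m + (n + 1)) / B + 1)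

/-- A pass is executed. -/
theorem run_pass (S : Setting k D n m row B X) {w : Work k} (hw : w.Ok n 0 0)
    {α : AConf (St k)} (hα : α.Fine X) (hs : α.s = ⟨2, n, m, 0, 0, 0, [], w⟩) {s : St k}
    (hend : St.passEnd ⟨2, n, m, n, 2 * m, 2 * m, [], w.doRows n row n⟩ = s) (hok : s.Ok n m) :
    ∃ α' : AConf (St k), Run k D B X α α' ∧ α'.Fine X ∧ α.Silent α' ∧ α'.s = s ∧
      α'.cost ≤ α.cost + passCost n m B := by
  obtain ⟨β, hr, hβ, hsil, hβs, c₀, c₁, hcost, h0, h1⟩ := S.run_rows hw hα hs le_rfl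
  rw [S.total] at hβs h1
  have hst : β.s.step = .tau s := by
    rw [hβs, ← hend]
    simp [St.step]
  refine ⟨_, hr.trans (S.run_tau hβ hst hok), ⟨hβ.1, hβ.2, hβ.3⟩, ⟨hsil.1, hsil.2⟩, rfl, ?_⟩
  have := h0.le
  have := h1.le
  simp only [passCost]
  linarith

end Setting

/-! ### Obstructions -/

section Obstructions

variable {V : Type*} {G : SimpleGraph V}

theorem inducedCopy_ofFn {k : ℕ} {H : SimpleGraph (Fin k)} {v : Fin k → V}
    (hv : (List.ofFn v).Nodup) (hadj : ∀ i j, i < j → (G.Adj (v i) (v j) ↔ H.Adj i j)) :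
    InducedCopy G H (List.ofFn v) := by
  refine ⟨⟨⟨v, List.nodup_ofFn.1 hv⟩, fun {i j} => ?_⟩, rfl⟩
  obtain h | rfl | h := lt_trichotomy i j
  · exact hadj i j h
  · simp
  · exact (G.adj_comm _ _).trans ((hadj j i h).trans (H.adj_comm _ _))

theorem inducedCopy_four_iff {H : SimpleGraph (Fin 4)} {l : List V} :
    InducedCopy G H l ↔ ∃ p q r s, l = [p, q, r, s] ∧ [p, q, r, s].Nodup ∧
      (G.Adj p q ↔ H.Adj 0 1) ∧ (G.Adj p r ↔ H.Adj 0 2) ∧ (G.Adj p s ↔ H.Adj 0 3) ∧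
      (G.Adj q r ↔ H.Adj 1 2) ∧ (G.Adj q s ↔ H.Adj 1 3) ∧ (G.Adj r s ↔ H.Adj 2 3) := by
  constructor
  · rintro ⟨f, rfl⟩
    exact ⟨f 0, f 1, f 2, f 3, by simp [List.ofFn_succ], by simp, f.map_adj_iff, f.map_adj_iff,
      f.map_adj_iff, f.map_adj_iff, f.map_adj_iff, f.map_adj_iff⟩
  · rintro ⟨p, q, r, s, rfl, hn, h1, h2, h3, h4, h5, h6⟩
    refine inducedCopy_ofFn (v := ![p, q, r, s]) hn fun i j hij => ?_
    revert i j
    simp [Fin.forall_fin_succ, *]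

theorem inducedCopy_five_iff {H : SimpleGraph (Fin 5)} {l : List V} :
    InducedCopy G H l ↔ ∃ p q r s t, l = [p, q, r, s, t] ∧ [p, q, r, s, t].Nodup ∧
      (G.Adj p q ↔ H.Adj 0 1) ∧ (G.Adj p r ↔ H.Adj 0 2) ∧ (G.Adj p s ↔ H.Adj 0 3) ∧
      (G.Adj p t ↔ H.Adj 0 4) ∧ (G.Adj q r ↔ H.Adj 1 2) ∧ (G.Adj q s ↔ H.Adj 1 3) ∧
      (G.Adj q t ↔ H.Adj 1 4) ∧ (G.Adj r s ↔ H.Adj 2 3) ∧ (G.Adj r t ↔ H.Adj 2 4) ∧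
      (G.Adj s t ↔ H.Adj 3 4) := by
  constructor
  · rintro ⟨f, rfl⟩
    exact ⟨f 0, f 1, f 2, f 3, f 4, by simp [List.ofFn_succ], by simp, f.map_adj_iff,
      f.map_adj_iff, f.map_adj_iff, f.map_adj_iff, f.map_adj_iff, f.map_adj_iff, f.map_adj_iff,
      f.map_adj_iff, f.map_adj_iff, f.map_adj_iff⟩
  · rintro ⟨p, q, r, s, t, rfl, hn, h1, h2, h3, h4, h5, h6, h7, h8, h9, h10⟩
    refine inducedCopy_ofFn (v := ![p, q, r, s, t]) hn fun i j hij => ?_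
    revert i j
    simp [Fin.forall_fin_succ, *]

theorem inducedCopy_C4_iff {l : List V} : InducedCopy G (SimpleGraph.cycleGraph 4) l ↔
    ∃ p q r s, l = [p, q, r, s] ∧ [p, q, r, s].Nodup ∧ G.Adj p q ∧ ¬ G.Adj p r ∧ G.Adj p s ∧
      G.Adj q r ∧ ¬ G.Adj q s ∧ G.Adj r s := by
  rw [inducedCopy_four_iff]
  have h : (SimpleGraph.cycleGraph 4).Adj 0 1 ∧ ¬ (SimpleGraph.cycleGraph 4).Adj 0 2 ∧
    (SimpleGraph.cycleGraph 4).Adj 0 3 ∧ (SimpleGraph.cycleGraph 4).Adj 1 2 ∧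
    ¬ (SimpleGraph.cycleGraph 4).Adj 1 3 ∧ (SimpleGraph.cycleGraph 4).Adj 2 3 := by decide
  simp only [h, iff_true, iff_false]

theorem inducedCopy_C5_iff {l : List V} : InducedCopy G (SimpleGraph.cycleGraph 5) l ↔
    ∃ p q r s t, l = [p, q, r, s, t] ∧ [p, q, r, s, t].Nodup ∧ G.Adj p q ∧ ¬ G.Adj p r ∧
      ¬ G.Adj p s ∧ G.Adj p t ∧ G.Adj q r ∧ ¬ G.Adj q s ∧ ¬ G.Adj q t ∧ G.Adj r s ∧
      ¬ G.Adj r t ∧ G.Adj s t := by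
  rw [inducedCopy_five_iff]
  have h : (SimpleGraph.cycleGraph 5).Adj 0 1 ∧ ¬ (SimpleGraph.cycleGraph 5).Adj 0 2 ∧
    ¬ (SimpleGraph.cycleGraph 5).Adj 0 3 ∧ (SimpleGraph.cycleGraph 5).Adj 0 4 ∧
    (SimpleGraph.cycleGraph 5).Adj 1 2 ∧ ¬ (SimpleGraph.cycleGraph 5).Adj 1 3 ∧
    ¬ (SimpleGraph.cycleGraph 5).Adj 1 4 ∧ (SimpleGraph.cycleGraph 5).Adj 2 3 ∧
    ¬ (SimpleGraph.cycleGraph 5).Adj 2 4 ∧ (SimpleGraph.cycleGraph 5).Adj 3 4 := by decide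
  simp only [h, iff_true, iff_false]

theorem inducedCopy_twoK2_iff {l : List V} : InducedCopy G twoK2 l ↔
    ∃ p q r s, l = [p, q, r, s] ∧ [p, q, r, s].Nodup ∧ G.Adj p q ∧ ¬ G.Adj p r ∧ ¬ G.Adj p s ∧
      ¬ G.Adj q r ∧ ¬ G.Adj q s ∧ G.Adj r s := by
  rw [inducedCopy_four_iff]
  have h : twoK2.Adj 0 1 ∧ ¬ twoK2.Adj 0 2 ∧ ¬ twoK2.Adj 0 3 ∧ ¬ twoK2.Adj 1 2 ∧
    ¬ twoK2.Adj 1 3 ∧ twoK2.Adj 2 3 := by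
    simp [twoK2]
  simp only [h, iff_true, iff_false]

theorem Obstruction.length_le {l : List V} (h : Obstruction G l) : l.length ≤ 5 := by
  obtain ⟨f, rfl⟩ | ⟨f, rfl⟩ | ⟨f, rfl⟩ := h <;> simp

/-- Every edge has an end in `K`, and every pair of distinct non-adjacent vertices has an end
outside `K`. On each of the three graphs these clauses on membership in `K` are contradictory. -/
theorem Obstruction.not_isSplitGraph {l : List V} (h : Obstruction G l) : ¬ IsSplitGraph G := by
  rintro ⟨K, I, -, hu, hK, hI⟩
  have mem : ∀ v, v ∈ K ∨ v ∈ I := fun v => by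
    have : v ∈ K ∪ I := hu ▸ Set.mem_univ v
    exact this
  have adj : ∀ {v w}, G.Adj v w → v ∈ K ∨ w ∈ K := fun {v w} h => by
    by_contra! hc
    exact hI ((mem v).resolve_left hc.1) ((mem w).resolve_left hc.2) h.ne h
  have non : ∀ {v w}, v ≠ w → ¬ G.Adj v w → v ∉ K ∨ w ∉ K := fun {v w} hne h => by
    by_contra! hc
    exact h (hK hc.1 hc.2 hne)
  obtain h | h | h := h
  · obtain ⟨p, q, r, s, -, hn, h1, h2, h3, h4, h5, h6⟩ := inducedCopy_C4_iff.1 h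
    simp only [List.nodup_cons, List.mem_cons, List.not_mem_nil, or_false, not_or] at hn
    have := adj h1
    have := adj h3
    have := adj h4
    have := adj h6
    have := non hn.1.2.1 h2
    have := non hn.2.1.2 h5
    tauto
  · obtain ⟨p, q, r, s, t, -, hn, h1, h2, h3, h4, h5, h6, h7, h8, h9, h10⟩ :=
      inducedCopy_C5_iff.1 h
    simp only [List.nodup_cons, List.mem_cons, List.not_mem_nil, or_false, not_or] at hn
    have := adj h1
    have := adj h4
    have := adj h5
    have := adj h8
    have := adj h10
    have := non hn.1.2.1 h2
    have := non hn.1.2.2.1 h3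
    have := non hn.2.1.2.1 h6
    have := non hn.2.1.2.2 h7
    have := non hn.2.2.1.2 h9
    grind
  · obtain ⟨p, q, r, s, -, hn, h1, h2, h3, h4, h5, h6⟩ := inducedCopy_twoK2_iff.1 h
    simp only [List.nodup_cons, List.mem_cons, List.not_mem_nil, or_false, not_or] at hn
    have := adj h1
    have := adj h6
    have := non hn.1.2.1 h2
    have := non hn.1.2.2 h3
    have := non hn.2.1.1 h4
    have := non hn.2.1.2 h5
    tauto

/-- Complementation interchanges `C₄` and `2K₂` and maps `C₅` to the pentagram, again a `C₅`, on the
same vertices in another order. -/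
theorem exists_obstruction_of_compl {l : List V} (h : Obstruction Gᶜ l) :
    ∃ l', (∀ v ∈ l', v ∈ l) ∧ Obstruction G l' := by
  obtain h | h | h := h
  · obtain ⟨p, q, r, s, rfl, hn, h1, h2, h3, h4, h5, h6⟩ := inducedCopy_C4_iff.1 h
    refine ⟨[p, r, q, s], by simp, .inr (.inr (inducedCopy_twoK2_iff.2
      ⟨p, r, q, s, rfl, ?_⟩))⟩
    simp only [List.nodup_cons, List.mem_cons, List.not_mem_nil, or_false, not_or,
      SimpleGraph.compl_adj] at *
    have := @G.adj_comm
    grind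
  · obtain ⟨p, q, r, s, t, rfl, hn, h1, h2, h3, h4, h5, h6, h7, h8, h9, h10⟩ :=
      inducedCopy_C5_iff.1 h
    refine ⟨[p, r, t, q, s], by simp, .inr (.inl (inducedCopy_C5_iff.2
      ⟨p, r, t, q, s, rfl, ?_⟩))⟩
    simp only [List.nodup_cons, List.mem_cons, List.not_mem_nil, or_false, not_or,
      SimpleGraph.compl_adj] at *
    have := @G.adj_comm
    grind
  · obtain ⟨p, q, r, s, rfl, hn, h1, h2, h3, h4, h5, h6⟩ := inducedCopy_twoK2_iff.1 h
    refine ⟨[p, r, q, s], by simp, .inl (inducedCopy_C4_iff.2 ⟨p, r, q, s, rfl, ?_⟩)⟩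
    simp only [List.nodup_cons, List.mem_cons, List.not_mem_nil, or_false, not_or,
      SimpleGraph.compl_adj] at *
    have := @G.adj_comm
    grind

/-- Being an induced copy depends only on adjacencies between listed vertices. This allows passing
from `G` to the graph known from the records, which agrees with `G` only on recorded vertices. -/
theorem inducedCopy_map {k : ℕ} {H : SimpleGraph (Fin k)} {U : Type*} {G' : SimpleGraph U}
    {l : List V} {i : V → U} (hi : Function.Injective i)
    (hadj : ∀ v ∈ l, ∀ w ∈ l, G'.Adj (i v) (i w) ↔ G.Adj v w) :
    InducedCopy G' H (l.map i) ↔ InducedCopy G H l := by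
  constructor
  · rintro ⟨f, hf⟩
    obtain rfl : k = l.length := by simpa using (congrArg List.length hf).symm
    have hfi : ∀ j : Fin l.length, f j = i l[j] := by
      intro j
      have := congrArg (fun L => L[j.1]?) hf
      simpa using this.symm
    refine ⟨⟨⟨fun j => l[j], fun a b h => f.injective ?_⟩, fun {a b} => ?_⟩, ?_⟩
    · rw [hfi, hfi]
      exact congrArg i h
    · rw [← f.map_adj_iff, hfi, hfi]
      exact (hadj _ (List.getElem_mem _) _ (List.getElem_mem _)).symm
    · exact (List.ofFn_getElem (xs := l)).symm
  · rintro ⟨f, rfl⟩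
    refine ⟨⟨⟨fun j => i (f j), hi.comp f.injective⟩, fun {a b} => ?_⟩, by
      simp [List.map_ofFn]; rfl⟩
    exact (hadj _ (by simp) _ (by simp)).trans f.map_adj_iff

theorem obstruction_map {U : Type*} {G' : SimpleGraph U} {l : List V} {i : V → U}
    (hi : Function.Injective i) (hadj : ∀ v ∈ l, ∀ w ∈ l, G'.Adj (i v) (i w) ↔ G.Adj v w) :
    Obstruction G' (l.map i) ↔ Obstruction G l := by
  simp only [Obstruction, inducedCopy_map hi hadj]

/-- The six vertices found for an edge `ab` contain an obstruction. -/
theorem exists_obstruction {a b x y e f : V} (hab : G.Adj a b)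
    (hxa : ¬ G.Adj x a) (hyb : ¬ G.Adj y b) (hxa' : x ≠ a) (hyb' : y ≠ b)
    (hxy : x = y ∨ G.Adj x b ∧ G.Adj y a)
    (hex : G.Adj e x) (heb : e ≠ b) (heb' : ¬ G.Adj e b)
    (hfy : G.Adj f y) (hfa : f ≠ a) (hfa' : ¬ G.Adj f a) :
    ∃ l, (∀ v ∈ l, v = a ∨ v = b ∨ v = x ∨ v = y ∨ v = e ∨ v = f) ∧ Obstruction G l := by
  have comm := @G.adj_comm
  have irr := @G.irrefl
  -- If `x = y`, this vertex sees neither `a` nor `b`. Unless `e` sees `a` and `f` sees `b`, one of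
  -- the edges `xe`, `xf` forms a `2K₂` with `ab`; otherwise there is a `C₄` or a `C₅`, depending on
  -- `ef`.
  obtain rfl | ⟨hxb, hya⟩ := hxy
  · by_cases hea : G.Adj e a
    · by_cases hfb : G.Adj f b
      · by_cases hef : G.Adj e f
        · refine ⟨[a, b, f, e], by simp, .inl (inducedCopy_C4_iff.2 ⟨_, _, _, _, rfl, ?_⟩)⟩
          simp only [List.nodup_cons, List.mem_cons, List.not_mem_nil, or_false, not_or]
          grind
        · refine ⟨[a, b, f, x, e], by simp, .inr (.inl (inducedCopy_C5_iff.2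
            ⟨_, _, _, _, _, rfl, ?_⟩))⟩
          simp only [List.nodup_cons, List.mem_cons, List.not_mem_nil, or_false, not_or]
          grind
      · refine ⟨[a, b, x, f], by simp, .inr (.inr (inducedCopy_twoK2_iff.2
          ⟨_, _, _, _, rfl, ?_⟩))⟩
        simp only [List.nodup_cons, List.mem_cons, List.not_mem_nil, or_false, not_or]
        grind
    · refine ⟨[a, b, x, e], by simp, .inr (.inr (inducedCopy_twoK2_iff.2
        ⟨_, _, _, _, rfl, ?_⟩))⟩
      simp only [List.nodup_cons, List.mem_cons, List.not_mem_nil, or_false, not_or]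
      grind
  -- Otherwise `x`, `b`, `a`, `y` is a path, closed to a `C₄` if `xy` is an edge and induced if not.
  -- In the latter case `e` alone completes an obstruction, and `f` is not needed.
  · by_cases hxy : G.Adj x y
    · refine ⟨[a, b, x, y], by simp, .inl (inducedCopy_C4_iff.2 ⟨_, _, _, _, rfl, ?_⟩)⟩
      simp only [List.nodup_cons, List.mem_cons, List.not_mem_nil, or_false, not_or]
      grind
    · by_cases hea : G.Adj e a
      · refine ⟨[x, b, a, e], by simp, .inl (inducedCopy_C4_iff.2 ⟨_, _, _, _, rfl, ?_⟩)⟩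
        simp only [List.nodup_cons, List.mem_cons, List.not_mem_nil, or_false, not_or]
        grind
      · by_cases hey : G.Adj e y
        · refine ⟨[x, b, a, y, e], by simp, .inr (.inl (inducedCopy_C5_iff.2
            ⟨_, _, _, _, _, rfl, ?_⟩))⟩
          simp only [List.nodup_cons, List.mem_cons, List.not_mem_nil, or_false, not_or]
          grind
        · refine ⟨[x, e, a, y], by simp, .inr (.inr (inducedCopy_twoK2_iff.2
            ⟨_, _, _, _, rfl, ?_⟩))⟩
          simp only [List.nodup_cons, List.mem_cons, List.not_mem_nil, or_false, not_or]
          grind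

/-- A neighbour of `x` that is not adjacent to `b`, when the degree of `x` is large enough. -/
theorem exists_adj_not_adj [Fintype V] [DecidableEq V] [DecidableRel G.Adj] {a b x : V}
    (hab : G.Adj a b) (hxa : ¬ G.Adj x a) (hxa' : x ≠ a)
    (hd : G.degree b ≤ G.degree x) : ∃ e, G.Adj e x ∧ e ≠ b ∧ ¬ G.Adj e b := by
  by_contra! h
  -- If the claim failed, each neighbour of `x` other than `b` would be a neighbour of `b`, and none
  -- of them is `a`. Since `a` is a neighbour of `b`, the degree of `x` would be smaller than that
  -- of `b`, whether or not `x` and `b` are adjacent.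
  have hsub : (G.neighborFinset x).erase b ⊆ ((G.neighborFinset b).erase x).erase a := by
    intro e he
    simp only [Finset.mem_erase, SimpleGraph.mem_neighborFinset] at he ⊢
    refine ⟨?_, he.2.ne', (h e he.2.symm he.1).symm⟩
    rintro rfl
    exact hxa he.2
  have hcard := Finset.card_le_card hsub
  have ha : a ∈ (G.neighborFinset b).erase x := by
    simp [hab.symm, hxa'.symm]
  rw [Finset.card_erase_of_mem ha] at hcard
  have hpos := Finset.card_pos.2 ⟨a, ha⟩
  by_cases hxb' : G.Adj x b
  · rw [Finset.card_erase_of_mem (by simpa using hxb'), Finset.card_erase_of_mem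
      (by simpa using hxb'.symm), SimpleGraph.card_neighborFinset_eq_degree,
      SimpleGraph.card_neighborFinset_eq_degree] at hcard
    rw [Finset.card_erase_of_mem (by simpa using hxb'.symm),
      SimpleGraph.card_neighborFinset_eq_degree] at hpos
    omega
  · rw [Finset.erase_eq_of_notMem (by simpa using hxb'), Finset.erase_eq_of_notMem
      (by simpa using fun h => hxb' h.symm), SimpleGraph.card_neighborFinset_eq_degree,
      SimpleGraph.card_neighborFinset_eq_degree] at hcard
    rw [Finset.erase_eq_of_notMem (by simpa using fun h => hxb' h.symm),
      SimpleGraph.card_neighborFinset_eq_degree] at hpos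
    omega

end Obstructions

/-! ### The results of the passes -/

section Passes

variable {k : ℕ} (n : ℕ) (row : ℕ → List ℕ)

/-- The key by which the vertices are compared. -/
def key (v : ℕ) : ℕ := (row v).length * n + v

/-- The number of vertices with a key of at least `θ` among the first `v` vertices. -/
def countKey (θ v : ℕ) : ℕ := ((Finset.range v).filter fun u => θ ≤ key n row u).card

/-- The number of vertices smaller than `i` with a key of at least `θ` among the first `v`
vertices. -/
def countPrefix (θ i v : ℕ) : ℕ :=
  ((Finset.range v).filter fun u => θ ≤ key n row u ∧ u < i).card

/-- The number of pairs of adjacent vertices smaller than `i`, the first of which satisfies `p` and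
is smaller than `v`. -/
def countPairs (p : ℕ → Prop) [DecidablePred p] (i v : ℕ) : ℕ :=
  ∑ u ∈ Finset.range v, if p u ∧ u < i then (row u).countP (· < i) else 0

/-- The recorded vertices adjacent to `v`. -/
def nbsOf (recs : List Rec) (v : ℕ) : List ℕ := (recs.map Prod.fst).filter (· ∈ row v)

/-- The record of the vertex `v`. -/
def recOf (θ : ℕ) (recs : List Rec) (v : ℕ) : Rec :=
  (v, decide (θ ≤ key n row v), nbsOf row recs v)

/-- The vertex `v` may be recorded next. -/
def Recordable (lo θ : ℕ) (recs : List Rec) (v : ℕ) : Prop :=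
  FindPred n lo recs v (decide (θ ≤ key n row v)) (nbsOf row recs v)

open Classical in
/-- The vertex recorded after the first `v` rows. -/
noncomputable def findRec (lo θ : ℕ) (recs : List Rec) : ℕ → Option Rec
  | 0 => none
  | v + 1 => (findRec lo θ recs v).or
      (if Recordable n row lo θ recs v then some (recOf n row θ recs v) else none)

/-- The records after `t` passes. -/
noncomputable def recsAt (lo θ : ℕ) : ℕ → List Rec
  | 0 => []
  | t + 1 => recsAt lo θ t ++ [(findRec n row lo θ (recsAt lo θ t) n).getD (n, false, [])]

variable {n row}

theorem findRec_spec {lo θ : ℕ} {recs : List Rec} {v : ℕ} :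
    (findRec n row lo θ recs v = none ∧ ∀ u < v, ¬ Recordable n row lo θ recs u) ∨
      ∃ u < v, Recordable n row lo θ recs u ∧
        findRec n row lo θ recs v = some (recOf n row θ recs u) := by
  induction v with
  | zero => exact .inl ⟨rfl, by simp⟩
  | succ v ih =>
    rw [findRec]
    obtain ⟨h, hn⟩ | ⟨u, hu, hr, h⟩ := ih
    · by_cases hr : Recordable n row lo θ recs v
      · exact .inr ⟨v, by omega, hr, by rw [h, if_pos hr, Option.none_or]⟩
      · refine .inl ⟨by rw [h, if_neg hr, Option.none_or], fun u hu => ?_⟩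
        obtain rfl | hu : u = v ∨ u < v := by omega
        · exact hr
        · exact hn u hu
    · exact .inr ⟨u, by omega, hr, by rw [h, Option.some_or]⟩

namespace Work

/-- The list `l₀` is the part of the row already processed; it makes the statement about `nbs`
strong enough for the induction. -/
theorem foldl_addEdge_eq (v : ℕ) (l : List ℕ) : ∀ (w : Work k) (l₀ : List ℕ),
    w.nbs = (w.recs.map Prod.fst).filter (· ∈ l₀) →
    l.foldl (addEdge v) w = { w with
      nbs := (w.recs.map Prod.fst).filter (· ∈ l₀ ++ l)
      c2 := fun j => w.c2 j +
        if w.inK = true ∧ v < w.query j then l.countP (· < w.query j) else 0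
      c3 := fun j => w.c3 j +
        if w.inK = false ∧ v < w.query j then l.countP (· < w.query j) else 0 } := by
  induction l with
  | nil =>
    intro w l₀ h
    cases w
    simp_all
  | cons u l ih =>
    intro w l₀ h
    have hn : (w.addEdge v u).nbs =
        ((w.addEdge v u).recs.map Prod.fst).filter (· ∈ l₀ ++ [u]) := by
      simp only [addEdge, h]
      refine List.filter_congr fun a ha => ?_
      simp only [List.mem_filter, ha, true_and, decide_eq_true_eq, List.mem_append,
        List.mem_singleton]
    rw [List.foldl_cons, ih _ _ hn]
    have hq : ∀ j, (w.addEdge v u).query j = w.query j := fun _ => rfl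
    simp only [hq]
    simp only [addEdge, List.append_assoc, List.singleton_append, List.countP_cons,
      decide_eq_true_eq]
    congr 1 <;> funext j
    · by_cases h1 : w.inK = true <;> by_cases h2 : v < w.query j <;>
        by_cases h3 : u < w.query j <;> (simp [h1, h2, h3]; try omega)
    · by_cases h1 : w.inK = false <;> by_cases h2 : v < w.query j <;>
        by_cases h3 : u < w.query j <;> (simp [h1, h2, h3]; try omega)

/-- The result of the first `v` rows of a pass. -/
structure Result (n : ℕ) (row : ℕ → List ℕ) (w₀ : Work k) (v : ℕ) (w : Work k) : Prop where
  ph : w.ph = w₀.ph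
  lo : w.lo = w₀.lo
  sz : w.sz = w₀.sz
  θ : w.θ = w₀.θ
  recs : w.recs = w₀.recs
  kc : w.kc = countKey n row w.θ v
  c1_zero : w.ph = 0 → ∀ j, w.c1 j = countKey n row (w.query j) v
  c1_pos : w.ph ≠ 0 → ∀ j, w.c1 j = countPrefix n row w.θ (w.query j) v
  c2 : ∀ j, w.c2 j = countPairs row (fun u => w.θ ≤ key n row u) (w.query j) v
  c3 : ∀ j, w.c3 j = countPairs row (fun u => ¬ w.θ ≤ key n row u) (w.query j) v
  hit : w.hit = findRec n row w.lo w.θ w.recs v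

theorem card_filter_range_succ (p : ℕ → Prop) [DecidablePred p] (v : ℕ) :
    ((Finset.range (v + 1)).filter p).card =
      ((Finset.range v).filter p).card + if p v then 1 else 0 := by
  rw [Finset.range_add_one, Finset.filter_insert]
  split <;> simp

theorem result_doRows (ph lo sz θ : ℕ) (recs : List Rec) (v : ℕ) :
    Result n row (fresh ph lo sz θ recs : Work k) v
      ((fresh ph lo sz θ recs).doRows n row v) := by
  induction v with
  | zero =>
    exact ⟨rfl, rfl, rfl, rfl, rfl, rfl, fun _ _ => rfl, fun _ _ => rfl, fun _ => rfl,
      fun _ => rfl, rfl⟩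
  | succ v ih =>
    obtain ⟨h1, h2, h3, h4, h5, h6, h7, h8, h9, h10, h11⟩ := ih
    rw [doRows]
    generalize doRows n row (fresh ph lo sz θ recs : Work k) v = w at *
    rw [doRow, foldl_addEdge_eq v (row v) _ [] (by simp [startRow])]
    have hq : ∀ j, (w.startRow n v (row v).length).query j = w.query j := fun _ => rfl
    simp only [hq, List.nil_append]
    have hk : (row v).length * n + v = key n row v := rfl
    refine ⟨h1, h2, h3, h4, h5, ?_, ?_, ?_, ?_, ?_, ?_⟩
    · simp only [startRow, endRow, countKey, card_filter_range_succ, h6, hk]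
    · intro hp j
      have hp' : w.ph = 0 := hp
      simp only [startRow, endRow, hk, hp', if_true]
      rw [h7 hp, countKey, countKey, card_filter_range_succ]
      rfl
    · intro hp j
      have hp' : w.ph ≠ 0 := hp
      simp only [startRow, endRow, hk, hp', if_false]
      rw [h8 hp, countPrefix, countPrefix, card_filter_range_succ]
      rfl
    · intro j
      simp only [startRow, endRow, hk, decide_eq_true_eq]
      rw [h9 j, countPairs, countPairs, Finset.sum_range_succ]
      rfl
    · intro j
      simp only [startRow, endRow, hk, decide_eq_false_iff_not]
      rw [h10 j, countPairs, countPairs, Finset.sum_range_succ]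
      rfl
    · exact congrArg (Option.or · _) h11

end Work

/-- The range is cut into at most `k + 1` blocks of width `⌈sz / (k + 1)⌉`, and the candidates are
the last elements of the first `k` blocks. Hence the number of candidates below `T` is the index of
the block containing `T`. -/
theorem search_next {k lo sz T : ℕ} (hlo : lo ≤ T) (hT : T < lo + sz) :
    (Finset.univ.filter fun j : Fin k =>
        lo + (j + 1) * ((sz + k) / (k + 1)) - 1 < T).card =
      (T - lo) / ((sz + k) / (k + 1)) := by
  set d := (sz + k) / (k + 1) with hd
  have hd0 : 0 < d := Nat.div_pos (by omega) (by omega)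
  have hsz : sz ≤ d * (k + 1) := by
    have := Nat.lt_div_mul_add (a := sz + k) (b := k + 1) (by omega)
    rw [← hd] at this
    omega
  -- The index of this block is at most `k`, so the `k` candidates suffice to count it.
  have hle : (T - lo) / d ≤ k := by
    refine Nat.lt_succ_iff.1 ((Nat.div_lt_iff_lt_mul hd0).2 ?_)
    rw [Nat.mul_comm, Nat.succ_eq_add_one]
    omega
  have : ∀ j : Fin k, lo + (j + 1) * d - 1 < T ↔ (j : ℕ) < (T - lo) / d := by
    intro j
    rw [← Nat.add_one_le_iff (n := (j : ℕ)), Nat.le_div_iff_mul_le hd0]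
    have : 0 < (j + 1 : ℕ) * d := Nat.mul_pos (by omega) hd0
    omega
  simp only [this]
  rw [Fin.card_filter_val_lt, min_eq_right hle]

theorem search_bounds {d lo T : ℕ} (hd : 0 < d) (hlo : lo ≤ T) :
    lo + d * ((T - lo) / d) ≤ T ∧ T < lo + d * ((T - lo) / d) + d := by
  have h1 := Nat.div_add_mod (T - lo) d
  have h2 := Nat.mod_lt (T - lo) hd
  omega

theorem width_lt {k sz : ℕ} (hk : 0 < k) (hsz : 2 ≤ sz) : (sz + k) / (k + 1) < sz := by
  rw [Nat.div_lt_iff_lt_mul (by omega)]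
  nlinarith

/-- Each pass that does not finish the search lowers the logarithm of the range by exactly one; the
maximum with `1` pays for the last pass. -/
theorem clog_width {k sz : ℕ} (hk : 0 < k) (hsz : 2 ≤ sz) (hw : (sz + k) / (k + 1) ≠ 1) :
    max 1 (Nat.clog (k + 1) ((sz + k) / (k + 1))) + 1 = max 1 (Nat.clog (k + 1) sz) := by
  rw [Nat.clog_of_two_le (by omega) hsz]
  have h2 : 1 < (sz + k) / (k + 1) := by
    have : 0 < (sz + k) / (k + 1) := Nat.div_pos (by omega) (by omega)
    omega
  have := Nat.clog_pos (b := k + 1) (by omega) h2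
  rw [show sz + (k + 1) - 1 = sz + k by omega]
  omega

variable {D : ℕ → ℕ} {m B X : ℕ}

theorem ok_state {w : Work k} (hw : w.Ok n 0 0) {mode : ℕ} (hmode : mode ≤ 12) {l : List ℕ}
    (hl : l.length ≤ 7) (hl' : ∀ x ∈ l, x ≤ n) : St.Ok n m ⟨mode, n, m, 0, 0, 0, l, w⟩ where
  mode_le := hmode
  n_le := le_rfl
  m_le := le_rfl
  v_le := Nat.zero_le _
  e_le := Nat.zero_le _
  pend_le := Nat.zero_le _
  outl_length := hl
  outl_le := hl'
  work := hw.mono (Nat.zero_le _) (Nat.zero_le _)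

namespace Setting

/-- The search for the threshold. -/
theorem run_search₁ (S : Setting k D n m row B X) {T : ℕ} (hTn : T ≤ n * n)
    (hT : ∀ θ, countKey n row θ n ≤ θ / n + 1 ↔ T ≤ θ) (sz : ℕ) : ∀ (lo : ℕ) (α : AConf (St k)),
    lo ≤ T → T < lo + sz → sz ≤ n * n + 1 → α.Fine X →
    α.s = ⟨2, n, m, 0, 0, 0, [], .fresh 0 lo sz 0 []⟩ →
    ∃ α' : AConf (St k), Run k D B X α α' ∧ α'.Fine X ∧ α.Silent α' ∧
      α'.s = ⟨2, n, m, 0, 0, 0, [], .fresh 1 0 (n + 2) T []⟩ ∧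
      α'.cost ≤ α.cost + max 1 (Nat.clog (k + 1) sz) * passCost n m B := by
  induction sz using Nat.strong_induction_on with
  | _ sz ih =>
    intro lo α hlo hsz hszn hα hs
    have hk := S.pos_k
    have hnn := Nat.le_mul_self n
    have hw0 : (Work.fresh 0 lo sz 0 [] : Work k).Ok n 0 0 :=
      Work.ok_fresh (by omega) (by omega) (by omega) (by omega) (by simp) (by simp)
    have hR := Work.result_doRows (k := k) (n := n) (row := row) 0 lo sz 0 [] n
    set w := (Work.fresh 0 lo sz 0 [] : Work k).doRows n row n
    have hwidth : w.width = (sz + k) / (k + 1) := by rw [Work.width, hR.sz]; rfl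
    have hq : ∀ j, w.query j = lo + (j + 1) * ((sz + k) / (k + 1)) - 1 := fun j => by
      rw [Work.query, hwidth, hR.lo]
      rfl
    have hph : w.ph = 0 := hR.ph
    have hlo1 : w.lo₁ n = lo + w.width * ((T - lo) / w.width) := by
      rw [Work.lo₁, hR.lo, hwidth, ← search_next (k := k) hlo hsz]
      simp only [hR.c1_zero hph, hT, not_le, hq]
      rfl
    have hw1 : 0 < w.width := by
      rw [hwidth]
      exact Nat.div_pos (by omega) (by omega)
    obtain ⟨hb1, hb2⟩ := search_bounds hw1 hlo
    rw [← hlo1] at hb1 hb2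
    by_cases h1 : w.width = 1
    · have hlT : w.lo₁ n = T := by omega
      obtain ⟨β, hr, hβ, hsil, hβs, hc⟩ := S.run_pass hw0 hα hs
        (s := ⟨2, n, m, 0, 0, 0, [], .fresh 1 0 (n + 2) T []⟩)
        (by simp only [St.passEnd]; rw [if_pos hph, if_pos h1, hlT])
        (ok_state (Work.ok_fresh (by omega) (by omega) (by omega) (by omega) (by simp) (by simp))
          (by omega) (by simp) (by simp))
      refine ⟨β, hr, hβ, hsil, hβs, hc.trans ?_⟩
      have := Nat.le_mul_of_pos_left (passCost n m B)
        (show 0 < max 1 (Nat.clog (k + 1) sz) by omega)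
      omega
    · have hsz2 : 2 ≤ sz := by
        by_contra h
        have : sz = 1 := by omega
        rw [hwidth, this, Nat.add_comm 1 k, Nat.div_self (by omega)] at h1
        exact h1 rfl
      have hlt := width_lt hk hsz2
      rw [← hwidth] at hlt
      obtain ⟨β, hr, hβ, hsil, hβs, hc⟩ := S.run_pass hw0 hα hs
        (s := ⟨2, n, m, 0, 0, 0, [], .fresh 0 (w.lo₁ n) w.width 0 []⟩)
        (by simp only [St.passEnd]; rw [if_pos hph, if_neg h1])
        (ok_state (Work.ok_fresh (by omega) (by omega) (by omega) (by omega) (by simp) (by simp))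
          (by omega) (by simp) (by simp))
      obtain ⟨γ, hr', hγ, hsil', hγs, hc'⟩ := ih w.width hlt (w.lo₁ n) β hb1 hb2 (by omega) hβ hβs
      refine ⟨γ, hr.trans hr', hγ, hsil.trans hsil', hγs, hc'.trans ?_⟩
      rw [← clog_width hk hsz2 (hwidth ▸ h1), ← hwidth, Nat.add_mul]
      omega

/-- The search for the shortest prefix with a violation. -/
theorem run_search₂ (S : Setting k D n m row B X) {θ T : ℕ} (hθ : θ ≤ n * n) (hTn : T ≤ n + 1)
    (hT : ∀ i, (i ≤ n ∧ countPrefix n row θ i n * (countPrefix n row θ i n - 1) +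
      countPairs row (fun u => ¬ θ ≤ key n row u) i n =
      countPairs row (fun u => θ ≤ key n row u) i n) ↔ i < T) (sz : ℕ) :
    ∀ (lo : ℕ) (α : AConf (St k)),
    lo ≤ T → T < lo + sz → sz ≤ n + 2 → α.Fine X →
    α.s = ⟨2, n, m, 0, 0, 0, [], .fresh 1 lo sz θ []⟩ →
    ∃ α' : AConf (St k), Run k D B X α α' ∧ α'.Fine X ∧ α.Silent α' ∧
      ((T = n + 1 ∧ ∃ w : Work k, w.θ = θ ∧ w.kc = countKey n row θ n ∧ w.Ok n n (2 * m) ∧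
          α'.s = ⟨4, n, m, 0, 0, 0, [], w⟩) ∨
        T ≤ n ∧ α'.s = ⟨2, n, m, 0, 0, 0, [], .fresh 2 T 0 θ []⟩) ∧
      α'.cost ≤ α.cost + max 1 (Nat.clog (k + 1) sz) * passCost n m B := by
  induction sz using Nat.strong_induction_on with
  | _ sz ih =>
    intro lo α hlo hsz hszn hα hs
    have hk := S.pos_k
    have hnn := Nat.le_mul_self n
    have hw0 : (Work.fresh 1 lo sz θ [] : Work k).Ok n 0 0 :=
      Work.ok_fresh (by omega) (by omega) (by omega) (by omega) (by simp) (by simp)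
    have hR := Work.result_doRows (k := k) (n := n) (row := row) 1 lo sz θ [] n
    have hOk := hw0.doRows row le_rfl
    rw [S.total] at hOk
    set w := (Work.fresh 1 lo sz θ [] : Work k).doRows n row n
    have hwidth : w.width = (sz + k) / (k + 1) := by rw [Work.width, hR.sz]; rfl
    have hq : ∀ j, w.query j = lo + (j + 1) * ((sz + k) / (k + 1)) - 1 := fun j => by
      rw [Work.query, hwidth, hR.lo]
      rfl
    have hph : w.ph = 1 := hR.ph
    have hph0 : w.ph ≠ 0 := by omega
    have hwθ : w.θ = θ := hR.θ
    have hlo1 : w.lo₂ n = lo + w.width * ((T - lo) / w.width) := by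
      rw [Work.lo₂, hR.lo, hwidth, ← search_next (k := k) hlo hsz]
      simp only [hR.c1_pos hph0, hR.c2, hR.c3, hwθ, hT, hq]
      rfl
    have hw1 : 0 < w.width := by
      rw [hwidth]
      exact Nat.div_pos (by omega) (by omega)
    obtain ⟨hb1, hb2⟩ := search_bounds hw1 hlo
    rw [← hlo1] at hb1 hb2
    by_cases h1 : w.width = 1
    · have hlT : w.lo₂ n = T := by omega
      have hcost : α.cost + passCost n m B ≤
          α.cost + max 1 (Nat.clog (k + 1) sz) * passCost n m B :=
        Nat.add_le_add_left (Nat.le_mul_of_pos_left (passCost n m B)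
          (show 0 < max 1 (Nat.clog (k + 1) sz) by omega)) _
      by_cases hTe : T = n + 1
      · obtain ⟨β, hr, hβ, hsil, hβs, hc⟩ := S.run_pass hw0 hα hs
          (s := ⟨4, n, m, 0, 0, 0, [], w⟩)
          (by simp only [St.passEnd]; rw [if_neg hph0, if_pos hph, if_pos h1, hlT, if_pos hTe])
          { mode_le := by simp
            n_le := le_rfl
            m_le := le_rfl
            v_le := Nat.zero_le _
            e_le := Nat.zero_le _
            pend_le := Nat.zero_le _
            outl_length := by simp
            outl_le := by simp
            work := hOk }
        exact ⟨β, hr, hβ, hsil, .inl ⟨hTe, w, hwθ, hwθ ▸ hR.kc, hOk, hβs⟩, hc.trans hcost⟩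
      · obtain ⟨β, hr, hβ, hsil, hβs, hc⟩ := S.run_pass hw0 hα hs
          (s := ⟨2, n, m, 0, 0, 0, [], .fresh 2 T 0 θ []⟩)
          (by simp only [St.passEnd]
              rw [if_neg hph0, if_pos hph, if_pos h1, hlT, if_neg hTe, hwθ])
          (ok_state (Work.ok_fresh (by omega) (by omega) (by omega) (by omega) (by simp) (by simp))
            (by omega) (by simp) (by simp))
        exact ⟨β, hr, hβ, hsil, .inr ⟨by omega, hβs⟩, hc.trans hcost⟩
    · have hsz2 : 2 ≤ sz := by
        by_contra h
        have : sz = 1 := by omega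
        rw [hwidth, this, Nat.add_comm 1 k, Nat.div_self (by omega)] at h1
        exact h1 rfl
      have hlt := width_lt hk hsz2
      rw [← hwidth] at hlt
      obtain ⟨β, hr, hβ, hsil, hβs, hc⟩ := S.run_pass hw0 hα hs
        (s := ⟨2, n, m, 0, 0, 0, [], .fresh 1 (w.lo₂ n) w.width θ []⟩)
        (by simp only [St.passEnd]; rw [if_neg hph0, if_pos hph, if_neg h1, hwθ])
        (ok_state (Work.ok_fresh (by omega) (by omega) (by omega) (by omega) (by simp) (by simp))
          (by omega) (by simp) (by simp))
      obtain ⟨γ, hr', hγ, hsil', hγs, hc'⟩ := ih w.width hlt (w.lo₂ n) β hb1 hb2 (by omega) hβ hβs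
      refine ⟨γ, hr.trans hr', hγ, hsil.trans hsil', hγs, hc'.trans ?_⟩
      rw [← clog_width hk hsz2 (hwidth ▸ h1), ← hwidth, Nat.add_mul]
      omega

theorem _root_.length_recsAt (lo θ t : ℕ) : (recsAt n row lo θ t).length = t := by
  induction t with
  | zero => rfl
  | succ t ih => simp [recsAt, ih]

theorem _root_.recOk_recsAt (lo θ : ℕ) {t : ℕ} (ht : t ≤ 7) :
    ∀ r ∈ recsAt n row lo θ t, RecOk n r := by
  induction t with
  | zero => simp [recsAt]
  | succ t ih =>
    have ih := ih (by omega)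
    intro r hr
    rw [recsAt, List.mem_append, List.mem_singleton] at hr
    obtain hr | rfl := hr
    · exact ih r hr
    · obtain ⟨h, -⟩ | ⟨v, hv, -, h⟩ :=
        findRec_spec (n := n) (row := row) (lo := lo) (θ := θ) (recs := recsAt n row lo θ t) (v := n)
      · rw [h]
        exact ⟨le_rfl, by simp, by simp⟩
      · rw [h]
        refine ⟨hv.le, ?_, fun u hu => ?_⟩
        · refine (List.length_filter_le _ _).trans ?_
          simp only [List.length_map, length_recsAt]
          omega
        · obtain ⟨r, hr, rfl⟩ := List.mem_map.1 (List.mem_of_mem_filter hu)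
          exact (ih r hr).1

/-- The vertices are recorded. -/
theorem run_records (S : Setting k D n m row B X) {lo θ : ℕ} (hlo : lo ≤ n) (hθ : θ ≤ n * n)
    {α : AConf (St k)} (hα : α.Fine X)
    (hs : α.s = ⟨2, n, m, 0, 0, 0, [], .fresh 2 lo 0 θ []⟩) {t : ℕ} (ht : t ≤ 6) :
    ∃ α' : AConf (St k), Run k D B X α α' ∧ α'.Fine X ∧ α.Silent α' ∧
      α'.s = ⟨2, n, m, 0, 0, 0, [], .fresh 2 lo 0 θ (recsAt n row lo θ t)⟩ ∧
      α'.cost ≤ α.cost + t * passCost n m B := by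
  have hnn := Nat.le_mul_self n
  induction t with
  | zero => exact ⟨α, .refl, hα, ⟨rfl, rfl⟩, hs, by simp⟩
  | succ t ih =>
    obtain ⟨β, hr, hβ, hsil, hβs, hc⟩ := ih (by omega)
    have hw0 : (Work.fresh 2 lo 0 θ (recsAt n row lo θ t) : Work k).Ok n 0 0 :=
      Work.ok_fresh le_rfl (by omega) (by omega) (by omega)
        (by rw [length_recsAt]; omega) (recOk_recsAt lo θ (by omega))
    have hR := Work.result_doRows (k := k) (n := n) (row := row) 2 lo 0 θ (recsAt n row lo θ t) n
    obtain ⟨γ, hr', hγ, hsil', hγs, hc'⟩ := S.run_pass hw0 hβ hβs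
      (s := ⟨2, n, m, 0, 0, 0, [], .fresh 2 lo 0 θ (recsAt n row lo θ (t + 1))⟩)
      (by
        simp only [St.passEnd]
        rw [hR.ph, hR.recs, hR.hit, hR.lo, hR.θ, hR.recs]
        simp only [Work.fresh, length_recsAt]
        rw [if_neg (by omega), if_neg (by omega), if_neg (by omega)]
        rfl)
      (ok_state (Work.ok_fresh le_rfl (by omega) (by omega) (by omega)
        (by rw [length_recsAt]; omega) (recOk_recsAt lo θ (by omega)))
        (by omega) (by simp) (by simp))
    refine ⟨γ, hr.trans hr', hγ, hsil.trans hsil', hγs, hc'.trans ?_⟩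
    rw [Nat.add_mul]
    omega

/-- The seventh recording pass is treated separately because its end also evaluates the records. -/
theorem run_pick (S : Setting k D n m row B X) {lo θ : ℕ} (hlo : lo ≤ n) (hθ : θ ≤ n * n)
    {α : AConf (St k)} (hα : α.Fine X)
    (hs : α.s = ⟨2, n, m, 0, 0, 0, [], .fresh 2 lo 0 θ []⟩)
    (hpick : (pick n (recsAt n row lo θ 7)).length ≤ 7 ∧
      ∀ x ∈ pick n (recsAt n row lo θ 7), x ≤ n) :
    ∃ (α' : AConf (St k)) (w : Work k), Run k D B X α α' ∧ α'.Fine X ∧ α.Silent α' ∧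
      w.Ok n 0 0 ∧ α'.s = ⟨10, n, m, 0, 0, 0, pick n (recsAt n row lo θ 7), w⟩ ∧
      α'.cost ≤ α.cost + 7 * passCost n m B := by
  have hnn := Nat.le_mul_self n
  obtain ⟨β, hr, hβ, hsil, hβs, hc⟩ := S.run_records hlo hθ hα hs le_rfl
  have hw0 : (Work.fresh 2 lo 0 θ (recsAt n row lo θ 6) : Work k).Ok n 0 0 :=
    Work.ok_fresh le_rfl (by omega) (by omega) (by omega)
      (by rw [length_recsAt]; omega) (recOk_recsAt lo θ (by omega))
  have hw1 : (Work.fresh 2 lo 0 θ (recsAt n row lo θ 7) : Work k).Ok n 0 0 :=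
    Work.ok_fresh le_rfl (by omega) (by omega) (by omega)
      (by rw [length_recsAt]) (recOk_recsAt lo θ (by omega))
  have hR := Work.result_doRows (k := k) (n := n) (row := row) 2 lo 0 θ (recsAt n row lo θ 6) n
  obtain ⟨γ, hr', hγ, hsil', hγs, hc'⟩ := S.run_pass hw0 hβ hβs
    (s := ⟨10, n, m, 0, 0, 0, pick n (recsAt n row lo θ 7), .fresh 2 lo 0 θ (recsAt n row lo θ 7)⟩)
    (by
      simp only [St.passEnd]
      rw [hR.ph, hR.recs, hR.hit, hR.lo, hR.θ, hR.recs]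
      simp only [Work.fresh, length_recsAt]
      rw [if_neg (by omega), if_neg (by omega), if_pos trivial]
      rfl)
    (ok_state hw1 (by omega) hpick.1 hpick.2)
  exact ⟨γ, _, hr.trans hr', hγ, hsil.trans hsil', hw1, hγs, by omega⟩

end Setting

end Passes

/-! ### The graph behind the arrays -/

/-! ### The degree threshold -/

section Threshold

variable {n : ℕ} {row : ℕ → List ℕ}

theorem key_lt (h : ∀ v < n, (row v).length < n) {v : ℕ} (hv : v < n) : key n row v < n * n := by
  have := Nat.mul_le_mul_right n (Nat.succ_le_of_lt (h v hv))
  rw [Nat.succ_mul] at this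
  rw [key]
  omega

/-- A key is a number in base `n` with the degree as leading part and the vertex as last digit. Keys
are thus distinct and ordered by degree first. -/
theorem key_div {v : ℕ} (hv : v < n) : key n row v / n = (row v).length := by
  rw [key, Nat.mul_comm, Nat.mul_add_div (by omega), Nat.div_eq_of_lt hv, Nat.add_zero]

theorem countKey_anti {θ θ' : ℕ} (h : θ ≤ θ') : countKey n row θ' n ≤ countKey n row θ n :=
  Finset.card_le_card fun _ hv => by
    simp only [Finset.mem_filter] at hv ⊢
    exact ⟨hv.1, h.trans hv.2⟩

/-- Distinct vertices have distinct keys, so raising the threshold by one loses at most one vertex.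
This is what breaking ties by the index is for. -/
theorem countKey_le_succ (θ : ℕ) : countKey n row θ n ≤ countKey n row (θ + 1) n + 1 := by
  have h1 : ((Finset.range n).filter fun v => key n row v = θ).card ≤ 1 := by
    refine Finset.card_le_one.2 fun u hu v hv => ?_
    simp only [Finset.mem_filter, Finset.mem_range] at hu hv
    have h : key n row u % n = key n row v % n := by rw [hu.2, hv.2]
    rwa [key, key, Nat.mul_add_mod_self_right, Nat.mul_add_mod_self_right, Nat.mod_eq_of_lt hu.1,
      Nat.mod_eq_of_lt hv.1] at h
  refine (Finset.card_le_card ?_).trans ((Finset.card_union_le _ _).trans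
    (Nat.add_le_add_left h1 _))
  intro v hv
  simp only [Finset.mem_union, Finset.mem_filter, Finset.mem_range] at hv ⊢
  omega

/-- A threshold such that the vertices above it have as many neighbours as a clique of this size
requires, and the vertices below it have fewer neighbours than there are vertices above it. -/
theorem exists_threshold (h : ∀ v < n, (row v).length < n) :
    ∃ T ≤ n * n, (∀ θ, countKey n row θ n ≤ θ / n + 1 ↔ T ≤ θ) ∧
      ∀ v < n, (T ≤ key n row v → countKey n row T n ≤ (row v).length + 1) ∧
        (¬ T ≤ key n row v → (row v).length + 1 ≤ countKey n row T n) := by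
  have h0 : countKey n row (n * n) n ≤ n * n / n + 1 := by
    have : countKey n row (n * n) n = 0 := Finset.card_eq_zero.2 (Finset.filter_eq_empty_iff.2
      fun v hv => not_le.2 (key_lt h (Finset.mem_range.1 hv)))
    rw [this]
    exact Nat.zero_le _
  -- The left side decreases in `θ` and the right side increases, so the property is monotone and
  -- its least solution is the cut.
  have hex : ∃ θ, countKey n row θ n ≤ θ / n + 1 := ⟨_, h0⟩
  have hiff : ∀ θ, countKey n row θ n ≤ θ / n + 1 ↔ Nat.find hex ≤ θ := by
    refine fun θ => ⟨fun hθ => Nat.find_min' hex hθ, fun hθ => ?_⟩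
    exact (countKey_anti hθ).trans ((Nat.find_spec hex).trans
      (Nat.add_le_add_right (Nat.div_le_div_right hθ) 1))
  refine ⟨Nat.find hex, Nat.find_min' hex h0, hiff, fun v hv => ⟨fun hk => ?_, fun hk => ?_⟩⟩
  · refine (Nat.find_spec hex).trans (Nat.add_le_add_right ?_ 1)
    rw [← key_div (row := row) hv]
    exact Nat.div_le_div_right hk
  -- By minimality the predecessor `T` of the cut fails, so at least `T / n + 2` vertices have a key
  -- of at least `T`. At most one of them is lost at the cut, and a vertex below the cut has degree
  -- at most `T / n`.
  · obtain ⟨T, hT⟩ : ∃ T, Nat.find hex = T + 1 := ⟨Nat.find hex - 1, by omega⟩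
    have h1 : ¬ countKey n row T n ≤ T / n + 1 := fun h => by
      have := (hiff T).1 h
      omega
    have h2 := countKey_le_succ (n := n) (row := row) T
    have h3 : (row v).length ≤ T / n := by
      rw [← key_div (row := row) hv]
      exact Nat.div_le_div_right (by omega)
    rw [hT]
    generalize T / n = q at *
    omega

end Threshold

/-! ### Counting violations of the candidate partition -/

namespace AdjacencyRows

variable {n : ℕ} {G : SimpleGraph (Fin n)} (R : AdjacencyRows G)

/-- The rows as lists of numbers. -/
def rows (v : ℕ) : List ℕ := if h : v < n then (R.row ⟨v, h⟩).map Fin.val else []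

theorem rows_val (v : Fin n) : R.rows v = (R.row v).map Fin.val := by
  rw [rows, dif_pos v.2]

theorem mem_rows {u v : Fin n} : (u : ℕ) ∈ R.rows v ↔ G.Adj v u := by
  rw [rows_val, List.mem_map_of_injective Fin.val_injective, R.mem_row]

theorem rowStart_rows {v : ℕ} (hv : v ≤ n) : rowStart R.rows v =
    ((List.ofFn R.row).take v).flatten.length := by
  induction v with
  | zero => simp [rowStart]
  | succ v ih =>
    rw [rowStart_succ, ih (by omega), List.take_succ_eq_append_getElem (by simpa using hv)]
    simp [rows, show v < n by omega]

variable [DecidableRel G.Adj]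

theorem toFinset_row (v : Fin n) : (R.row v).toFinset = G.neighborFinset v := by
  ext w
  simp [R.mem_row]

theorem length_rows (v : Fin n) : (R.rows v).length = G.degree v := by
  rw [rows_val, List.length_map, ← List.toFinset_card_of_nodup (R.nodup v), R.toFinset_row,
    SimpleGraph.card_neighborFinset_eq_degree]

theorem countP_rows (v : Fin n) (i : ℕ) :
    (R.rows v).countP (· < i) = ∑ w : Fin n, if G.Adj v w ∧ (w : ℕ) < i then 1 else 0 := by
  rw [rows_val, List.countP_map, List.countP_eq_length_filter,
    ← List.toFinset_card_of_nodup ((R.nodup v).filter _), ← Finset.card_filter]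
  congr 1
  ext w
  simp [R.mem_row]

/-- The vertices below `i` do not contain a violation of the partition given by `p`. -/
theorem count_eq_iff (θ i : ℕ) :
    countPrefix n R.rows θ i n * (countPrefix n R.rows θ i n - 1) +
        countPairs R.rows (fun u => ¬ θ ≤ key n R.rows u) i n =
      countPairs R.rows (fun u => θ ≤ key n R.rows u) i n ↔
    ∀ u v : Fin n, (u : ℕ) < i → (v : ℕ) < i →
      (θ ≤ key n R.rows u → θ ≤ key n R.rows v → u ≠ v → G.Adj u v) ∧
      (¬ θ ≤ key n R.rows u → ¬ θ ≤ key n R.rows v → ¬ G.Adj u v) := by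
  set K : Finset (Fin n) := Finset.univ.filter fun u => θ ≤ key n R.rows u ∧ (u : ℕ) < i with hK
  set I : Finset (Fin n) := Finset.univ.filter fun u => ¬ θ ≤ key n R.rows u ∧ (u : ℕ) < i with hI
  let a : Fin n → Fin n → ℕ := fun u w => if G.Adj u w then 1 else 0
  have hc : countPrefix n R.rows θ i n = K.card := by
    rw [countPrefix, hK, Finset.card_filter, Finset.card_filter, Finset.sum_range]
  have hrow : ∀ u : Fin n, (R.rows u).countP (· < i) = ∑ w ∈ K, a u w + ∑ w ∈ I, a u w := by
    intro u
    rw [R.countP_rows, hK, hI, Finset.sum_filter, Finset.sum_filter, ← Finset.sum_add_distrib]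
    refine Finset.sum_congr rfl fun w _ => ?_
    by_cases h1 : G.Adj u w <;> by_cases h2 : (w : ℕ) < i <;>
      by_cases h3 : θ ≤ key n R.rows w <;> simp [a, h1, h2, h3]
  -- Both counts of adjacencies contain the pairs between `K` and `I`, which cancel. What remains is
  -- the equality of `|K| (|K| - 1)` plus the pairs inside `I` with the pairs inside `K`; since the
  -- latter are at most `|K| (|K| - 1)`, it holds only if `K` is a clique and `I` is independent.
  have hD : countPairs R.rows (fun u => θ ≤ key n R.rows u) i n =
      ∑ u ∈ K, ∑ w ∈ K, a u w + ∑ u ∈ K, ∑ w ∈ I, a u w := by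
    rw [countPairs, Finset.sum_range, ← Finset.sum_add_distrib, hK, Finset.sum_filter]
    simp only [hrow, ← hK]
  have hA : countPairs R.rows (fun u => ¬ θ ≤ key n R.rows u) i n =
      ∑ u ∈ K, ∑ w ∈ I, a u w + ∑ u ∈ I, ∑ w ∈ I, a u w := by
    rw [Finset.sum_comm (s := K)]
    have : ∀ u ∈ I, ∑ w ∈ K, a w u = ∑ w ∈ K, a u w := fun u _ =>
      Finset.sum_congr rfl fun w _ => by simp only [a, G.adj_comm]
    rw [Finset.sum_congr rfl this, countPairs, Finset.sum_range, ← Finset.sum_add_distrib, hI,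
      Finset.sum_filter]
    simp only [hrow, ← hI]
  have hkk : K.card * (K.card - 1) = ∑ u ∈ K, ∑ w ∈ K, if u ≠ w then 1 else 0 := by
    rw [← smul_eq_mul, ← Finset.sum_const]
    refine Finset.sum_congr rfl fun u hu => ?_
    rw [← Finset.card_filter, Finset.filter_ne, Finset.card_erase_of_mem hu]
  have hle : ∀ u w, a u w ≤ if u ≠ w then 1 else 0 := by
    intro u w
    by_cases h : G.Adj u w
    · simp [a, h, h.ne]
    · simp [a, h]
  have hle1 : ∀ u ∈ K, ∑ w ∈ K, a u w ≤ ∑ w ∈ K, if u ≠ w then 1 else 0 := fun u _ =>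
    Finset.sum_le_sum fun w _ => hle u w
  rw [hc, hA, hD, hkk]
  have hle2 := Finset.sum_le_sum hle1
  have hmem : ∀ u : Fin n, (u : ℕ) < i → (u ∈ K ↔ θ ≤ key n R.rows u) ∧
      (u ∈ I ↔ ¬ θ ≤ key n R.rows u) := fun u hu => by simp [hK, hI, hu]
  constructor
  · intro he
    have h1 : ∑ u ∈ K, ∑ w ∈ K, a u w = ∑ u ∈ K, ∑ w ∈ K, if u ≠ w then 1 else 0 := by omega
    have h2 : ∑ u ∈ I, ∑ w ∈ I, a u w = 0 := by omega
    intro u v hu hv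
    refine ⟨fun hu' hv' hne => ?_, fun hu' hv' => ?_⟩
    · have huK := (hmem u hu).1.2 hu'
      have hvK := (hmem v hv).1.2 hv'
      have := (Finset.sum_eq_sum_iff_of_le fun w _ => hle u w).1
        ((Finset.sum_eq_sum_iff_of_le hle1).1 h1 u huK) v hvK
      by_contra hadj
      simp [a, hadj, hne] at this
    · have huI := (hmem u hu).2.2 hu'
      have hvI := (hmem v hv).2.2 hv'
      have := Finset.sum_eq_zero_iff.1 (Finset.sum_eq_zero_iff.1 h2 u huI) v hvI
      intro hadj
      simp [a, hadj] at this
  · intro h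
    have h1 : ∑ u ∈ K, ∑ w ∈ K, a u w = ∑ u ∈ K, ∑ w ∈ K, if u ≠ w then 1 else 0 := by
      refine Finset.sum_congr rfl fun u hu => Finset.sum_congr rfl fun w hw => ?_
      simp only [hK, Finset.mem_filter, Finset.mem_univ, true_and] at hu hw
      by_cases hne : u = w
      · simp [a, hne]
      · simp [a, hne, (h u w hu.2 hw.2).1 hu.1 hw.1 hne]
    have h2 : ∑ u ∈ I, ∑ w ∈ I, a u w = 0 := by
      refine Finset.sum_eq_zero fun u hu => Finset.sum_eq_zero fun w hw => ?_
      simp only [hI, Finset.mem_filter, Finset.mem_univ, true_and] at hu hw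
      simp [a, (h u w hu.2 hw.2).2 hu.1 hw.1]
    omega

/-- The length of the shortest prefix with a violation. -/
theorem exists_prefix (θ : ℕ) : ∃ T ≤ n + 1,
    (∀ i, (i ≤ n ∧ countPrefix n R.rows θ i n * (countPrefix n R.rows θ i n - 1) +
        countPairs R.rows (fun u => ¬ θ ≤ key n R.rows u) i n =
      countPairs R.rows (fun u => θ ≤ key n R.rows u) i n) ↔ i < T) := by
  simp only [R.count_eq_iff]
  -- The condition `i ≤ n` makes `n + 1` fail, so a least failing index exists; the value `n + 1`
  -- signals that there is no violation.
  have hex : ∃ i, ¬ (i ≤ n ∧ ∀ u v : Fin n, (u : ℕ) < i → (v : ℕ) < i →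
      (θ ≤ key n R.rows u → θ ≤ key n R.rows v → u ≠ v → G.Adj u v) ∧
      (¬ θ ≤ key n R.rows u → ¬ θ ≤ key n R.rows v → ¬ G.Adj u v)) := ⟨n + 1, by simp⟩
  refine ⟨Nat.find hex, Nat.find_min' hex (by simp), fun i => ⟨fun hi => ?_, fun hi => ?_⟩⟩
  · by_contra hlt
    refine Nat.find_spec hex ⟨(not_lt.1 hlt).trans hi.1, fun u v hu hv => ?_⟩
    exact hi.2 u v (hu.trans_le (not_lt.1 hlt)) (hv.trans_le (not_lt.1 hlt))
  · exact not_not.1 (Nat.find_min hex hi)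

theorem sum_rows : rowStart R.rows n = 2 * G.edgeSet.ncard := by
  rw [rowStart, Finset.sum_range, Finset.sum_congr rfl fun v _ => R.length_rows v,
    G.sum_degrees_eq_twice_card_edges, ← SimpleGraph.coe_edgeFinset, Set.ncard_coe_finset]

end AdjacencyRows

/-! ### The input arrays and the graph on the records -/

namespace AdjacencyRows

variable {n : ℕ} {G : SimpleGraph (Fin n)} (R : AdjacencyRows G)

theorem rowStart_eq_sum_filter (i : Fin n) :
    ∑ j ∈ Finset.univ.filter (· < i), (R.row j).length = rowStart R.rows i := by
  have h : Finset.range (i : ℕ) = (Finset.range n).filter fun u => u < (i : ℕ) := by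
    ext u
    simp only [Finset.mem_range, Finset.mem_filter]
    omega
  rw [rowStart, h, Finset.sum_filter, Finset.sum_filter, Finset.sum_range]
  refine Finset.sum_congr rfl fun u _ => ?_
  rw [R.rows_val, List.length_map]; rfl

theorem layout [DecidableRel G.Adj] :
    Layout (fun i => R.input.getD i 0) n G.edgeSet.ncard R.rows where
  zero := rfl
  one := rfl
  pos v hv := by
    have hl : R.posArray.length = n := by simp [posArray]
    change (R.posArray ++ R.edgeArray).getD (v + 1) 0 = _
    rw [List.getD_append _ _ _ _ (by omega), List.getD_eq_getElem _ _ (by omega)]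
    simp only [posArray, List.getElem_ofFn]
    exact R.rowStart_eq_sum_filter ⟨v + 1, hv⟩
  edge v hv i hi := by
    have hl : R.posArray.length = n := by simp [posArray]
    rw [show n + 2 + (rowStart R.rows v + i) = n + (rowStart R.rows v + i) + 2 by omega]
    change (R.posArray ++ R.edgeArray).getD (n + (rowStart R.rows v + i)) 0 = _
    rw [List.getD_append_right _ _ _ _ (by omega), hl, Nat.add_sub_cancel_left, edgeArray]
    have hsplit : List.ofFn R.row = (List.ofFn R.row).take v ++
        R.row ⟨v, hv⟩ :: (List.ofFn R.row).drop (v + 1) := by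
      conv_lhs => rw [← List.take_append_drop v (List.ofFn R.row),
        List.drop_eq_getElem_cons (by simpa using hv)]
      simp
    rw [hsplit, List.flatten_append, List.flatten_cons, List.map_append, List.map_append,
      List.getD_append_right _ _ _ _ (by rw [List.length_map, R.rowStart_rows hv.le]; omega),
      List.length_map, ← R.rowStart_rows hv.le, Nat.add_sub_cancel_left]
    have hrow : R.rows v = (R.row ⟨v, hv⟩).map Fin.val := R.rows_val ⟨v, hv⟩
    rw [← hrow, List.getD_append _ _ _ _ hi, List.getD_eq_getElem _ _ hi]
  total := R.sum_rows

theorem input_le (x : ℕ) : R.input.getD x 0 ≤ n + 2 * G.edgeSet.ncard := by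
  classical
  refine Nat.lt_succ_iff.1 (getD_lt (by omega) (fun y hy => ?_) x)
  rw [input, List.mem_cons, List.mem_cons, List.mem_append] at hy
  obtain rfl | rfl | hy | hy := hy
  · omega
  · omega
  · rw [posArray, List.mem_ofFn] at hy
    obtain ⟨i, rfl⟩ := hy
    rw [R.rowStart_eq_sum_filter]
    have := R.layout.rowStart_le i.2.le
    omega
  · rw [edgeArray, List.mem_map] at hy
    obtain ⟨i, -, rfl⟩ := hy
    have := i.2
    omega

/-- The graph in which the violation is an edge. -/
def flip (_ : AdjacencyRows G) (fl : Bool) : SimpleGraph (Fin n) := if fl then Gᶜ else G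

/-- This is the form in which `FindPred` tests adjacency in the graph or its complement. The
inequality matters for the complement, where a vertex is missing from its own neighbour list. -/
theorem flip_adj {fl : Bool} {v w : Fin n} {nbs : List ℕ}
    (h : (v : ℕ) ∈ nbs ↔ G.Adj w v) :
    ((w : ℕ) ≠ v ∧ ((v : ℕ) ∈ nbs ↔ fl = false)) ↔ (R.flip fl).Adj w v := by
  rw [h, flip]
  cases fl
  · simp only [iff_true, Bool.false_eq_true, if_false]
    exact ⟨fun h => h.2, fun h => ⟨fun he => h.ne (Fin.ext he), h⟩⟩
  · simp [Fin.ext_iff]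

/-- The graph on the recorded vertices is the induced subgraph. -/
theorem recGraph_adj (lo θ t : ℕ) (u v : Fin n)
    (hu : (u : ℕ) ∈ (recsAt n R.rows lo θ t).map Prod.fst)
    (hv : (v : ℕ) ∈ (recsAt n R.rows lo θ t).map Prod.fst) :
    (recGraph (recsAt n R.rows lo θ t)).Adj u v ↔ G.Adj u v := by
  induction t with
  | zero => simp [recsAt] at hu
  | succ t ih =>
    have key : ∀ w : Fin n, (w : ℕ) ∈ (recsAt n R.rows lo θ (t + 1)).map Prod.fst →
        (w : ℕ) ∈ (recsAt n R.rows lo θ t).map Prod.fst ∨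
          ∃ r, recsAt n R.rows lo θ (t + 1) = recsAt n R.rows lo θ t ++ [r] ∧
            r = recOf n R.rows θ (recsAt n R.rows lo θ t) w := by
      intro w hw
      rw [recsAt, List.map_append, List.mem_append] at hw
      refine hw.imp_right fun hw => ⟨_, rfl, ?_⟩
      simp only [List.map_cons, List.map_nil, List.mem_singleton] at hw
      obtain ⟨h, -⟩ | ⟨u, hu, -, h⟩ := findRec_spec (n := n) (row := R.rows) (lo := lo) (θ := θ)
          (recs := recsAt n R.rows lo θ t) (v := n)
      · rw [h] at hw
        have := w.2
        simp only [Option.getD_none] at hw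
        omega
      · rw [h] at hw ⊢
        simp only [Option.getD_some, recOf] at hw ⊢
        rw [hw]
    have hsound : ∀ r ∈ recsAt n R.rows lo θ (t + 1), ∀ x ∈ r.2.2, x ∈ R.rows r.1 := by
      have : ∀ s, ∀ r ∈ recsAt n R.rows lo θ s, ∀ x ∈ r.2.2, x ∈ R.rows r.1 := by
        intro s
        induction s with
        | zero => simp [recsAt]
        | succ s ih =>
          intro r hr x hx
          rw [recsAt, List.mem_append, List.mem_singleton] at hr
          obtain hr | rfl := hr
          · exact ih r hr x hx
          · obtain ⟨h, -⟩ | ⟨u, hu, -, h⟩ := findRec_spec (n := n) (row := R.rows) (lo := lo)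
              (θ := θ) (recs := recsAt n R.rows lo θ s) (v := n)
            · rw [h] at hx
              simp at hx
            · rw [h] at hx ⊢
              simpa [recOf, nbsOf] using (List.mem_filter.1 hx).2
      exact this _
    constructor
    · intro h
      rw [recGraph, SimpleGraph.fromRel_adj] at h
      obtain ⟨-, ⟨r, hr, hru, hrv⟩ | ⟨r, hr, hrv, hru⟩⟩ := h
      · have := hsound r hr _ hrv
        rw [hru] at this
        exact R.mem_rows.1 this
      · have := hsound r hr _ hru
        rw [hrv] at this
        exact (R.mem_rows.1 this).symm
    · intro h
      have hne : (u : ℕ) ≠ v := fun he => h.ne (Fin.ext he)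
      rw [recGraph, SimpleGraph.fromRel_adj]
      refine ⟨hne, ?_⟩
      -- Whichever of `u` and `v` is recorded later lists the other among its neighbours. If both
      -- were new in this pass, they would be the same vertex.
      obtain hu' | ⟨r, hr, hr'⟩ := key u hu
      · obtain hv' | ⟨r, hr, hr'⟩ := key v hv
        · have := (ih hu' hv').2 h
          rw [recGraph, SimpleGraph.fromRel_adj] at this
          rw [recsAt]
          refine this.2.imp ?_ ?_ <;>
          · rintro ⟨r, hr, h⟩
            exact ⟨r, List.mem_append_left _ hr, h⟩
        · refine .inr ⟨r, by rw [hr]; simp, by rw [hr']; rfl, ?_⟩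
          rw [hr']
          exact List.mem_filter.2 ⟨hu', by simpa using R.mem_rows.2 h.symm⟩
      · obtain hv' | ⟨r₂, hr₂, hr₂'⟩ := key v hv
        · refine .inl ⟨r, by rw [hr]; simp, by rw [hr']; rfl, ?_⟩
          rw [hr']
          exact List.mem_filter.2 ⟨hv', by simpa using R.mem_rows.2 h⟩
        · exfalso
          rw [hr] at hr₂
          have : r = r₂ := by simpa using hr₂
          rw [hr', hr₂'] at this
          exact hne (congrArg Prod.fst this)

theorem exists_recs_succ {lo θ t : ℕ}
    (h : ∃ w : Fin n, Recordable n R.rows lo θ (recsAt n R.rows lo θ t) w) :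
    ∃ w : Fin n, Recordable n R.rows lo θ (recsAt n R.rows lo θ t) w ∧
      recsAt n R.rows lo θ (t + 1) =
        recsAt n R.rows lo θ t ++ [recOf n R.rows θ (recsAt n R.rows lo θ t) w] := by
  obtain ⟨w, hw⟩ := h
  obtain ⟨-, hn⟩ | ⟨u, hu, hr, he⟩ := findRec_spec (n := n) (row := R.rows) (lo := lo) (θ := θ)
    (recs := recsAt n R.rows lo θ t) (v := n)
  · exact absurd hw (hn w w.2)
  · exact ⟨⟨u, hu⟩, hr, by rw [recsAt, he]; rfl⟩

theorem recs_succ_of_not {lo θ t : ℕ}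
    (h : ¬ ∃ w : Fin n, Recordable n R.rows lo θ (recsAt n R.rows lo θ t) w) :
    recsAt n R.rows lo θ (t + 1) = recsAt n R.rows lo θ t ++ [(n, false, [])] := by
  obtain ⟨he, -⟩ | ⟨u, hu, hr, he⟩ := findRec_spec (n := n) (row := R.rows) (lo := lo) (θ := θ)
    (recs := recsAt n R.rows lo θ t) (v := n)
  · rw [recsAt, he]
    rfl
  · exact absurd ⟨⟨u, hu⟩, hr⟩ h

/-- If there is an obstruction among the recorded vertices, one is picked. -/
theorem pick_spec {lo θ t : ℕ} {l : List (Fin n)}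
    (hl : ∀ v ∈ l, (v : ℕ) ∈ (recsAt n R.rows lo θ t).map Prod.fst) (ho : Obstruction G l) :
    ∃ l' : List (Fin n), pick n (recsAt n R.rows lo θ t) = l'.map Fin.val ∧ Obstruction G l' := by
  have hex : ∃ l, (∀ v ∈ l, v < n ∧ v ∈ (recsAt n R.rows lo θ t).map Prod.fst) ∧
      Obstruction (recGraph (recsAt n R.rows lo θ t)) l := by
    refine ⟨l.map Fin.val, ?_, (obstruction_map Fin.val_injective fun u hu v hv =>
      R.recGraph_adj lo θ t u v (hl u hu) (hl v hv)).2 ho⟩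
    intro v hv
    obtain ⟨w, hw, rfl⟩ := List.mem_map.1 hv
    exact ⟨w.2, hl w hw⟩
  rw [pick, dif_pos hex]
  obtain ⟨hm, hob⟩ := hex.choose_spec
  obtain ⟨l', hl'⟩ : ∃ l' : List (Fin n), hex.choose = l'.map Fin.val := by
    refine ⟨hex.choose.pmap (fun v hv => ⟨v, hv⟩) fun v hv => (hm v hv).1, ?_⟩
    rw [List.map_pmap]
    simp
  refine ⟨l', hl', ?_⟩
  rw [hl'] at hob hm
  refine (obstruction_map Fin.val_injective fun u hu v hv => ?_).1 hob
  exact R.recGraph_adj lo θ t u v (hm u (List.mem_map_of_mem hu)).2 (hm v (List.mem_map_of_mem hv)).2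

end AdjacencyRows

/-! ### The recorded vertices contain an obstruction -/

/-- If `a` saw all of `S`, it would have the `S.card + 1` neighbours in `insert b S`. -/
theorem exists_not_adj {V : Type*} [Fintype V] [DecidableEq V] {H : SimpleGraph V}
    [DecidableRel H.Adj] {S : Finset V} {a b : V} (hab : H.Adj a b) (hb : b ∉ S)
    (hd : H.degree a ≤ S.card) : ∃ x ∈ S, ¬ H.Adj x a := by
  by_contra! h
  have hsub : insert b S ⊆ H.neighborFinset a := by
    intro v hv
    rw [SimpleGraph.mem_neighborFinset]
    obtain rfl | hv := Finset.mem_insert.1 hv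
    · exact hab
    · exact (h v hv).symm
  have := Finset.card_le_card hsub
  rw [Finset.card_insert_of_notMem hb, SimpleGraph.card_neighborFinset_eq_degree] at this
  omega

namespace AdjacencyRows

variable {n : ℕ} {G : SimpleGraph (Fin n)} (R : AdjacencyRows G)

/-- There are `t` records, those of `a` and of the vertices in `l`. -/
def StartsAt (lo θ t : ℕ) (a : Fin n) (l : List ℕ) : Prop :=
  (recsAt n R.rows lo θ t).map Prod.fst = (a : ℕ) :: l ∧
    ((recsAt n R.rows lo θ t).getD 0 (n, false, [])).2.1 = decide (θ ≤ key n R.rows a)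

theorem startsAt_one {θ : ℕ} (a : Fin n) : R.StartsAt (a + 1) θ 1 a [] := by
  obtain ⟨w, hw, h⟩ := R.exists_recs_succ (lo := a + 1) (θ := θ) (t := 0) ⟨a, by
    simp [Recordable, FindPred, recsAt]⟩
  obtain rfl : w = a := by
    simpa [Recordable, FindPred, recsAt, Fin.ext_iff] using hw
  rw [StartsAt, h]
  exact ⟨rfl, rfl⟩

variable {R}

theorem StartsAt.append {lo θ t : ℕ} {a : Fin n} {l : List ℕ} (h : R.StartsAt lo θ t a l)
    {r : Rec} (hr : recsAt n R.rows lo θ (t + 1) = recsAt n R.rows lo θ t ++ [r]) :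
    R.StartsAt lo θ (t + 1) a (l ++ [r.1]) := by
  have hlen : 0 < (recsAt n R.rows lo θ t).length := by
    rw [← List.length_map (f := Prod.fst), h.1]
    simp
  refine ⟨?_, ?_⟩
  · rw [hr, List.map_append, h.1]
    rfl
  · rw [← h.2, hr, List.getD_append _ _ _ _ hlen]

theorem StartsAt.succ {lo θ t : ℕ} {a : Fin n} {l : List ℕ} (h : R.StartsAt lo θ t a l)
    (hex : ∃ w : Fin n, Recordable n R.rows lo θ (recsAt n R.rows lo θ t) w) :
    ∃ w : Fin n, Recordable n R.rows lo θ (recsAt n R.rows lo θ t) w ∧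
      R.StartsAt lo θ (t + 1) a (l ++ [(w : ℕ)]) := by
  obtain ⟨w, hw, he⟩ := R.exists_recs_succ hex
  exact ⟨w, hw, h.append he⟩

theorem StartsAt.succ_of_not {lo θ t : ℕ} {a : Fin n} {l : List ℕ} (h : R.StartsAt lo θ t a l)
    (hex : ¬ ∃ w : Fin n, Recordable n R.rows lo θ (recsAt n R.rows lo θ t) w) :
    R.StartsAt lo θ (t + 1) a (l ++ [n]) :=
  h.append (R.recs_succ_of_not hex)

theorem StartsAt.getD {lo θ t : ℕ} {a : Fin n} {l : List ℕ} (h : R.StartsAt lo θ t a l) (i : ℕ) :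
    ((recsAt n R.rows lo θ t).getD i (n, false, [])).1 = ((a : ℕ) :: l).getD i n := by
  rw [← h.1]
  simp only [List.getD_eq_getElem?_getD, List.getElem?_map]
  cases (recsAt n R.rows lo θ t)[i]? <;> rfl

theorem StartsAt.adj_iff {lo θ t : ℕ} {a : Fin n} {l : List ℕ} (h : R.StartsAt lo θ t a l)
    {H : SimpleGraph (Fin n)} (hH : R.flip (decide (θ ≤ key n R.rows a)) = H)
    {w v : Fin n} (hv : (v : ℕ) ∈ (a : ℕ) :: l) :
    ((w : ℕ) ≠ v ∧ ((v : ℕ) ∈ nbsOf R.rows (recsAt n R.rows lo θ t) w ↔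
      decide (θ ≤ key n R.rows a) = false)) ↔ H.Adj w v := by
  subst hH
  refine R.flip_adj ?_
  rw [nbsOf, List.mem_filter, h.1, decide_eq_true_eq, R.mem_rows]
  exact and_iff_right hv

/-- The vertices on the other side than `a`. -/
def opposite (R : AdjacencyRows G) (θ : ℕ) (a : Fin n) : Finset (Fin n) :=
  Finset.univ.filter fun v => decide (θ ≤ key n R.rows v) ≠ decide (θ ≤ key n R.rows a)

theorem mem_opposite {θ : ℕ} {a v : Fin n} : v ∈ R.opposite θ a ↔
    decide (θ ≤ key n R.rows v) ≠ decide (θ ≤ key n R.rows a) := by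
  simp only [opposite, Finset.mem_filter, Finset.mem_univ, true_and]

/-- The recorded vertices contain an obstruction if the first of them has a violation. -/
theorem exists_obstruction_recsAt {θ : ℕ} {a b : Fin n} {H : SimpleGraph (Fin n)}
    [DecidableRel H.Adj] (hH : R.flip (decide (θ ≤ key n R.rows a)) = H) (hab : H.Adj a b)
    (hb : b ∉ R.opposite θ a) (hS : ∀ v ∉ R.opposite θ a, H.degree v ≤ (R.opposite θ a).card)
    (hd : ∀ v ∉ R.opposite θ a, ∀ u ∈ R.opposite θ a, H.degree v ≤ H.degree u) :
    ∃ l : List (Fin n), (∀ v ∈ l, (v : ℕ) ∈ (recsAt n R.rows (a + 1) θ 7).map Prod.fst) ∧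
      Obstruction H l := by
  have ha : a ∉ R.opposite θ a := by simp [mem_opposite]
  have h0 := R.startsAt_one (θ := θ) a
  set lo := (a : ℕ) + 1
  have iff1 : ∀ w : Fin n, Recordable n R.rows lo θ (recsAt n R.rows lo θ 1) w ↔
      w ∉ R.opposite θ a ∧ H.Adj w a := by
    intro w
    unfold Recordable FindPred
    simp only [length_recsAt, h0.getD, h0.2, List.getD_cons_zero]
    rw [h0.adj_iff hH (by simp), mem_opposite, not_not]
  -- The pass may record another vertex than the given one. From here on `b` is the recorded vertex,
  -- which has the same properties.
  obtain ⟨b, hb', (h1 : R.StartsAt lo θ 2 a [(b : ℕ)])⟩ := h0.succ ⟨b, (iff1 b).2 ⟨hb, hab.symm⟩⟩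
  obtain ⟨hb, hab⟩ := (iff1 b).1 hb'
  have iff2 : ∀ w : Fin n, Recordable n R.rows lo θ (recsAt n R.rows lo θ 2) w ↔
      w ∈ R.opposite θ a ∧ ¬ H.Adj w a ∧ ¬ H.Adj w b := by
    intro w
    unfold Recordable FindPred
    simp only [length_recsAt, h1.getD, h1.2, List.getD_cons_zero, List.getD_cons_succ]
    rw [h1.adj_iff hH (by simp), h1.adj_iff hH (by simp), mem_opposite]
  obtain ⟨x, y, hx, hxa, hy, hyb, hxy, z, hz⟩ : ∃ x y : Fin n, x ∈ R.opposite θ a ∧ ¬ H.Adj x a ∧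
      y ∈ R.opposite θ a ∧ ¬ H.Adj y b ∧ (x = y ∨ H.Adj x b ∧ H.Adj y a) ∧
      ∃ z, R.StartsAt lo θ 5 a [(b : ℕ), z, (x : ℕ), (y : ℕ)] := by
    -- Either `z` is a common non-neighbour of `a` and `b` on the other side, or `z = n` and every
    -- vertex there sees `a` or `b`. The first case forces `x = y`; in the second, `x` must see `b`
    -- and `y` must see `a`.
    obtain ⟨z, h2, hz⟩ : ∃ z, R.StartsAt lo θ 3 a [(b : ℕ), z] ∧
        ((∃ w : Fin n, w ∈ R.opposite θ a ∧ ¬ H.Adj w a ∧ ¬ H.Adj w b ∧ (w : ℕ) = z) ∨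
          z = n ∧ ∀ w ∈ R.opposite θ a, H.Adj w a ∨ H.Adj w b) := by
      by_cases hex : ∃ w : Fin n, Recordable n R.rows lo θ (recsAt n R.rows lo θ 2) w
      · obtain ⟨z, hz, h2⟩ := h1.succ hex
        obtain ⟨hz1, hz2, hz3⟩ := (iff2 z).1 hz
        exact ⟨z, h2, .inl ⟨z, hz1, hz2, hz3, rfl⟩⟩
      · refine ⟨n, h1.succ_of_not hex, .inr ⟨rfl, fun w hw => ?_⟩⟩
        by_contra! hc
        exact hex ⟨w, (iff2 w).2 ⟨hw, hc⟩⟩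
    have iff3 : ∀ w : Fin n, Recordable n R.rows lo θ (recsAt n R.rows lo θ 3) w ↔
        w ∈ R.opposite θ a ∧ ¬ H.Adj w a ∧ (z < n → (w : ℕ) = z) := by
      intro w
      unfold Recordable FindPred
      simp only [length_recsAt, h2.getD, h2.2, List.getD_cons_zero, List.getD_cons_succ]
      rw [h2.adj_iff hH (by simp), mem_opposite]
    have hex3 : ∃ w : Fin n, Recordable n R.rows lo θ (recsAt n R.rows lo θ 3) w := by
      simp only [iff3]
      obtain ⟨w, hw1, hw2, hw3, hw4⟩ | ⟨rfl, -⟩ := hz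
      · exact ⟨w, hw1, hw2, fun _ => hw4⟩
      · obtain ⟨x, hx, hxa⟩ := exists_not_adj hab.symm hb (hS a ha)
        exact ⟨x, hx, hxa, fun h => absurd h (lt_irrefl _)⟩
    obtain ⟨x, hx, (h3 : R.StartsAt lo θ 4 a [(b : ℕ), z, (x : ℕ)])⟩ := h2.succ hex3
    obtain ⟨hx, hxa, hxz⟩ := (iff3 x).1 hx
    have iff4 : ∀ w : Fin n, Recordable n R.rows lo θ (recsAt n R.rows lo θ 4) w ↔
        w ∈ R.opposite θ a ∧ ¬ H.Adj w b ∧ (z < n → (w : ℕ) = z) := by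
      intro w
      unfold Recordable FindPred
      simp only [length_recsAt, h3.getD, h3.2, List.getD_cons_zero, List.getD_cons_succ]
      rw [h3.adj_iff hH (by simp), mem_opposite]
    have hex4 : ∃ w : Fin n, Recordable n R.rows lo θ (recsAt n R.rows lo θ 4) w := by
      simp only [iff4]
      obtain ⟨w, hw1, hw2, hw3, hw4⟩ | ⟨rfl, -⟩ := hz
      · exact ⟨w, hw1, hw3, fun _ => hw4⟩
      · obtain ⟨x, hx, hxa⟩ := exists_not_adj hab ha (hS b hb)
        exact ⟨x, hx, hxa, fun h => absurd h (lt_irrefl _)⟩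
    obtain ⟨y, hy, h4⟩ := h3.succ hex4
    obtain ⟨hy, hyb, hyz⟩ := (iff4 y).1 hy
    refine ⟨x, y, hx, hxa, hy, hyb, ?_, z, h4⟩
    obtain ⟨w, -, -, -, hw⟩ | ⟨-, hz⟩ := hz
    · have := w.2
      exact .inl (Fin.ext ((hxz (by omega)).trans (hyz (by omega)).symm))
    · exact .inr ⟨(hz x hx).resolve_left hxa, (hz y hy).resolve_right hyb⟩
  have hxa' : x ≠ a := fun h => ha (h ▸ hx)
  have hyb' : y ≠ b := fun h => hb (h ▸ hy)
  have iff5 : ∀ w : Fin n, Recordable n R.rows lo θ (recsAt n R.rows lo θ 5) w ↔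
      H.Adj w x ∧ w ≠ b ∧ ¬ H.Adj w b := by
    intro w
    unfold Recordable FindPred
    simp only [length_recsAt, hz.getD, hz.2, List.getD_cons_zero, List.getD_cons_succ]
    rw [hz.adj_iff hH (by simp), hz.adj_iff hH (by simp), ne_eq, ne_eq, Fin.ext_iff]
  obtain ⟨e, he, (h5 : R.StartsAt lo θ 6 a [(b : ℕ), z, (x : ℕ), (y : ℕ), (e : ℕ)])⟩ := hz.succ ((exists_congr iff5).2
    (exists_adj_not_adj hab.symm hxa hxa' (hd b hb x hx)))
  obtain ⟨hex, heb, heb'⟩ := (iff5 e).1 he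
  have iff6 : ∀ w : Fin n, Recordable n R.rows lo θ (recsAt n R.rows lo θ 6) w ↔
      H.Adj w y ∧ w ≠ a ∧ ¬ H.Adj w a := by
    intro w
    unfold Recordable FindPred
    simp only [length_recsAt, h5.getD, h5.2, List.getD_cons_zero, List.getD_cons_succ]
    rw [h5.adj_iff hH (by simp), h5.adj_iff hH (by simp), ne_eq, ne_eq, Fin.ext_iff]
  obtain ⟨f, hf, (h6 : R.StartsAt lo θ 7 a
      [(b : ℕ), z, (x : ℕ), (y : ℕ), (e : ℕ), (f : ℕ)])⟩ := h5.succ ((exists_congr iff6).2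
    (exists_adj_not_adj hab hyb hyb' (hd a ha y hy)))
  obtain ⟨hfy, hfa, hfa'⟩ := (iff6 f).1 hf
  obtain ⟨l, hl, ho⟩ := exists_obstruction hab.symm hxa hyb hxa' hyb' hxy hex heb heb' hfy hfa hfa'
  refine ⟨l, fun v hv => ?_, ho⟩
  rw [h6.1]
  obtain rfl | rfl | rfl | rfl | rfl | rfl := hl v hv <;> simp

variable (R)

/-- The threshold is as `exists_threshold` provides it. -/
def IsThreshold (T : ℕ) : Prop :=
  ∀ v < n, (T ≤ key n R.rows v → countKey n R.rows T n ≤ (R.rows v).length + 1) ∧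
    (¬ T ≤ key n R.rows v → (R.rows v).length + 1 ≤ countKey n R.rows T n)

theorem countKey_eq (T : ℕ) : countKey n R.rows T n =
    (Finset.univ.filter fun v : Fin n => T ≤ key n R.rows v).card := by
  rw [countKey, Finset.card_filter, Finset.card_filter, Finset.sum_range]

/-- The threshold condition is self-dual. If `a` is in `K`, degrees in the complement are `n - 1`
minus degrees in `G`, hence at most `n - |K| = |I|` on `K`, and the comparison of degrees between
the two sides is reversed as required. -/
theorem exists_obstruction_of_violation {T : ℕ} (hT : R.IsThreshold T) {a b : Fin n}
    (hab : (R.flip (decide (T ≤ key n R.rows a))).Adj a b)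
    (hb : T ≤ key n R.rows b ↔ T ≤ key n R.rows a) :
    ∃ l : List (Fin n), pick n (recsAt n R.rows (a + 1) T 7) = l.map Fin.val ∧
      Obstruction G l := by
  classical
  have hadd := Finset.card_filter_add_card_filter_not
    (s := (Finset.univ : Finset (Fin n))) (fun v => T ≤ key n R.rows v)
  rw [Finset.card_univ, Fintype.card_fin, ← R.countKey_eq] at hadd
  have hl : ∀ v : Fin n, (R.rows v).length = G.degree v := fun v => R.length_rows v
  have hb' : b ∉ R.opposite T a := by simp [mem_opposite, hb]
  by_cases ha : T ≤ key n R.rows a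
  · have hS : (R.opposite T a).card + countKey n R.rows T n = n := by
      refine Eq.trans ?_ hadd
      rw [Nat.add_comm]
      congr 2
      ext v
      simp [mem_opposite, ha]
    have hmem : ∀ v, v ∈ R.opposite T a ↔ ¬ T ≤ key n R.rows v := fun v => by
      simp [mem_opposite, ha]
    have hf : R.flip (decide (T ≤ key n R.rows a)) = Gᶜ := by simp [flip, ha]
    rw [hf] at hab
    have hdeg : ∀ v, Gᶜ.degree v + G.degree v + 1 = n := by
      intro v
      have h1 := G.degree_compl v
      have h2 := G.degree_lt_card_verts v
      rw [Fintype.card_fin] at h1 h2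
      omega
    obtain ⟨l, hlm, ho⟩ := exists_obstruction_recsAt hf hab hb'
      (fun v hv => by
        have h1 := (hT v v.2).1 (not_not.1 (mt (hmem v).2 hv))
        have h2 := hdeg v
        rw [hl] at h1
        omega)
      (fun v hv u hu => by
        have h1 := (hT v v.2).1 (not_not.1 (mt (hmem v).2 hv))
        have h2 := hdeg v
        have h3 := (hT u u.2).2 ((hmem u).1 hu)
        have h4 := hdeg u
        rw [hl] at h1 h3
        omega)
    obtain ⟨l', hl', ho'⟩ := exists_obstruction_of_compl ho
    exact R.pick_spec (fun v hv => hlm v (hl' v hv)) ho'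
  · have hS : (R.opposite T a).card = countKey n R.rows T n := by
      rw [R.countKey_eq]
      congr 1
      ext v
      simp [mem_opposite, ha]
    have hmem : ∀ v, v ∈ R.opposite T a ↔ T ≤ key n R.rows v := fun v => by
      simp [mem_opposite, ha]
    have hf : R.flip (decide (T ≤ key n R.rows a)) = G := by simp [flip, ha]
    rw [hf] at hab
    obtain ⟨l, hlm, ho⟩ := exists_obstruction_recsAt hf hab hb'
      (fun v hv => by
        have h1 := (hT v v.2).2 (mt (hmem v).2 hv)
        rw [hl] at h1
        omega)
      (fun v hv u hu => by
        have h1 := (hT v v.2).2 (mt (hmem v).2 hv)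
        have h3 := (hT u u.2).1 ((hmem u).1 hu)
        rw [hl] at h1 h3
        omega)
    exact R.pick_spec hlm ho

/-- What the searches find. -/
theorem partition_or_obstruction {T T₂ : ℕ} (hT : R.IsThreshold T) (hle : T₂ ≤ n + 1)
    (hT₂ : ∀ i, (i ≤ n ∧ countPrefix n R.rows T i n * (countPrefix n R.rows T i n - 1) +
        countPairs R.rows (fun u => ¬ T ≤ key n R.rows u) i n =
      countPairs R.rows (fun u => T ≤ key n R.rows u) i n) ↔ i < T₂) :
    (T₂ = n + 1 ∧ IsSplitPartition G {v | T ≤ key n R.rows v} {v | ¬ T ≤ key n R.rows v}) ∨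
      T₂ ≤ n ∧ ∃ l : List (Fin n), pick n (recsAt n R.rows T₂ T 7) = l.map Fin.val ∧
        Obstruction G l := by
  classical
  simp only [R.count_eq_iff] at hT₂
  obtain rfl | hlt : T₂ = n + 1 ∨ T₂ ≤ n := by omega
  · left
    have h := ((hT₂ n).2 (Nat.lt_succ_self n)).2
    refine ⟨rfl, ?_, ?_, fun u hu v hv hne => (h u v u.2 v.2).1 hu hv hne,
      fun u hu v hv _ => (h u v u.2 v.2).2 hu hv⟩
    · rw [Set.disjoint_left]
      exact fun v hv hv' => hv' hv
    · exact Set.eq_univ_of_forall fun v => em _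
  · refine .inr ⟨hlt, ?_⟩
    have hpos : 0 < T₂ := (hT₂ 0).1 ⟨Nat.zero_le _, by simp⟩
    have h1 := ((hT₂ (T₂ - 1)).2 (by omega)).2
    have h2 := mt (hT₂ T₂).1 (lt_irrefl _)
    let a : Fin n := ⟨T₂ - 1, by omega⟩
    have haT : (a : ℕ) + 1 = T₂ := Nat.sub_add_cancel hpos
    rw [← haT]
    suffices h : ∃ b, (R.flip (decide (T ≤ key n R.rows a))).Adj a b ∧
        (T ≤ key n R.rows b ↔ T ≤ key n R.rows a) by
      obtain ⟨b, hab, hb⟩ := h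
      exact R.exists_obstruction_of_violation hT hab hb
    -- The prefix without `a` has no violation. If `a` were in none either, the prefix ending with
    -- `a` would be free of violations, against the choice of `T₂`.
    by_contra! hno
    refine h2 ⟨hlt, ?_⟩
    have hside : ∀ b : Fin n, (T ≤ key n R.rows a → T ≤ key n R.rows b → a ≠ b → G.Adj a b) ∧
        (¬ T ≤ key n R.rows a → ¬ T ≤ key n R.rows b → ¬ G.Adj a b) := by
      intro b
      refine ⟨fun ha hb hne => ?_, fun ha hb hadj => ?_⟩
      · by_contra hadj
        have := hno b (by simp [flip, ha, hne, hadj])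
        omega
      · have := hno b (by simp [flip, ha, hadj])
        tauto
    intro u v hu hv
    by_cases hua : u = a
    · exact hua ▸ hside v
    by_cases hva : v = a
    · subst hva
      exact ⟨fun h h' hne => ((hside u).1 h' h hne.symm).symm,
        fun h h' hadj => (hside u).2 h' h hadj.symm⟩
    · have hu' : (u : ℕ) ≠ a := fun h => hua (Fin.ext h)
      have hv' : (v : ℕ) ≠ a := fun h => hva (Fin.ext h)
      exact h1 u v (by omega) (by omega)

end AdjacencyRows

/-! ### Start and end of the program -/

namespace Setting

variable {k : ℕ} {D : ℕ → ℕ} {n m : ℕ} {row : ℕ → List ℕ} {B X : ℕ}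

theorem run_ann (S : Setting k D n m row B X) {α : AConf (St k)} (hα : α.Fine X) {b : Bool}
    {s : St k} (hs : α.s.step = .ann b s) (hok : s.Ok n m) :
    Run k D B X α { α with s := s, ans := α.ans.or (some b) } := by
  refine .single ⟨?_, S.enc_lt s hok, hα.tag_lt, hα.out_lt, hα.length_lt⟩
  rw [AConf.next, hs]

theorem fine_put {α : AConf (St k)} (hα : α.Fine X) {x : ℕ} {s : St k} (hx : x < X)
    (hl : α.out.length + 1 < X) : AConf.Fine X { α with s := s, out := α.out ++ [x] } where
  tag_lt := hα.tag_lt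
  out_lt y hy := by
    obtain hy | hy := List.mem_append.1 hy
    · exact hα.out_lt y hy
    · rwa [List.mem_singleton.1 hy]
  length_lt := by simpa using hl

theorem run_put (S : Setting k D n m row B X) {α : AConf (St k)} (hα : α.Fine X) {x : ℕ}
    {s : St k} (hs : α.s.step = .put x s) (hok : s.Ok n m) (hx : x < X)
    (hl : α.out.length + 1 < X) :
    Run k D B X α { α with s := s, out := α.out ++ [x] } := by
  have hf := fine_put (s := s) hα hx hl
  refine .single ⟨?_, S.enc_lt s hok, hf.tag_lt, hf.out_lt, hf.length_lt⟩
  rw [AConf.next, hs]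

/-- The numbers of vertices and edges are read. -/
theorem run_start (S : Setting k D n m row B X) :
    ∃ α : AConf (St k), Run k D B X ⟨default, fun _ => 0, [], none, 0⟩ α ∧ α.Fine X ∧
      α.out = [] ∧ α.ans = none ∧
      α.s = ⟨2, n, m, 0, 0, 0, [], .fresh 0 0 (n * n + 1) 0 []⟩ ∧ α.cost ≤ 2 := by
  have hX := S.lt_X
  have hα : AConf.Fine X (⟨default, fun _ => 0, [], none, 0⟩ : AConf (St k)) :=
    ⟨fun _ => by simp only; omega, by simp, by simp only [List.length_nil]; omega⟩
  have hok : (Work.fresh 0 0 0 0 [] : Work k).Ok n 0 0 :=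
    Work.ok_fresh (by omega) (by omega) (by omega) (by omega) (by simp) (by simp)
  have hok' : (Work.fresh 0 0 (n * n + 1) 0 [] : Work k).Ok n 0 0 :=
    Work.ok_fresh (by omega) (by omega) (by omega) (by omega) (by simp) (by simp)
  obtain ⟨β, hr, hβ, hβs, -, hout, hans, hc⟩ := S.run_get hα (b := false) (x := 0)
    (f := fun x => ⟨1, x, 0, 0, 0, 0, [], .fresh 0 0 0 0 []⟩) rfl
    { mode_le := by simp
      n_le := S.zero.le
      m_le := Nat.zero_le _
      v_le := Nat.zero_le _
      e_le := Nat.zero_le _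
      pend_le := Nat.zero_le _
      outl_length := by simp
      outl_le := by simp
      work := hok.mono (Nat.zero_le _) (Nat.zero_le _) } (Nat.zero_le _)
  simp only [S.zero] at hβs
  obtain ⟨γ, hr', hγ, hγs, -, hout', hans', hc'⟩ := S.run_get hβ (b := false) (x := 1)
    (f := fun x => ⟨2, n, x, 0, 0, 0, [], .fresh 0 0 (n * n + 1) 0 []⟩) (by rw [hβs]; rfl)
    (by simp only [S.one]; exact ok_state hok' (by omega) (by simp) (by simp)) (by omega)
  simp only [S.one] at hγs
  refine ⟨γ, hr.trans hr', hγ, hout'.trans hout, hans'.trans hans, hγs, ?_⟩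
  rw [hc', hc]
  simp only
  split <;> split <;> omega

/-- The vertices with the property `p` are output. -/
theorem run_scan (S : Setting k D n m row B X) {w : Work k} (hw : w.Ok n n (2 * m)) {q q' : ℕ}
    (hq : q ≤ 12) (hq' : q' ≤ 12) {p : ℕ → Prop} [DecidablePred p] {f : ℕ → ℕ → St k}
    (hget : ∀ v < n, (⟨q, n, m, v, rowStart row v, 0, [], w⟩ : St k).step =
      .get false (v + 3) (f v))
    (hf : ∀ v < n, f v (D (v + 3)) =
      ⟨if p v then q' else q, n, m, v + 1, rowStart row (v + 1), 0, [], w⟩)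
    (hput : ∀ v < n, (⟨q', n, m, v + 1, rowStart row (v + 1), 0, [], w⟩ : St k).step =
      .put v ⟨q, n, m, v + 1, rowStart row (v + 1), 0, [], w⟩)
    {α : AConf (St k)} (hα : α.Fine X) (hs : α.s = ⟨q, n, m, 0, 0, 0, [], w⟩)
    (hX : α.out.length + ((List.range n).filter p).length < X) {v : ℕ} (hv : v ≤ n) :
    ∃ α' : AConf (St k), Run k D B X α α' ∧ α'.Fine X ∧
      α'.s = ⟨q, n, m, v, rowStart row v, 0, [], w⟩ ∧
      α'.out = α.out ++ (List.range v).filter p ∧ α'.ans = α.ans ∧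
      ∃ c, α'.cost ≤ α.cost + c ∧ Streamed 2 B (α'.tag false) c v := by
  induction v with
  | zero => exact ⟨α, .refl, hα, by simpa [rowStart] using hs, by simp, rfl, 0, le_rfl,
      .inl ⟨rfl, rfl⟩⟩
  | succ v ih =>
    obtain ⟨β, hr, hβ, hβs, hout, hans, c, hc, hst⟩ := ih (by omega)
    have hok : ∀ {q}, q ≤ 12 →
        (⟨q, n, m, v + 1, rowStart row (v + 1), 0, [], w⟩ : St k).Ok n m := fun hq =>
      { mode_le := hq
        n_le := le_rfl
        m_le := le_rfl
        v_le := hv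
        e_le := S.rowStart_le hv
        pend_le := Nat.zero_le _
        outl_length := by simp
        outl_le := by simp
        work := hw }
    obtain ⟨γ, hr', hγ, hγs, htag, hout', hans', hc'⟩ := S.run_get hβ
      (by rw [hβs]; exact hget v hv) (by rw [hf v hv]; exact hok (by split <;> assumption))
      (by omega)
    rw [hf v hv] at hγs
    have hcost : γ.cost ≤ α.cost + (c + if β.tag false = (v + 1 + 2) / B + 1 then 0 else 1) := by
      rw [hc']
      have : v + 3 = v + 1 + 2 := rfl
      rw [this]
      omega
    have hstr : Streamed 2 B (γ.tag false)
        (c + if β.tag false = (v + 1 + 2) / B + 1 then 0 else 1) (v + 1) := by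
      rw [htag, Function.update_self]
      exact hst.succ
    have hrange : (List.range (v + 1)).filter p =
        (List.range v).filter p ++ if p v then [v] else [] := by
      rw [List.range_succ, List.filter_append]
      by_cases hp : p v <;> simp [hp]
    by_cases hp : p v
    · rw [if_pos hp] at hγs hrange
      have hlen : γ.out.length + 1 < X := by
        have hle : ((List.range (v + 1)).filter p).length ≤ ((List.range n).filter p).length :=
          (((List.range_sublist.2 (show v + 1 ≤ n from hv))).filter _).length_le
        rw [hrange, List.length_append, List.length_singleton] at hle
        rw [hout', hout, List.length_append]
        omega
      have hvX : v < X := by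
        have := S.lt_X
        omega
      have hstep : γ.s.step = .put v ⟨q, n, m, v + 1, rowStart row (v + 1), 0, [], w⟩ := by
        rw [hγs]
        exact hput v hv
      refine ⟨_, (hr.trans hr').trans (S.run_put hγ hstep (hok hq) hvX hlen),
        fine_put hγ hvX hlen, rfl, ?_, hans'.trans hans, _, hcost, hstr⟩
      simp only [hout', hout, hrange, List.append_assoc]
    · rw [if_neg hp] at hγs hrange
      exact ⟨γ, hr.trans hr', hγ, hγs, by rw [hout', hout, hrange, List.append_nil],
        hans'.trans hans, _, hcost, hstr⟩

/-- The partition is announced and output. -/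
theorem run_partition (S : Setting k D n m row B X) {w : Work k} (hw : w.Ok n n (2 * m))
    {α : AConf (St k)} (hα : α.Fine X) (hs : α.s = ⟨4, n, m, 0, 0, 0, [], w⟩)
    (hout : α.out = []) (hans : α.ans = none) :
    ∃ β γ : AConf (St k), Run k D B X α β ∧ β.out = [] ∧ β.ans = some true ∧ β.cost = α.cost ∧
      Run k D B X β γ ∧ γ.s.step = .halt ∧
      γ.out = w.kc :: ((List.range n).filter (fun v => w.θ ≤ key n row v) ++
        (List.range n).filter (fun v => ¬ w.θ ≤ key n row v)) ∧
      γ.cost ≤ β.cost + 2 * ((n + 2) / B + 1) := by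
  have hX := S.lt_X
  have hok : ∀ {q}, q ≤ 12 → (⟨q, n, m, 0, 0, 0, [], w⟩ : St k).Ok n m := fun hq =>
    { mode_le := hq
      n_le := le_rfl
      m_le := le_rfl
      v_le := Nat.zero_le _
      e_le := Nat.zero_le _
      pend_le := Nat.zero_le _
      outl_length := by simp
      outl_le := by simp
      work := hw }
  have h4 := S.run_ann hα (s := ⟨5, n, m, 0, 0, 0, [], w⟩) (by rw [hs]; rfl) (hok (by omega))
  set β : AConf (St k) :=
    { α with s := ⟨5, n, m, 0, 0, 0, [], w⟩, ans := α.ans.or (some true) } with hβ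
  have hβf : β.Fine X := ⟨hα.1, hα.2, hα.3⟩
  have hkc : w.kc < X := by
    have := hw.kc
    omega
  have hβo : β.out = [] := hout
  have hl : β.out.length + 1 < X := by
    rw [hβo, List.length_nil]
    omega
  have h5 := S.run_put hβf (x := w.kc) (s := ⟨6, n, m, 0, 0, 0, [], w⟩) rfl (hok (by omega)) hkc hl
  have hγf := fine_put (s := ⟨6, n, m, 0, 0, 0, [], w⟩) hβf hkc hl
  have hlen : ∀ p : ℕ → Prop, ∀ [DecidablePred p], ((List.range n).filter p).length +
      ((List.range n).filter fun v => ¬ p v).length = n := by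
    intro p _
    have := List.length_eq_length_filter_add (l := List.range n) (fun v => decide (p v))
    rw [List.length_range] at this
    simp only [decide_not]
    exact this.symm
  have hlen' := hlen fun v => w.θ ≤ key n row v
  have hend : ∀ v < n, (if v + 1 = n then 2 * m else D (v + 3)) = rowStart row (v + 1) :=
    fun v hv => S.rowEnd_eq hv
  have hrow : ∀ v, rowStart row (v + 1) - rowStart row v = (row v).length := fun v => by
    rw [rowStart_succ, Nat.add_sub_cancel_left]
  obtain ⟨δ, h6, hδf, hδs, hδo, hδa, c, hc, hst⟩ := S.run_scan hw (q := 6) (q' := 7) (by omega)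
    (by omega) (p := fun v => w.θ ≤ key n row v)
    (f := fun v x => ⟨if w.θ ≤ ((if v + 1 = n then 2 * m else x) - rowStart row v) * n + v
        then 7 else 6, n, m, v + 1, if v + 1 = n then 2 * m else x, 0, [], w⟩)
    (fun v hv => by simp only [St.step]; rw [if_pos hv])
    (fun v hv => by simp only [hend v hv, hrow]; rfl)
    (fun v hv => by simp only [St.step, Nat.add_sub_cancel])
    hγf rfl (by
      simp only [hβo, List.nil_append, List.length_singleton]
      omega) le_rfl
  have h7 := S.run_tau hδf (s := ⟨8, n, m, 0, 0, 0, [], w⟩)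
    (by rw [hδs]; simp [St.step]) (hok (by omega))
  obtain ⟨ε, h8, hεf, hεs, hεo, hεa, c', hc', hst'⟩ := S.run_scan hw (q := 8) (q' := 9) (by omega)
    (by omega) (p := fun v => ¬ w.θ ≤ key n row v)
    (f := fun v x => ⟨if w.θ ≤ ((if v + 1 = n then 2 * m else x) - rowStart row v) * n + v
        then 8 else 9, n, m, v + 1, if v + 1 = n then 2 * m else x, 0, [], w⟩)
    (fun v hv => by simp only [St.step]; rw [if_pos hv])
    (fun v hv => by simp only [hend v hv, hrow, ite_not]; rfl)
    (fun v hv => by simp only [St.step, Nat.add_sub_cancel])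
    (α := { δ with s := ⟨8, n, m, 0, 0, 0, [], w⟩ }) ⟨hδf.1, hδf.2, hδf.3⟩ rfl (by
      simp only [hδo, hβo, List.nil_append, List.length_append, List.length_singleton]
      omega) le_rfl
  refine ⟨β, ε, h4, hβo, by simp [hβ, hans], rfl, ((h5.trans h6).trans h7).trans h8, ?_, ?_, ?_⟩
  · rw [hεs]
    simp [St.step]
  · simp only [hεo, hδo, hβo, List.nil_append, List.singleton_append]
    rfl
  · have := hst.le
    have := hst'.le
    simp only at hc hc'
    omega

/-- The list is output. -/
theorem run_outl (S : Setting k D n m row B X) {w : Work k} (hw : w.Ok n n (2 * m)) (l : List ℕ) :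
    ∀ α : AConf (St k), α.Fine X → α.s = ⟨11, n, m, 0, 0, 0, l, w⟩ → l.length ≤ 7 →
      (∀ x ∈ l, x ≤ n) → α.out.length + l.length < X →
      ∃ β : AConf (St k), Run k D B X α β ∧ β.s.step = .halt ∧ β.out = α.out ++ l ∧
        β.ans = α.ans ∧ β.cost = α.cost := by
  induction l with
  | nil => exact fun α hα hs _ _ _ => ⟨α, .refl, by rw [hs]; rfl, by simp, rfl, rfl⟩
  | cons x l ih =>
    intro α hα hs hl hn hX
    have hx : x < X := by
      have := hn x (by simp)
      have := S.lt_X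
      omega
    simp only [List.length_cons] at hl hX
    have hok : (⟨11, n, m, 0, 0, 0, l, w⟩ : St k).Ok n m :=
      { mode_le := by simp
        n_le := le_rfl
        m_le := le_rfl
        v_le := Nat.zero_le _
        e_le := Nat.zero_le _
        pend_le := Nat.zero_le _
        outl_length := by simp only; omega
        outl_le := fun y hy => hn y (List.mem_cons_of_mem _ hy)
        work := hw }
    have h1 := S.run_put hα (by rw [hs]; rfl) hok hx (by omega)
    obtain ⟨β, h2, hβs, hβo, hβa, hβc⟩ := ih { α with s := _, out := _ } (fine_put hα hx (by omega))
      rfl (by omega) (fun y hy => hn y (List.mem_cons_of_mem _ hy))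
      (by simp only [List.length_append, List.length_singleton]; omega)
    exact ⟨β, h1.trans h2, hβs, by simp [hβo], hβa, hβc⟩

/-- The obstruction is announced and output. -/
theorem run_obstruction (S : Setting k D n m row B X) {w : Work k} (hw : w.Ok n 0 0) {l : List ℕ}
    (hl : l.length ≤ 7) (hl' : l.length < X) (hn : ∀ x ∈ l, x ≤ n) {α : AConf (St k)}
    (hα : α.Fine X) (hs : α.s = ⟨10, n, m, 0, 0, 0, l, w⟩) (hout : α.out = [])
    (hans : α.ans = none) :
    ∃ β : AConf (St k), Run k D B X α β ∧ β.s.step = .halt ∧ β.out = l ∧ β.ans = some false ∧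
      β.cost = α.cost := by
  have h1 := S.run_ann hα (s := ⟨11, n, m, 0, 0, 0, l, w⟩) (by rw [hs]; rfl)
    (ok_state hw (by omega) hl hn)
  obtain ⟨β, h2, hβs, hβo, hβa, hβc⟩ := S.run_outl (hw.mono (Nat.zero_le _) (Nat.zero_le _)) l
    _ (⟨hα.1, hα.2, hα.3⟩ : AConf.Fine X
      { α with s := ⟨11, n, m, 0, 0, 0, l, w⟩, ans := α.ans.or (some false) }) rfl hl hn
    (by simpa [hout] using hl')
  exact ⟨β, h1.trans h2, hβs, by simp [hβo, hout], by simp [hβa, hans], hβc⟩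

end Setting

/-! ### The number of passes -/

section Costs

open Setting

theorem le_scanIO (B N : ℕ) : 1 ≤ scanIO B N ∧ ((N / B : ℕ) : ℝ) ≤ scanIO B N :=
  ⟨le_max_left _ _, (Nat.cast_div_le).trans ((Nat.le_ceil _).trans (le_max_right _ _))⟩

theorem add_div_le {B : ℕ} (hB : 1 ≤ B) (x c : ℕ) : (x + c) / B ≤ x / B + c := by
  rw [← Nat.add_mul_div_left x c hB]
  exact Nat.div_le_div_right (Nat.add_le_add_left (Nat.le_mul_of_pos_left c hB) x)

theorem passCost_le {n m B : ℕ} (hB : 1 ≤ B) :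
    (passCost n m B : ℝ) ≤ 9 * scanIO B (n + m) := by
  obtain ⟨h1, h2⟩ := le_scanIO B (n + m)
  have h3 := add_div_le hB n 2
  have h4 := add_div_le hB (2 * (n + m)) 1
  have h5 : n / B ≤ (n + m) / B := Nat.div_le_div_right (by omega)
  have h6 : (2 * m + (n + 1)) / B ≤ (2 * (n + m) + 1) / B := Nat.div_le_div_right (by omega)
  have h7 : 2 * (n + m) / B ≤ 2 * ((n + m) / B) + 1 := by
    rw [← Nat.lt_succ_iff, Nat.div_lt_iff_lt_mul hB]
    have := Nat.lt_div_mul_add (a := n + m) hB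
    nlinarith
  have h8 : passCost n m B ≤ 3 * ((n + m) / B) + 6 := by
    rw [passCost]
    omega
  have h9 : (passCost n m B : ℝ) ≤ 3 * (((n + m) / B : ℕ) : ℝ) + 6 := by exact_mod_cast h8
  linarith

/-- For `N ≥ M` the quotient `log N / log M` is at least one, and subtracting `log B` from numerator
and denominator can only increase it. For `N ≤ M` the maximum with `1` suffices. -/
theorem log_div_log_le {M B N : ℕ} (hB : 1 ≤ B) (hM : 2 * B ≤ M) :
    Real.log N ≤ max 1 (Real.logb ((M : ℝ) / B) ((N : ℝ) / B)) * Real.log M := by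
  have hB' : (1 : ℝ) ≤ B := by exact_mod_cast hB
  have hM' : 2 * (B : ℝ) ≤ M := by exact_mod_cast hM
  have hlB := Real.log_nonneg hB'
  have hBM : Real.log B < Real.log M := Real.log_lt_log (by linarith) (by linarith)
  obtain h | h := le_total N M
  · have h1 : Real.log N ≤ Real.log M := by
      obtain rfl | hN := Nat.eq_zero_or_pos N
      · simp only [Nat.cast_zero, Real.log_zero]
        linarith
      · exact Real.log_le_log (by exact_mod_cast hN) (by exact_mod_cast h)
    nlinarith [le_max_left 1 (Real.logb ((M : ℝ) / B) ((N : ℝ) / B))]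
  · have hN' : (M : ℝ) ≤ N := by exact_mod_cast h
    have hMN : Real.log M ≤ Real.log N := Real.log_le_log (by linarith) hN'
    refine le_trans ?_ (mul_le_mul_of_nonneg_right (le_max_right _ _) (by linarith))
    rw [Real.logb, Real.log_div (by linarith) (by linarith),
      Real.log_div (by linarith) (by linarith), div_mul_eq_mul_div, le_div_iff₀ (by linarith)]
    nlinarith

/-- Since `M ≤ 2 * (M - B)`, the base `M - B + 1` is at least the square root of `M`, so changing to
base `M` costs a factor `2`. The bound `log x ≤ 2 * (2 * log M + log N)` contributes the factor `6`,
and rounding up adds one: `12 + 1 = 13`. -/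
theorem clog_le {M B N x : ℕ} (hB : 1 ≤ B) (hM : 2 * B ≤ M) (hx1 : 1 ≤ x)
    (hx : x ≤ (N + 2) ^ 2) : ((max 1 (Nat.clog (M - B + 1) x) : ℕ) : ℝ) ≤
      13 * max 1 (Real.logb ((M : ℝ) / B) ((N : ℝ) / B)) := by
  have h1 := log_div_log_le (N := N) hB hM
  set ℓ := max 1 (Real.logb ((M : ℝ) / B) ((N : ℝ) / B)) with hℓ
  have hℓ1 : 1 ≤ ℓ := le_max_left _ _
  rw [Nat.cast_max, Nat.cast_one]
  refine max_le (by linarith) ?_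
  have hM2 : (2 : ℝ) ≤ M := by exact_mod_cast (show 2 ≤ M by omega)
  have h2M : Real.log 2 ≤ Real.log M := Real.log_le_log two_pos hM2
  have hl2 : 0 < Real.log 2 := Real.log_pos one_lt_two
  have hN2 : Real.log ((N : ℝ) + 2) ≤ 2 * Real.log M + Real.log N := by
    obtain rfl | hN := Nat.eq_zero_or_pos N
    · simp only [Nat.cast_zero, zero_add, Real.log_zero]
      linarith
    · have hN1 : (1 : ℝ) ≤ N := by exact_mod_cast hN
      have h4 : Real.log (2 * 2) = Real.log 2 + Real.log 2 := Real.log_mul (by norm_num) (by norm_num)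
      have h5 : Real.log ((N : ℝ) + 2) ≤ Real.log (2 * 2 * N) :=
        Real.log_le_log (by linarith) (by linarith)
      rw [Real.log_mul (by norm_num) (by linarith), h4] at h5
      linarith
  have hlx : Real.log x ≤ 2 * (2 * Real.log M + Real.log N) := by
    have hx' : (x : ℝ) ≤ ((N : ℝ) + 2) ^ 2 := by exact_mod_cast hx
    have := Real.log_le_log (by exact_mod_cast hx1) hx'
    rw [Real.log_pow, Nat.cast_ofNat] at this
    linarith
  have hkM : M ≤ (M - B + 1) ^ 2 := by
    obtain ⟨k, hk⟩ : ∃ k, k = M - B := ⟨_, rfl⟩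
    rw [← hk]
    nlinarith [show M ≤ 2 * k by omega]
  have hlk : Real.log M ≤ 2 * Real.log ((M - B + 1 : ℕ) : ℝ) := by
    have hk' : (M : ℝ) ≤ ((M - B + 1 : ℕ) : ℝ) ^ 2 := by exact_mod_cast hkM
    have := Real.log_le_log (by linarith) hk'
    rwa [Real.log_pow, Nat.cast_ofNat] at this
  rw [← Real.natCeil_logb_natCast]
  have hlx0 : 0 ≤ Real.log x := Real.log_nonneg (by exact_mod_cast hx1)
  have hlog : Real.logb ((M - B + 1 : ℕ) : ℝ) x ≤ 12 * ℓ := by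
    rw [Real.logb, div_le_iff₀ (by linarith)]
    nlinarith
  have hlog0 : 0 ≤ Real.logb ((M - B + 1 : ℕ) : ℝ) x := by
    rw [Real.logb]
    exact div_nonneg hlx0 (by linarith)
  have := Nat.ceil_lt_add_one hlog0
  linarith

/-- The cost of the searches and of a constant number of further passes. -/
theorem searches_le {M B n m : ℕ} (hB : 1 ≤ B) (hM : 2 * B ≤ M) :
    ((2 + max 1 (Nat.clog (M - B + 1) (n * n + 1)) * passCost n m B +
      max 1 (Nat.clog (M - B + 1) (n + 2)) * passCost n m B + 7 * passCost n m B + 8 : ℕ) : ℝ) ≤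
      400 * sortIO M B (n + m) := by
  have h1 := clog_le (N := n + m) (x := n * n + 1) hB hM (by omega)
    (by nlinarith [Nat.zero_le (n * m), Nat.zero_le (m * m)])
  have h2 := clog_le (N := n + m) (x := n + 2) hB hM (by omega)
    (by nlinarith [Nat.zero_le (n * m), Nat.zero_le (m * m), Nat.zero_le (n * n)])
  have h3 := passCost_le (n := n) (m := m) hB
  have h4 := (le_scanIO B (n + m)).1
  rw [sortIO]
  push_cast at h1 h2 ⊢
  set ℓ := max 1 (Real.logb ((M : ℝ) / B) (((n : ℝ) + m) / B))
  have hℓ : 1 ≤ ℓ := le_max_left _ _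
  have hP : (0 : ℝ) ≤ passCost n m B := Nat.cast_nonneg _
  -- Two searches cost `13 * 9` each, seven passes `7 * 9`, and the constants `10`: together `307`,
  -- below `400`.
  have h5 := mul_le_mul h1 h3 hP (by linarith)
  have h6 := mul_le_mul h2 h3 hP (by linarith)
  nlinarith

end Costs

/-! ### Runs of the program -/

namespace AdjacencyRows

open Setting

variable {n : ℕ} {G : SimpleGraph (Fin n)} (R : AdjacencyRows G)

theorem rows_length_lt {v : ℕ} (hv : v < n) : (R.rows v).length < n := by
  classical
  have h := G.degree_lt_card_verts ⟨v, hv⟩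
  rw [Fintype.card_fin] at h
  exact (R.length_rows ⟨v, hv⟩).trans_lt h

theorem length_filter_range (T : ℕ) :
    countKey n R.rows T n = ((List.range n).filter fun v => T ≤ key n R.rows v).length := rfl

theorem map_filter_finRange (p : ℕ → Bool) :
    ((List.finRange n).filter fun v : Fin n => p v).map Fin.val = (List.range n).filter p := by
  rw [← List.map_coe_finRange_eq_range, List.filter_map]
  rfl

/-- The program finds a split partition or an obstruction. -/
theorem run_program {k m B X : ℕ} (hm : m = G.edgeSet.ncard)
    (S : Setting k (fun i => R.input.getD i 0) n m R.rows B X) :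
    let c := 2 + max 1 (Nat.clog (k + 1) (n * n + 1)) * passCost n m B +
      max 1 (Nat.clog (k + 1) (n + 2)) * passCost n m B
    (∃ (K I : List (Fin n)) (β γ : AConf (St k)),
      K.Nodup ∧ I.Nodup ∧ IsSplitPartition G {v | v ∈ K} {v | v ∈ I} ∧
      Run k (fun i => R.input.getD i 0) B X ⟨default, fun _ => 0, [], none, 0⟩ β ∧
      β.out = [] ∧ β.ans = some true ∧ β.cost ≤ c ∧
      Run k (fun i => R.input.getD i 0) B X β γ ∧ γ.s.step = .halt ∧
      γ.out = K.length :: (K ++ I).map Fin.val ∧ γ.cost ≤ β.cost + 2 * ((n + 2) / B + 1)) ∨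
    ∃ (l : List (Fin n)) (γ : AConf (St k)), Obstruction G l ∧
      Run k (fun i => R.input.getD i 0) B X ⟨default, fun _ => 0, [], none, 0⟩ γ ∧
      γ.s.step = .halt ∧ γ.out = l.map Fin.val ∧ γ.ans = some false ∧
      γ.cost ≤ c + 7 * passCost n m B := by
  subst hm
  classical
  intro c
  obtain ⟨T, hTn, hT, hT'⟩ := exists_threshold (row := R.rows) fun v hv => R.rows_length_lt hv
  obtain ⟨T₂, hT₂n, hT₂⟩ := R.exists_prefix T
  obtain ⟨α, hα, hαf, hαo, hαa, hαs, hαc⟩ := S.run_start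
  obtain ⟨β, hβ, hβf, hβs, hβst, hβc⟩ := S.run_search₁ hTn hT (n * n + 1) 0 α (Nat.zero_le _)
    (by omega) le_rfl hαf hαs
  obtain ⟨γ, hγ, hγf, hγs, hγst, hγc⟩ := S.run_search₂ hTn hT₂n hT₂ (n + 2) 0 β (Nat.zero_le _)
    (by omega) le_rfl hβf hβst
  have hγo : γ.out = [] := hγs.out.trans (hβs.out.trans hαo)
  have hγa : γ.ans = none := hγs.ans.trans (hβs.ans.trans hαa)
  have hr := (hα.trans hβ).trans hγ
  have hc : γ.cost ≤ c := by omega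
  obtain ⟨hT₂e, hsp⟩ | ⟨hT₂l, l, hl, ho⟩ := R.partition_or_obstruction hT' hT₂n hT₂
  · obtain ⟨-, w, hwθ, hwkc, hw, hγst⟩ | ⟨h, -⟩ := hγst
    · obtain ⟨δ, ε, hδ, hδo, hδa, hδc, hε, hεh, hεo, hεc⟩ := S.run_partition hw hγf hγst hγo hγa
      refine .inl ⟨(List.finRange n).filter fun v => T ≤ key n R.rows v,
        (List.finRange n).filter fun v => ¬ T ≤ key n R.rows v, δ, ε,
        (List.nodup_finRange n).filter _, (List.nodup_finRange n).filter _, ?_, hr.trans hδ, hδo,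
        hδa, hδc.trans_le hc, hε, hεh, ?_, hεc⟩
      · simpa using hsp
      · rw [hεo, hwkc, hwθ, R.length_filter_range, List.map_append,
          ← map_filter_finRange, ← map_filter_finRange, List.length_map]
    · omega
  · obtain ⟨h, -⟩ | ⟨-, hγst⟩ := hγst
    · omega
    · have hlen : (pick n (recsAt n R.rows T₂ T 7)).length ≤ 7 := by
        rw [hl, List.length_map]
        exact ho.length_le.trans (by norm_num)
      have hmem : ∀ x ∈ pick n (recsAt n R.rows T₂ T 7), x ≤ n := by
        rw [hl]
        rintro x hx
        obtain ⟨v, -, rfl⟩ := List.mem_map.1 hx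
        exact v.2.le
      obtain ⟨δ, w, hδ, hδf, hδs, hw, hδst, hδc⟩ := S.run_pick hT₂l hTn hγf hγst ⟨hlen, hmem⟩
      have hlX : (pick n (recsAt n R.rows T₂ T 7)).length < X := by
        have h5 := ho.length_le
        have hX := S.lt_X
        rw [hl, List.length_map]
        omega
      obtain ⟨ε, hε, hεh, hεo, hεa, hεc⟩ := S.run_obstruction hw hlen hlX hmem hδf hδst
        (hδs.out.trans hγo) (hδs.ans.trans hγa)
      exact .inr ⟨l, ε, ho, (hr.trans hδ).trans hε, hεh, hεo.trans hl, hεa, by omega⟩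

end AdjacencyRows

/-- The cost of the output. -/
theorem output_le {B n : ℕ} (hB : 1 ≤ B) :
    ((2 * ((n + 2) / B + 1) + (n + 1) / B + 1 : ℕ) : ℝ) ≤ 400 * scanIO B n := by
  obtain ⟨h1, h2⟩ := le_scanIO B n
  have h3 := add_div_le hB n 2
  have h4 := add_div_le hB n 1
  have h5 : 2 * ((n + 2) / B + 1) + (n + 1) / B + 1 ≤ 3 * (n / B) + 8 := by omega
  have h6 : ((2 * ((n + 2) / B + 1) + (n + 1) / B + 1 : ℕ) : ℝ) ≤ 3 * ((n / B : ℕ) : ℝ) + 8 := by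
    exact_mod_cast h5
  linarith

/-- At the announcement the abstract output is empty, so nothing is buffered and, as `B` is
positive, nothing has been flushed: all I/Os so far are cache misses. -/
theorem Simulates.eq_of_out_eq_nil {σ : ℕ → Type} [∀ k, Inhabited (σ k)]
    {δ : ∀ k, σ k → Act (σ k)} {enc : ∀ k, σ k → ℕ → ℕ} {M B : ℕ} {D : ℕ → ℕ} (hB : 1 ≤ B)
    {c : (compile σ δ enc).Config M} {α : AConf (σ (M - B))} (h : Simulates D B c α)
    (hα : α.out = []) : c.out = [] ∧ c.answer = α.ans ∧ c.ios = α.cost := by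
  obtain ⟨cache, buf, e, -, ho, -, hol, hi, -, ha, -⟩ := h
  rw [hα, List.append_eq_nil_iff] at ho
  rw [ho.1, List.length_nil, eq_comm, Nat.mul_eq_zero] at hol
  exact ⟨ho.1, ha, by omega⟩

/-- There are an algorithm `A` in the I/O model and constants `d`, `C` such that, whenever
`1 ≤ B` and `2 * B ≤ M`, on every graph with `n` vertices and `m` edges in adjacency row
representation, with elements of at most `d * log (n + m + 2)` bits: if the graph is split, `A`
announces this within `C * sort(n + m)` I/Os and then outputs a split partition `(K, I)`, as `|K|`
followed by the elements of `K` and of `I`, within `C * scan(|K| + |I|)` further I/Os; otherwise it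
announces that and outputs an induced `C₄`, `C₅` or `2K₂` within `C * sort(n + m)` I/Os. -/
theorem mainTheorem1 :
    ∃ (A : IOAlgorithm) (d C : ℕ), ∀ M B : ℕ, 1 ≤ B → 2 * B ≤ M →
      ∀ (n : ℕ) (G : SimpleGraph (Fin n)) (R : AdjacencyRows G) (m W : ℕ),
        m = G.edgeSet.ncard → W = (n + m + 2) ^ d →
        (IsSplitGraph G →
          ∃ (K I : List (Fin n)) (c₁ c₂ : A.Config M),
            K.Nodup ∧ I.Nodup ∧ IsSplitPartition G {v | v ∈ K} {v | v ∈ I} ∧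
            IOAlgorithm.Reaches B W (A.init M R.input) c₁ ∧
            c₁.answer = some true ∧ c₁.out = [] ∧
            (c₁.ios : ℝ) ≤ C * sortIO M B (n + m) ∧
            IOAlgorithm.Reaches B W c₁ c₂ ∧ IOAlgorithm.Halted B c₂ ∧
            c₂.out = K.length :: (K ++ I).map Fin.val ∧
            (c₂.ios : ℝ) ≤ c₁.ios + C * scanIO B (K.length + I.length)) ∧
        (¬ IsSplitGraph G →
          ∃ (l : List (Fin n)) (c : A.Config M),
            (InducedCopy G (SimpleGraph.cycleGraph 4) l ∨
              InducedCopy G (SimpleGraph.cycleGraph 5) l ∨ InducedCopy G twoK2 l) ∧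
            IOAlgorithm.Reaches B W (A.init M R.input) c ∧ IOAlgorithm.Halted B c ∧
            c.answer = some false ∧ c.out = l.map Fin.val ∧
            (c.ios : ℝ) ≤ C * sortIO M B (n + m)) := by
  obtain ⟨d, hd⟩ := St.exists_enc_lt
  -- The bound `X = (n + m + 2) ^ (d + 4)` covers encoded states by `d`, and positions, tags and
  -- input entries by the additional `4`; packing a layer into the cells raises it to the power
  -- `64`.
  refine ⟨compile St (fun _ => St.step) (fun _ => St.enc), (d + 4) * 64, 400,
    fun M B hB hM n G R m W hm hW => ?_⟩
  classical
  have hk : 0 < M - B := by omega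
  set X := (n + m + 2) ^ (d + 4) with hXdef
  have hX4 : (n + m + 2) ^ 4 ≤ X := Nat.pow_le_pow_right (by omega) (by omega)
  have hX : n + 2 * m + 6 ≤ X := by
    refine le_trans ?_ hX4
    have h1 : 2 ^ 3 ≤ (n + m + 2) ^ 3 := Nat.pow_le_pow_left (by omega) 3
    have h2 := Nat.mul_le_mul_right (n + m + 2) h1
    have h3 : (n + m + 2) ^ 4 = (n + m + 2) ^ 3 * (n + m + 2) := pow_succ _ 3
    rw [← h3] at h2
    omega
  have S : Setting (M - B) (fun i => R.input.getD i 0) n m R.rows B X :=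
    { (hm ▸ R.layout : Layout (fun i => R.input.getD i 0) n m R.rows) with
      pos_k := hk
      enc_lt := fun s hs j => (hd _ _ _ s hs j).trans_le
        (Nat.pow_le_pow_right (by omega) (by omega))
      lt_X := hX }
  have hXW : X ^ 64 ≤ W := by rw [hW, hXdef, pow_mul]
  have hX1 : 1 < X := by omega
  have hD : ∀ x, R.input.getD x 0 < X := fun x => by
    have := R.input_le x
    omega
  have henc : ∀ s s' : St (M - B), (∀ j < M - B, s.enc j = s'.enc j) → s = s' :=
    fun s s' => St.enc_inj hk s s'
  have hinit : Simulates (fun i => R.input.getD i 0) B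
      ((compile St (fun _ => St.step) (fun _ => St.enc)).init M R.input)
      ⟨default, fun _ => 0, [], none, 0⟩ :=
    simulates_init hB hM henc (St.enc_default _)
  have htame : AConf.Tame St.enc X (⟨default, fun _ => 0, [], none, 0⟩ : AConf (St (M - B))) :=
    ⟨fun j => by rw [St.enc_default]; omega, fun _ => by simp only; omega, by simp,
      by simp only [List.length_nil]; omega⟩
  have hcost := searches_le (n := n) (m := m) hB hM
  obtain ⟨K, I, β, γ, hK, hI, hsp, hβ, hβo, hβa, hβc, hγ, hγh, hγo, hγc⟩ |
    ⟨l, γ, ho, hγ, hγh, hγo, hγa, hγc⟩ := R.run_program hm S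
  · refine ⟨fun _ => ?_, fun h => absurd ⟨_, _, hsp⟩ h⟩
    obtain ⟨hβt, c₁, hc₁, hs₁⟩ := hinit.reaches hB hM hX1 henc hXW hD htame hβ
    obtain ⟨hγt, c', hc', hs'⟩ := hs₁.reaches hB hM hX1 henc hXW hD hβt hγ
    obtain ⟨c₂, hc₂, hc₂h, hc₂o, -, hc₂i⟩ := hs'.halts hB hM hX1 henc hXW hD hγt hγh
    obtain ⟨ho₁, ha₁, hi₁⟩ := hs₁.eq_of_out_eq_nil hB hβo
    have hKI : K.length + I.length = n := by
      have hnd : (K ++ I).Nodup :=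
        hK.append hI fun v hv hv' => Set.disjoint_left.1 hsp.disjoint hv hv'
      have huniv : (K ++ I).toFinset = Finset.univ := by
        ext v
        have : v ∈ {v | v ∈ K} ∪ {v | v ∈ I} := hsp.union ▸ Set.mem_univ v
        simpa using this
      rw [← List.length_append, ← List.toFinset_card_of_nodup hnd, huniv, Finset.card_univ,
        Fintype.card_fin]
    refine ⟨K, I, c₁, c₂, hK, hI, hsp, hc₁, ha₁.trans hβa, ho₁, ?_, hc'.trans hc₂, hc₂h,
      hc₂o.trans hγo, ?_⟩
    · refine le_trans (Nat.cast_le.2 ?_) (hcost.trans_eq (by norm_num))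
      omega
    · rw [hKI]
      have h1 := output_le (n := n) hB
      have h2 : c₂.ios ≤ c₁.ios + (2 * ((n + 2) / B + 1) + (n + 1) / B + 1) := by
        have hlen : γ.out.length = n + 1 := by
          rw [hγo, List.length_cons, List.length_map, List.length_append, hKI]
        rw [hlen] at hc₂i
        omega
      have h3 : (c₂.ios : ℝ) ≤ c₁.ios + ((2 * ((n + 2) / B + 1) + (n + 1) / B + 1 : ℕ) : ℝ) := by
        exact_mod_cast h2
      exact h3.trans (add_le_add_right (h1.trans_eq (by norm_num)) _)
  · refine ⟨fun h => absurd h ho.not_isSplitGraph, fun _ => ?_⟩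
    obtain ⟨hγt, c', hc', hs'⟩ := hinit.reaches hB hM hX1 henc hXW hD htame hγ
    obtain ⟨c, hc, hch, hco, hca, hci⟩ := hs'.halts hB hM hX1 henc hXW hD hγt hγh
    refine ⟨l, c, ho, hc'.trans hc, hch, hca.trans hγa, hco.trans hγo, ?_⟩
    refine le_trans (Nat.cast_le.2 ?_) (hcost.trans_eq (by norm_num))
    -- An obstruction has at most five vertices, so its output takes at most six I/Os, which the
    -- summand `8` in `searches_le` pays for.
    have h1 : γ.out.length / B ≤ 5 := by
      refine (Nat.div_le_self _ _).trans ?_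
      rw [hγo, List.length_map]
      exact ho.length_le
    omega
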